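/- Let $k$ be an algebraically closed field of characteristic different from $2$, let $F\subset\mathbb{P}^3_k$ be a smooth cubic surface with equation $f=0$, and let $T$ be a tritangent plane of $F$, cutting $F$ along three distinct lines $\ell_1,\ell_2,\ell_3$ that form a triangle (i.e. do not pass through one common point). For planes $\Pi_1,\Pi_2,\Pi_3\neq T$ with $\ell_i\subset \Pi_i$, write $\Pi_i\cap F=\ell_i+K_i$ with residual conic $K_i$, and let $G(\Pi_1,\Pi_2,\Pi_3)$ be the quadric that cuts out $K_1+K_2+K_3$ on $F$ (Cremona's family of quadrics). Let the Steinerian surface $S$ be the Zariski closure of the set of singular points of all quadrics $G(\Pi_1,\Pi_2,\Pi_3)$. A conjugate triad is a set $\{A_1,A_2,A_3\}$ of tritangent planes of $F$ for which there are tritangent planes $B_1,B_2,B_3$ such that the nine intersections $A_i\cap B_j$ are nine distinct lines on $F$. Then $S$ is an irreducible quartic surface. It has exactly $12$ singular points, and all of them are nodes (ordinary double points). There are exactly $16$ conjugate triads $\{T,A,B\}$ containing $T$; the intersections $A\cap B$ are $16$ distinct lines, and all of them lie on $S$. The $12$ nodes and these $16$ lines form a configuration $(12_4,16_3)$: each of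 the nodes lies on exactly four of the lines, and each of the lines contains exactly three of the nodes. -/

import Mathlib

open scoped LinearAlgebra.Projectivization

namespace CremonaQuartic

variable {k : Type*} [Field k]

/-- Homogeneous coordinate space of projective 3-space. -/
abbrev V4 (k : Type*) [Field k] : Type _ := Fin 4 → k

/-- The projective space of dimension three. -/
abbrev P3 (k : Type*) [Field k] : Type _ := ℙ k (V4 k)

/-- Polynomials in the four homogeneous coordinates. -/
abbrev Form (k : Type*) [Field k] : Type _ := MvPolynomial (Fin 4) k

/-- The points of the projective linear subspace attached to the linear subspace `W`;
lines and planes are linear subspaces of dimension two and three. -/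
def pts (W : Submodule k (V4 k)) : Set (P3 k) := {p | p.submodule ≤ W}

/-- Zero locus in projective 3-space (used only for homogeneous polynomials, for which the value
of `g` being zero does not depend on the representative). -/
def zeroLocus (g : Form k) : Set (P3 k) := {p | MvPolynomial.eval p.rep g = 0}

/-- Singular points of the surface `g = 0`: the form and all its partial derivatives vanish. -/
def singularPoints (g : Form k) : Set (P3 k) :=
  {p | MvPolynomial.eval p.rep g = 0 ∧
    ∀ i, MvPolynomial.eval p.rep (MvPolynomial.pderiv i g) = 0}

/-- The Hessian matrix of `g` at (a representative of) `p`. -/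
noncomputable def hessianAt (g : Form k) (p : P3 k) : Matrix (Fin 4) (Fin 4) k :=
  Matrix.of fun i j =>
    MvPolynomial.eval p.rep (MvPolynomial.pderiv i (MvPolynomial.pderiv j g))

/-- A node (ordinary double point, characteristic not two): a singular point at which the tangent
cone is a nondegenerate quadratic cone. At a singular point the vector of coordinates of `p` lies
in the kernel of the homogeneous Hessian, and the induced form on the quotient by it is the
Hessian form in local coordinates, so nondegeneracy means that the rank is three. -/
def IsNode (g : Form k) (p : P3 k) : Prop :=
  p ∈ singularPoints g ∧ (hessianAt g p).rank = 3

/-- Zariski closure of a set of points of projective 3-space. -/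
def zariskiClosure (A : Set (P3 k)) : Set (P3 k) :=
  {p | ∀ (d : ℕ) (g : Form k), g.IsHomogeneous d → A ⊆ zeroLocus g → p ∈ zeroLocus g}

/-- `f` is the equation of a smooth cubic surface (`k` will be algebraically closed). -/
def IsSmoothCubic (f : Form k) : Prop :=
  f.IsHomogeneous 3 ∧ singularPoints f = ∅

/-- The plane `T` cuts the cubic surface `f = 0` along the three distinct lines `l 0, l 1, l 2`. -/
def IsTritangentWith (f : Form k) (T : Submodule k (V4 k)) (l : Fin 3 → Submodule k (V4 k)) :
    Prop :=
  Module.finrank k T = 3 ∧ (∀ i, Module.finrank k (l i) = 2) ∧ Function.Injective l ∧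
    pts T ∩ zeroLocus f = ⋃ i, pts (l i)

/-- `T` is a tritangent plane of the cubic surface `f = 0`. -/
def IsTritangentPlane (f : Form k) (T : Submodule k (V4 k)) : Prop :=
  ∃ l, IsTritangentWith f T l

/-- The linear form `a` is an equation of the plane `W`. -/
def IsEquationOf (a : Form k) (W : Submodule k (V4 k)) : Prop :=
  a.IsHomogeneous 1 ∧ zeroLocus a = pts W

/-- Let `F` be the cubic surface `f = 0`, let `T` cut `F` along the lines `l 0 + l 1 + l 2`, and
let the plane `P i ≠ T` belong to the pencil of planes through `l i`. It cuts `F` along `l i + K i`,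
where `K i` is the residual conic. This says that the quadric `Q = 0` cuts out
`K 0 + K 1 + K 2` on `F`. As divisors on `F`, the sum of the `K i` is
`(P 0 + P 1 + P 2) ∩ F` minus `T ∩ F`, so the condition is that the cubic forms `w * Q` and
`π 0 * π 1 * π 2`, where `w` and `π i` are equations of `T` and `P i`, cut out the same
subscheme (divisor) of `F`. -/
def CutsOutResidualConics (f : Form k) (T : Submodule k (V4 k))
    (l P : Fin 3 → Submodule k (V4 k)) (Q : Form k) : Prop :=
  (∀ i, Module.finrank k (P i) = 3 ∧ l i ≤ P i ∧ P i ≠ T) ∧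
  Q.IsHomogeneous 2 ∧
  ∃ (w : Form k) (π : Fin 3 → Form k), IsEquationOf w T ∧ (∀ i, IsEquationOf (π i) (P i)) ∧
    Ideal.span {f, w * Q} = Ideal.span {f, ∏ i, π i}

/-- The Steinerian surface of Cremona's family of quadrics attached to the tritangent plane `T`
with lines `l i`: the Zariski closure of the locus of singular points of the quadrics of the
family. The planes of the pencils are different from `T`: when one of them is `T` the quadric is a
pair of planes, and the singular points of such pairs already sweep out the whole space. -/
def steinerian (f : Form k) (T : Submodule k (V4 k)) (l : Fin 3 → Submodule k (V4 k)) :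
    Set (P3 k) :=
  zariskiClosure {p | ∃ P Q, CutsOutResidualConics f T l P Q ∧ p ∈ singularPoints Q}

/-- A conjugate triad of tritangent planes: a set `{A 0, A 1, A 2}` of tritangent planes for which
there are tritangent planes `B 0, B 1, B 2` such that the nine intersections `A i ∩ B j` are nine
distinct lines on the cubic surface (one half of a Steiner trihedral pair). -/
def IsConjugateTriad (f : Form k) (τ : Set (Submodule k (V4 k))) : Prop :=
  ∃ A B : Fin 3 → Submodule k (V4 k),
    τ = Set.range A ∧
    (∀ i, IsTritangentPlane f (A i)) ∧ (∀ j, IsTritangentPlane f (B j)) ∧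
    (∀ i j, Module.finrank k (A i ⊓ B j : Submodule k (V4 k)) = 2 ∧
      pts (A i ⊓ B j) ⊆ zeroLocus f) ∧
    Function.Injective fun ij : Fin 3 × Fin 3 => A ij.1 ⊓ B ij.2

/-- The conjugate triads that contain the given plane `T`. -/
def triadsThrough (f : Form k) (T : Submodule k (V4 k)) : Set (Set (Submodule k (V4 k))) :=
  {τ | IsConjugateTriad f τ ∧ T ∈ τ}

/-- The intersection of the planes of the triad `τ` other than `T`. -/
def triadLine (T : Submodule k (V4 k)) (τ : Set (Submodule k (V4 k))) : Submodule k (V4 k) :=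
  sInf (τ \ {T})

/-- Two sets `A`, `B` and a relation form an abstract configuration of type `(a_c, b_d)`. -/
def IsConfiguration {α β : Type*} (A : Set α) (B : Set β) (R : α → β → Prop) (a c b d : ℕ) :
    Prop :=
  A.ncard = a ∧ B.ncard = b ∧
    (∀ x ∈ A, {y ∈ B | R x y}.ncard = c) ∧ (∀ y ∈ B, {x ∈ A | R x y}.ncard = d)

end CremonaQuartic

/-! A linear change of coordinates and a rescaling turn the triangle into `x = w = 0`, `y = w = 0`,
`z = w = 0` and the cubic into `f = x y z + w q` with a quadratic form `q`. The planes of the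
pencils are then `X_i = x_i + t_i w = 0`, and `f = X_0 X_1 X_2 + w Q_t`, where `Q_t` is the Cremona
quadric with parameters `t` (`Coef.f_eq`). At a singular point of `Q_t` one has `f = X_0 X_1 X_2`
and `f_i = X_j X_k` for the partial derivatives in `x, y, z`, hence `f_0 f_1 f_2 = f²`. The
difference of the two sides is `w²` times a quartic `g` (`Coef.mul_g`). Conversely, a zero of `g`
with `w f ≠ 0` is singular on the `Q_t` with `X_i = f / f_i`. So `S` is `g = 0` as soon as `g` is
known to be irreducible (`Coef.steinerian_eq`).

The nodes are the vertices of the singular residual conics in the three pencils. A plane `x + s w =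
0` has such a vertex exactly when `s` is a root of a polynomial of degree four. Smoothness of the
cubic makes the vertex unique and the roots simple (`Coef.Smooth.derivative_disc_ne_zero`), so there
are `3 · 4 = 12` vertices. Each is a node of `g`, by a direct computation of the Hessian
(`Coef.hess_rank_of_isVertex`), and there is no other singular point
(`Coef.exists_vertex_of_singularAt`). Irreducibility follows: two factors of `g` would share a zero
in projective space, and there the Hessian has rank at most two (`irreducible_of_isNode`).

A conjugate triad `{T, A, B}` is the same as a Cremona quadric that splits as `Q_t = A B`, since
then `f = X_0 X_1 X_2 + w A B` (`Coef.exists_isSplit_of_isConjugateTriad`,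
`Coef.IsTrihedralPair.isConjugateTriad`). The line `A = B = 0` consists of singular points of `Q_t`,
so it lies on `S`; it meets the plane `X_i = 0` in the vertex of that plane. Conversely, vertices in
planes of two different pencils lie on exactly one such line (`Coef.exists_isSplit`,
`Coef.IsSplit.eq_of_eq`). This gives `4 · 4 = 16` triads, three nodes on each line and four lines
through each node. -/

namespace CremonaQuartic

variable {k : Type*} [Field k]

open MvPolynomial

/-! ### Homogeneous forms at points of projective space. -/

section Basic

theorem eval_smul_of_isHomogeneous {g : Form k} {d : ℕ} (hg : g.IsHomogeneous d) (c : k)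
    (v : V4 k) : eval (c • v) g = c ^ d * eval v g := by
  rw [eval_eq', eval_eq', Finset.mul_sum]
  refine Finset.sum_congr rfl fun m hm => ?_
  have hd := hg.degree_eq_sum_deg_support hm
  have : d = ∑ i, m i := by
    rw [hd]; exact Finset.sum_subset (Finset.subset_univ _) (by simp)
  simp only [Pi.smul_apply, smul_eq_mul, mul_pow, Finset.prod_mul_distrib, Finset.prod_pow_eq_pow_sum, ← this]
  ring

theorem exists_rep_mk (v : V4 k) (hv : v ≠ 0) :
    ∃ a : k, a ≠ 0 ∧ (Projectivization.mk k v hv).rep = a • v := by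
  obtain ⟨a, ha⟩ := Projectivization.exists_smul_eq_mk_rep k v hv
  exact ⟨a, a.ne_zero, ha.symm⟩

theorem mk_mem_zeroLocus {g : Form k} {d : ℕ} (hg : g.IsHomogeneous d) (v : V4 k) (hv : v ≠ 0) :
    Projectivization.mk k v hv ∈ zeroLocus g ↔ eval v g = 0 := by
  obtain ⟨a, ha, h⟩ := exists_rep_mk v hv
  simp [zeroLocus, h, eval_smul_of_isHomogeneous hg, ha]

theorem mk_mem_pts (W : Submodule k (V4 k)) (v : V4 k) (hv : v ≠ 0) :
    Projectivization.mk k v hv ∈ pts W ↔ v ∈ W := by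
  simp [pts, Projectivization.submodule_mk]

theorem mk_mem_singularPoints {g : Form k} {d : ℕ} (hg : g.IsHomogeneous d) (v : V4 k)
    (hv : v ≠ 0) : Projectivization.mk k v hv ∈ singularPoints g ↔
      eval v g = 0 ∧ ∀ i, eval v (pderiv i g) = 0 := by
  obtain ⟨a, ha, h⟩ := exists_rep_mk v hv
  simp [singularPoints, h, eval_smul_of_isHomogeneous hg,
    fun i => eval_smul_of_isHomogeneous (hg.pderiv (i := i)), ha]

/-- The matrix of second partial derivatives at a vector. -/
noncomputable def hess (g : Form k) (v : V4 k) : Matrix (Fin 4) (Fin 4) k :=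
  Matrix.of fun i j => eval v (pderiv i (pderiv j g))

theorem mk_isNode {g : Form k} {d : ℕ} (hg : g.IsHomogeneous d) (v : V4 k) (hv : v ≠ 0) :
    IsNode g (Projectivization.mk k v hv) ↔
      (eval v g = 0 ∧ ∀ i, eval v (pderiv i g) = 0) ∧ (hess g v).rank = 3 := by
  obtain ⟨a, ha, h⟩ := exists_rep_mk v hv
  have : hessianAt g (Projectivization.mk k v hv) = a ^ (d - 1 - 1) • hess g v := by
    ext i j
    simp [hessianAt, hess, h, eval_smul_of_isHomogeneous ((hg.pderiv (i := j)).pderiv (i := i))]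
  rw [IsNode, mk_mem_singularPoints hg, this, Matrix.rank_smul_of_mem_nonZeroDivisors]
  simpa using pow_ne_zero _ ha

theorem le_of_pts_subset {W W' : Submodule k (V4 k)} (h : pts W ⊆ pts W') : W ≤ W' := by
  intro v hv
  by_cases h0 : v = 0
  · simp [h0]
  · exact (mk_mem_pts W' v h0).1 (h ((mk_mem_pts W v h0).2 hv))

end Basic

/-! ### Linear changes of coordinates: forms, gradients, Hessians. -/

section Pull

/-- Composition of a form with a linear map. -/
noncomputable def pull (φ : V4 k →ₗ[k] V4 k) : Form k →ₐ[k] Form k :=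
  aeval fun i => ∑ j, C (φ (Pi.single j 1) i) * X j

theorem eval_pull (φ : V4 k →ₗ[k] V4 k) (g : Form k) (v : V4 k) :
    eval v (pull φ g) = eval (φ v) g := by
  induction g using MvPolynomial.induction_on with
  | C a => simp [pull]
  | add p q hp hq => simp [hp, hq]
  | mul_X p i hp =>
    rw [map_mul, map_mul, map_mul, hp, eval_X, pull, aeval_X]
    congr 1
    have hv : v = ∑ j, v j • Pi.single j (1 : k) := by
      ext i; simp [Finset.sum_apply, Pi.single_apply]
    conv_rhs => rw [hv]
    simp [Finset.sum_apply, mul_comm]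

theorem pull_isHomogeneous (φ : V4 k →ₗ[k] V4 k) {g : Form k} {d : ℕ} (hg : g.IsHomogeneous d) :
    (pull φ g).IsHomogeneous d := by
  have := hg.aeval (fun i => ∑ j, C (φ (Pi.single j 1) i) * X j)
    (fun i => IsHomogeneous.sum _ _ 1 fun j _ => isHomogeneous_C_mul_X _ _)
  rwa [one_mul] at this

theorem pderiv_pull (φ : V4 k →ₗ[k] V4 k) (g : Form k) (j : Fin 4) :
    pderiv j (pull φ g) = ∑ i, C (φ (Pi.single j 1) i) * pull φ (pderiv i g) := by
  induction g using MvPolynomial.induction_on with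
  | C a => simp [pull]
  | add p q hp hq => simp [hp, hq, mul_add, Finset.sum_add_distrib]
  | mul_X p i hp =>
    simp only [map_mul, Derivation.leibniz, hp, smul_eq_mul, map_add, mul_add, Finset.sum_add_distrib]
    have h1 : pderiv j (pull φ (X i)) = C (φ (Pi.single j 1) i) := by
      simp [pull, Pi.single_apply, pderiv_X]
    rw [h1]
    congr 1
    · simp [pderiv_X, Pi.single_apply, mul_comm]
    · rw [Finset.mul_sum]; exact Finset.sum_congr rfl fun _ _ => by ring

theorem hess_pull (φ : V4 k →ₗ[k] V4 k) (g : Form k) (v : V4 k) :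
    hess (pull φ g) v = (LinearMap.toMatrix' φ).transpose * hess g (φ v) * LinearMap.toMatrix' φ := by
  ext i j
  simp only [hess, pderiv_pull, Matrix.of_apply, Matrix.mul_apply, map_sum, Derivation.leibniz,
    pderiv_C, smul_eq_mul, mul_zero, add_zero, map_mul, eval_C, eval_pull, Matrix.transpose_apply,
    LinearMap.toMatrix'_apply, Finset.mul_sum, Finset.sum_mul]
  refine Finset.sum_congr rfl fun x _ => Finset.sum_congr rfl fun y _ => ?_
  ring

theorem eq_of_eval_eq [Infinite k] {g g' : Form k} (h : ∀ v, eval v g = eval v g') : g = g' :=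
  MvPolynomial.funext h

variable (φ : V4 k ≃ₗ[k] V4 k)

theorem pull_symm_pull [Infinite k] (g : Form k) : pull φ.symm.toLinearMap (pull φ.toLinearMap g) = g :=
  eq_of_eval_eq fun v => by simp [eval_pull]

theorem pull_pull_symm [Infinite k] (g : Form k) : pull φ.toLinearMap (pull φ.symm.toLinearMap g) = g :=
  eq_of_eval_eq fun v => by simp [eval_pull]

/-- The algebra automorphism given by a linear change of coordinates. -/
noncomputable def pullEquiv [Infinite k] : Form k ≃ₐ[k] Form k :=
  AlgEquiv.ofAlgHom (pull φ.toLinearMap) (pull φ.symm.toLinearMap)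
    (AlgHom.ext fun g => pull_pull_symm φ g) (AlgHom.ext fun g => pull_symm_pull φ g)

/-- The projective transformation attached to a linear automorphism. -/
noncomputable def pmap : P3 k ≃ P3 k where
  toFun := Projectivization.map φ.toLinearMap φ.injective
  invFun := Projectivization.map φ.symm.toLinearMap φ.symm.injective
  left_inv p := by
    induction p using Projectivization.ind with
    | h v hv => simp [Projectivization.map_mk]
  right_inv p := by
    induction p using Projectivization.ind with
    | h v hv => simp [Projectivization.map_mk]

theorem pmap_mk (v : V4 k) (hv : v ≠ 0) : pmap φ (Projectivization.mk k v hv) =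
    Projectivization.mk k (φ v) (by simpa using hv) := rfl

theorem pmap_symm_apply (p : P3 k) : pmap φ.symm p = (pmap φ).symm p := rfl

theorem zeroLocus_pull {g : Form k} {d : ℕ} (hg : g.IsHomogeneous d) :
    zeroLocus (pull φ.toLinearMap g) = pmap φ ⁻¹' zeroLocus g := by
  ext p
  induction p using Projectivization.ind with
  | h v hv =>
    rw [mk_mem_zeroLocus (pull_isHomogeneous _ hg), Set.mem_preimage, pmap_mk, mk_mem_zeroLocus hg, eval_pull]
    rfl

theorem pts_comap (W : Submodule k (V4 k)) :
    pts (W.comap φ.toLinearMap) = pmap φ ⁻¹' pts W := by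
  ext p
  induction p using Projectivization.ind with
  | h v hv => rw [mk_mem_pts, Set.mem_preimage, pmap_mk, mk_mem_pts]; rfl

/-- By the chain rule the gradient of the pullback is the transposed matrix of `φ` applied to the
gradient of `g`, and that matrix is invertible. -/
theorem singular_pull_iff (g : Form k) (v : V4 k) :
    (eval v (pull φ.toLinearMap g) = 0 ∧ ∀ i, eval v (pderiv i (pull φ.toLinearMap g)) = 0) ↔
      (eval (φ v) g = 0 ∧ ∀ i, eval (φ v) (pderiv i g) = 0) := by
  have key : ∀ (φ : V4 k ≃ₗ[k] V4 k) (g : Form k) (v : V4 k),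
      (eval (φ v) g = 0 ∧ ∀ i, eval (φ v) (pderiv i g) = 0) →
      (eval v (pull φ.toLinearMap g) = 0 ∧ ∀ i, eval v (pderiv i (pull φ.toLinearMap g)) = 0) := by
    rintro φ g v ⟨h, h'⟩
    refine ⟨by rw [eval_pull]; exact h, fun i => ?_⟩
    rw [pderiv_pull, map_sum]
    refine Finset.sum_eq_zero fun j _ => ?_
    rw [map_mul, eval_pull]
    change _ * eval (φ v) _ = 0
    rw [h', mul_zero]
  refine ⟨fun h => ?_, key φ g v⟩
  rw [eval_pull] at h
  refine ⟨h.1, fun i => ?_⟩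
  have h2 := h.2
  simp only [pderiv_pull, map_sum, map_mul, eval_C, eval_pull] at h2
  have h3 : (LinearMap.toMatrix' φ.toLinearMap).transpose.mulVec
      (fun i => eval (φ v) (pderiv i g)) = 0 := by
    ext j
    simpa [Matrix.mulVec, dotProduct, LinearMap.toMatrix'_apply] using h2 j
  have h4 : IsUnit (LinearMap.toMatrix' φ.toLinearMap).transpose := by
    rw [Matrix.isUnit_transpose]
    exact (LinearMap.isUnit_toMatrix'_iff (f := φ.toLinearMap)).2 (by
      rw [Module.End.isUnit_iff]; exact φ.bijective)
  have h5 := Matrix.mulVec_injective_iff_isUnit.2 h4 (h3.trans (Matrix.mulVec_zero _).symm)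
  exact congrFun h5 i

theorem singularPoints_pull {g : Form k} {d : ℕ} (hg : g.IsHomogeneous d) :
    singularPoints (pull φ.toLinearMap g) = pmap φ ⁻¹' singularPoints g := by
  ext p
  induction p using Projectivization.ind with
  | h v hv =>
    rw [mk_mem_singularPoints (pull_isHomogeneous _ hg), Set.mem_preimage, pmap_mk,
      mk_mem_singularPoints hg, singular_pull_iff]

/-- The Hessian changes by a congruence with an invertible matrix, which preserves the rank. -/
theorem isNode_pull {g : Form k} {d : ℕ} (hg : g.IsHomogeneous d) (p : P3 k) :
    IsNode (pull φ.toLinearMap g) p ↔ IsNode g (pmap φ p) := by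
  induction p using Projectivization.ind with
  | h v hv =>
    rw [pmap_mk, mk_isNode hg, mk_isNode (pull_isHomogeneous _ hg), singular_pull_iff, hess_pull]
    have hu : IsUnit (LinearMap.toMatrix' φ.toLinearMap) :=
      (LinearMap.isUnit_toMatrix'_iff (f := φ.toLinearMap)).2 (by
        rw [Module.End.isUnit_iff]; exact φ.bijective)
    rw [Matrix.rank_mul_eq_left_of_isUnit_det _ _ ((Matrix.isUnit_iff_isUnit_det _).1 hu),
      Matrix.rank_mul_eq_right_of_isUnit_det]
    · rfl
    · rw [Matrix.det_transpose]; exact (Matrix.isUnit_iff_isUnit_det _).1 hu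

end Pull

end CremonaQuartic

namespace CremonaQuartic

variable {k : Type*} [Field k]

open MvPolynomial

/-! ### Invariance of all notions of the theorem under projective transformations. -/

section Transport

set_option linter.unusedSectionVars false

variable [Infinite k] (φ : V4 k ≃ₗ[k] V4 k)

/-- The preimage of a linear subspace under a linear automorphism. -/
abbrev cmap (W : Submodule k (V4 k)) : Submodule k (V4 k) := W.comap φ.toLinearMap

theorem mem_cmap (W : Submodule k (V4 k)) (v : V4 k) : v ∈ cmap φ W ↔ φ v ∈ W := Iff.rfl

theorem cmap_symm_cmap (W : Submodule k (V4 k)) : cmap φ.symm (cmap φ W) = W := by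
  ext v; simp

theorem cmap_cmap_symm (W : Submodule k (V4 k)) : cmap φ (cmap φ.symm W) = W := by
  ext v; simp

theorem cmap_injective : Function.Injective (cmap φ) :=
  Function.LeftInverse.injective (cmap_symm_cmap φ)

theorem cmap_mono {W W' : Submodule k (V4 k)} (h : W ≤ W') : cmap φ W ≤ cmap φ W' :=
  fun _ hv => h hv

theorem finrank_cmap (W : Submodule k (V4 k)) :
    Module.finrank k (cmap φ W) = Module.finrank k W := by
  rw [cmap, LinearEquiv.toLinearMap, Submodule.comap_equiv_eq_map_symm, LinearEquiv.finrank_map_eq]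

theorem isEquationOf_pull {a : Form k} {W : Submodule k (V4 k)} (h : IsEquationOf a W) :
    IsEquationOf (pull φ.toLinearMap a) (cmap φ W) :=
  ⟨pull_isHomogeneous _ h.1, by rw [zeroLocus_pull φ h.1, h.2, pts_comap]⟩

theorem isTritangentWith_pull {f : Form k} (hf : f.IsHomogeneous 3) {T : Submodule k (V4 k)}
    {l : Fin 3 → Submodule k (V4 k)} (h : IsTritangentWith f T l) :
    IsTritangentWith (pull φ.toLinearMap f) (cmap φ T) (fun i => cmap φ (l i)) := by
  obtain ⟨h1, h2, h3, h4⟩ := h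
  refine ⟨by rw [finrank_cmap, h1], fun i => by rw [finrank_cmap, h2],
    (cmap_injective φ).comp h3, ?_⟩
  rw [zeroLocus_pull φ hf, pts_comap, ← Set.preimage_inter, h4, Set.preimage_iUnion]
  exact Set.iUnion_congr fun i => (pts_comap φ (l i)).symm

theorem isTritangentPlane_pull {f : Form k} (hf : f.IsHomogeneous 3) {T : Submodule k (V4 k)}
    (h : IsTritangentPlane f T) : IsTritangentPlane (pull φ.toLinearMap f) (cmap φ T) := by
  obtain ⟨l, hl⟩ := h
  exact ⟨_, isTritangentWith_pull φ hf hl⟩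

theorem isConjugateTriad_pull {f : Form k} (hf : f.IsHomogeneous 3)
    {τ : Set (Submodule k (V4 k))} (h : IsConjugateTriad f τ) :
    IsConjugateTriad (pull φ.toLinearMap f) (cmap φ '' τ) := by
  obtain ⟨A, B, rfl, hA, hB, h1, h2⟩ := h
  refine ⟨fun i => cmap φ (A i), fun i => cmap φ (B i), (Set.range_comp _ _).symm,
    fun i => isTritangentPlane_pull φ hf (hA i), fun i => isTritangentPlane_pull φ hf (hB i),
    fun i j => ⟨?_, ?_⟩, ?_⟩
  · exact (finrank_cmap φ (A i ⊓ B j)).trans (h1 i j).1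
  · change pts (cmap φ (A i ⊓ B j)) ⊆ _
    rw [pts_comap, zeroLocus_pull φ hf]
    exact Set.preimage_mono (h1 i j).2
  · exact (cmap_injective φ).comp h2

theorem image_cmap_symm_image (τ : Set (Submodule k (V4 k))) :
    cmap φ '' (cmap φ.symm '' τ) = τ := by
  rw [← Set.image_comp, show cmap φ ∘ cmap φ.symm = id from
    _root_.funext fun W => cmap_cmap_symm φ W, Set.image_id]

theorem triadsThrough_pull {f : Form k} (hf : f.IsHomogeneous 3) (T : Submodule k (V4 k)) :
    triadsThrough (pull φ.toLinearMap f) (cmap φ T) =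
      Set.image (cmap φ) '' triadsThrough f T := by
  ext τ
  constructor
  · rintro ⟨h1, h2⟩
    refine ⟨cmap φ.symm '' τ, ⟨?_, ?_⟩, image_cmap_symm_image φ τ⟩
    · have := isConjugateTriad_pull φ.symm (pull_isHomogeneous _ hf) h1
      rwa [pull_symm_pull] at this
    · exact ⟨_, h2, cmap_symm_cmap φ T⟩
  · rintro ⟨τ, ⟨h1, h2⟩, rfl⟩
    exact ⟨isConjugateTriad_pull φ hf h1, ⟨_, h2, rfl⟩⟩

theorem triadLine_cmap (T : Submodule k (V4 k)) (τ : Set (Submodule k (V4 k))) :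
    triadLine (cmap φ T) (cmap φ '' τ) = cmap φ (triadLine T τ) := by
  have : cmap φ '' τ \ {cmap φ T} = cmap φ '' (τ \ {T}) := by
    rw [Set.image_sdiff (cmap_injective φ), Set.image_singleton]
  rw [triadLine, this, triadLine]
  ext v
  simp only [Submodule.mem_sInf, mem_cmap, Set.forall_mem_image]

theorem cutsOutResidualConics_pull {f : Form k} {T : Submodule k (V4 k)}
    {l P : Fin 3 → Submodule k (V4 k)} {Q : Form k} (h : CutsOutResidualConics f T l P Q) :
    CutsOutResidualConics (pull φ.toLinearMap f) (cmap φ T) (fun i => cmap φ (l i))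
      (fun i => cmap φ (P i)) (pull φ.toLinearMap Q) := by
  obtain ⟨h1, h2, w, π, h3, h4, h5⟩ := h
  refine ⟨fun i => ⟨by rw [finrank_cmap, (h1 i).1], cmap_mono φ (h1 i).2.1,
    (cmap_injective φ).ne (h1 i).2.2⟩, pull_isHomogeneous _ h2, pull φ.toLinearMap w,
    fun i => pull φ.toLinearMap (π i), isEquationOf_pull φ h3, fun i => isEquationOf_pull φ (h4 i), ?_⟩
  have := congrArg (Ideal.map (pull φ.toLinearMap)) h5
  rw [Ideal.map_span, Ideal.map_span, Set.image_pair, Set.image_pair, map_mul, map_prod] at this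
  exact this

theorem zariskiClosure_preimage (A : Set (P3 k)) :
    zariskiClosure (pmap φ ⁻¹' A) = pmap φ ⁻¹' zariskiClosure A := by
  ext p
  constructor
  · intro h d g hg hA
    have := h d _ (pull_isHomogeneous φ.toLinearMap hg)
      (by rw [zeroLocus_pull φ hg]; exact Set.preimage_mono hA)
    rwa [zeroLocus_pull φ hg] at this
  · intro h d g hg hA
    have := h d _ (pull_isHomogeneous φ.symm.toLinearMap hg) (by
      rw [zeroLocus_pull φ.symm hg]
      intro q hq
      rw [Set.mem_preimage, pmap_symm_apply]
      exact hA (by simpa using hq))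
    rw [zeroLocus_pull φ.symm hg, Set.mem_preimage, pmap_symm_apply, Equiv.symm_apply_apply] at this
    exact this

theorem steinerian_pull (f : Form k) (T : Submodule k (V4 k))
    (l : Fin 3 → Submodule k (V4 k)) :
    steinerian (pull φ.toLinearMap f) (cmap φ T) (fun i => cmap φ (l i)) =
      pmap φ ⁻¹' steinerian f T l := by
  rw [steinerian, steinerian, ← zariskiClosure_preimage]
  congr 1
  ext p
  constructor
  · rintro ⟨P, Q, h, hp⟩
    have h' := cutsOutResidualConics_pull φ.symm h
    simp only [pull_symm_pull, cmap_symm_cmap] at h'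
    refine ⟨_, _, h', ?_⟩
    rw [← Set.mem_preimage, ← singularPoints_pull φ h'.2.1, pull_pull_symm]
    exact hp
  · rintro ⟨P, Q, h, hp⟩
    refine ⟨_, _, cutsOutResidualConics_pull φ h, ?_⟩
    rwa [singularPoints_pull φ h.2.1]

theorem isSmoothCubic_pull {f : Form k} (hf : IsSmoothCubic f) :
    IsSmoothCubic (pull φ.toLinearMap f) :=
  ⟨pull_isHomogeneous _ hf.1, by rw [singularPoints_pull φ hf.1, hf.2, Set.preimage_empty]⟩

/-- Injectivity is needed on `A` and `B` only. The lemma serves both for projective transformations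
and for passing from a model by parameters to actual points and lines. -/
theorem IsConfiguration.image {α β α' β' : Type*} {A : Set α} {B : Set β}
    {R : α → β → Prop} {R' : α' → β' → Prop} {u : α → α'} {v : β → β'}
    (hu : Set.InjOn u A) (hv : Set.InjOn v B) (hR : ∀ x ∈ A, ∀ y ∈ B, R' (u x) (v y) ↔ R x y)
    {a c b d : ℕ} (h : IsConfiguration A B R a c b d) :
    IsConfiguration (u '' A) (v '' B) R' a c b d := by
  obtain ⟨h1, h2, h3, h4⟩ := h
  refine ⟨by rw [hu.ncard_image, h1], by rw [hv.ncard_image, h2], ?_, ?_⟩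
  · rintro _ ⟨x, hx, rfl⟩
    rw [← h3 x hx, ← (hv.mono (Set.sep_subset _ _)).ncard_image]
    congr 1
    ext y
    simp only [Set.mem_ofPred, Set.mem_image]
    constructor
    · rintro ⟨⟨y, hy, rfl⟩, h⟩; exact ⟨y, ⟨hy, (hR _ hx _ hy).1 h⟩, rfl⟩
    · rintro ⟨y, ⟨hy, h⟩, rfl⟩; exact ⟨⟨y, hy, rfl⟩, (hR _ hx _ hy).2 h⟩
  · rintro _ ⟨y, hy, rfl⟩
    rw [← h4 y hy, ← (hu.mono (Set.sep_subset _ _)).ncard_image]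
    congr 1
    ext x
    simp only [Set.mem_ofPred, Set.mem_image]
    constructor
    · rintro ⟨⟨x, hx, rfl⟩, h⟩; exact ⟨x, ⟨hx, (hR _ hx _ hy).1 h⟩, rfl⟩
    · rintro ⟨x, ⟨hx, h⟩, rfl⟩; exact ⟨⟨x, hx, rfl⟩, (hR _ hx _ hy).2 h⟩

/-- The Steinerian surface is an irreducible nodal quartic, and its nodes form a configuration
`(12_4, 16_3)` with the lines of the conjugate triads through the tritangent plane. -/
def SteinerianIsNodalQuartic (f : Form k) (T : Submodule k (V4 k))
    (l : Fin 3 → Submodule k (V4 k)) : Prop :=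
  ∃ G : Form k,
    G.IsHomogeneous 4 ∧ Irreducible G ∧
    steinerian f T l = zeroLocus G ∧
    (∀ p ∈ singularPoints G, IsNode G p) ∧
    (triadsThrough f T).ncard = 16 ∧
    Set.InjOn (triadLine T) (triadsThrough f T) ∧
    (∀ L ∈ triadLine T '' triadsThrough f T,
      Module.finrank k L = 2 ∧ pts L ⊆ steinerian f T l) ∧
    IsConfiguration (singularPoints G) (triadLine T '' triadsThrough f T)
      (fun p L => p ∈ pts L) 12 4 16 3

theorem SteinerianIsNodalQuartic.pull {f : Form k} (hf : f.IsHomogeneous 3)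
    {T : Submodule k (V4 k)} {l : Fin 3 → Submodule k (V4 k)}
    (h : SteinerianIsNodalQuartic f T l) :
    SteinerianIsNodalQuartic (pull φ.toLinearMap f) (cmap φ T) (fun i => cmap φ (l i)) := by
  obtain ⟨G, h1, h2, h3, h4, h5, h6, h7, h8⟩ := h
  have himg : triadLine (cmap φ T) '' triadsThrough (CremonaQuartic.pull φ.toLinearMap f) (cmap φ T)
      = cmap φ '' (triadLine T '' triadsThrough f T) := by
    rw [triadsThrough_pull φ hf, Set.image_image, Set.image_image]
    exact Set.image_congr fun τ _ => triadLine_cmap φ T τ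
  refine ⟨CremonaQuartic.pull φ.toLinearMap G, pull_isHomogeneous _ h1, ?_, ?_, ?_, ?_, ?_, ?_, ?_⟩
  · exact (MulEquiv.irreducible_iff (pullEquiv φ)).2 h2
  · rw [steinerian_pull, h3, zeroLocus_pull φ h1]
  · intro p hp
    rw [singularPoints_pull φ h1] at hp
    exact (isNode_pull φ h1 p).2 (h4 _ hp)
  · rw [triadsThrough_pull φ hf, Set.ncard_image_of_injective _ (cmap_injective φ).image_injective, h5]
  · rw [triadsThrough_pull φ hf]
    rintro _ ⟨τ, hτ, rfl⟩ _ ⟨τ', hτ', rfl⟩ he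
    rw [triadLine_cmap, triadLine_cmap] at he
    rw [h6 hτ hτ' (cmap_injective φ he)]
  · rw [himg]
    rintro _ ⟨L, hL, rfl⟩
    refine ⟨by rw [finrank_cmap, (h7 L hL).1], ?_⟩
    rw [pts_comap, steinerian_pull]
    exact Set.preimage_mono (h7 L hL).2
  · rw [himg, singularPoints_pull φ h1, ← Equiv.image_symm_eq_preimage]
    refine h8.image (pmap φ).symm.injective.injOn (cmap_injective φ).injOn fun p _ L _ => ?_
    rw [pts_comap, Set.mem_preimage, Equiv.apply_symm_apply]

/-- Transport along the inverse of `φ`; in this direction the theorem reduces to a convenient choice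
of coordinates. -/
theorem SteinerianIsNodalQuartic.of_pull {f : Form k} (hf : f.IsHomogeneous 3)
    {T : Submodule k (V4 k)} {l : Fin 3 → Submodule k (V4 k)}
    (h : SteinerianIsNodalQuartic (CremonaQuartic.pull φ.toLinearMap f) (cmap φ T)
      (fun i => cmap φ (l i))) :
    SteinerianIsNodalQuartic f T l := by
  have := h.pull φ.symm (pull_isHomogeneous _ hf)
  simpa only [pull_symm_pull, cmap_symm_cmap] using this

end Transport

end CremonaQuartic

/-! ### The normal form `x y z + w q` and the quartic attached to it. -/

namespace CremonaQuartic

variable {k : Type*} [Field k]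

open MvPolynomial

/-- The coefficients of a quadratic form in the coordinates `x, y, z, w`: the squares `d0, d1, d2`,
the mixed terms `m0 y z + m1 x z + m2 x y`, and `w (b0 x + b1 y + b2 z + c w)`. -/
structure Coef (k : Type*) where
  (d0 d1 d2 m0 m1 m2 b0 b1 b2 c : k)

namespace Coef

/-- The quadratic form. -/
def q (a : Coef k) (v : V4 k) : k :=
  a.d0 * v 0 ^ 2 + a.d1 * v 1 ^ 2 + a.d2 * v 2 ^ 2 + a.m0 * v 1 * v 2 + a.m1 * v 0 * v 2
    + a.m2 * v 0 * v 1 + v 3 * (a.b0 * v 0 + a.b1 * v 1 + a.b2 * v 2 + a.c * v 3)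

/-- The partial derivative of the quadratic form in the first coordinate. -/
def q0 (a : Coef k) (v : V4 k) : k :=
  2 * a.d0 * v 0 + a.m2 * v 1 + a.m1 * v 2 + a.b0 * v 3
/-- The partial derivative of the quadratic form in the second coordinate. -/
def q1 (a : Coef k) (v : V4 k) : k :=
  a.m2 * v 0 + 2 * a.d1 * v 1 + a.m0 * v 2 + a.b1 * v 3
/-- The partial derivative of the quadratic form in the third coordinate. -/
def q2 (a : Coef k) (v : V4 k) : k :=
  a.m1 * v 0 + a.m0 * v 1 + 2 * a.d2 * v 2 + a.b2 * v 3
/-- The partial derivative of the quadratic form in the fourth coordinate. -/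
def q3 (a : Coef k) (v : V4 k) : k :=
  a.b0 * v 0 + a.b1 * v 1 + a.b2 * v 2 + 2 * a.c * v 3

/-- The cubic form `x y z + w q`. -/
def f (a : Coef k) (v : V4 k) : k := v 0 * v 1 * v 2 + v 3 * a.q v
/-- The partial derivative of the cubic form in the first coordinate. -/
def f0 (a : Coef k) (v : V4 k) : k := v 1 * v 2 + v 3 * a.q0 v
/-- The partial derivative of the cubic form in the second coordinate. -/
def f1 (a : Coef k) (v : V4 k) : k := v 0 * v 2 + v 3 * a.q1 v
/-- The partial derivative of the cubic form in the third coordinate. -/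
def f2 (a : Coef k) (v : V4 k) : k := v 0 * v 1 + v 3 * a.q2 v
/-- The partial derivative of the cubic form in the fourth coordinate. -/
def f3 (a : Coef k) (v : V4 k) : k := a.q v + v 3 * a.q3 v

/-- The cubic surface is smooth. -/
def Smooth (a : Coef k) : Prop :=
  ∀ v, a.f v = 0 → a.f0 v = 0 → a.f1 v = 0 → a.f2 v = 0 → a.f3 v = 0 → v = 0

/-- The quartic form `w q₀ q₁ q₂ + x y q₀ q₁ + x z q₀ q₂ + y z q₁ q₂ - x y z q₃ - q²`. -/
def g (a : Coef k) (v : V4 k) : k :=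
  v 3 * (a.q0 v * a.q1 v * a.q2 v) + v 0 * v 1 * (a.q0 v * a.q1 v) + v 0 * v 2 * (a.q0 v * a.q2 v)
    + v 1 * v 2 * (a.q1 v * a.q2 v) - v 0 * v 1 * v 2 * a.q3 v - a.q v ^ 2

/-- The partial derivative of the quartic form in the first coordinate. -/
def g0 (a : Coef k) (v : V4 k) : k :=
  v 3 * (2 * a.d0 * a.q1 v * a.q2 v + a.q0 v * a.m2 * a.q2 v + a.q0 v * a.q1 v * a.m1)
    + v 1 * (a.q0 v * a.q1 v) + v 0 * v 1 * (2 * a.d0 * a.q1 v + a.q0 v * a.m2)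
    + v 2 * (a.q0 v * a.q2 v) + v 0 * v 2 * (2 * a.d0 * a.q2 v + a.q0 v * a.m1)
    + v 1 * v 2 * (a.m2 * a.q2 v + a.q1 v * a.m1) - v 1 * v 2 * a.q3 v - v 0 * v 1 * v 2 * a.b0
    - 2 * a.q v * a.q0 v

/-- The partial derivative of the quartic form in the second coordinate. -/
def g1 (a : Coef k) (v : V4 k) : k :=
  v 3 * (a.m2 * a.q1 v * a.q2 v + a.q0 v * (2 * a.d1) * a.q2 v + a.q0 v * a.q1 v * a.m0)
    + v 0 * (a.q0 v * a.q1 v) + v 0 * v 1 * (a.m2 * a.q1 v + a.q0 v * (2 * a.d1))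
    + v 2 * (a.q1 v * a.q2 v) + v 0 * v 2 * (a.m2 * a.q2 v + a.q0 v * a.m0)
    + v 1 * v 2 * (2 * a.d1 * a.q2 v + a.q1 v * a.m0) - v 0 * v 2 * a.q3 v - v 0 * v 1 * v 2 * a.b1
    - 2 * a.q v * a.q1 v

/-- The partial derivative of the quartic form in the third coordinate. -/
def g2 (a : Coef k) (v : V4 k) : k :=
  v 3 * (a.m1 * a.q1 v * a.q2 v + a.q0 v * a.m0 * a.q2 v + a.q0 v * a.q1 v * (2 * a.d2))
    + v 0 * (a.q0 v * a.q2 v) + v 0 * v 1 * (a.m1 * a.q1 v + a.q0 v * a.m0)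
    + v 1 * (a.q1 v * a.q2 v) + v 0 * v 2 * (a.m1 * a.q2 v + a.q0 v * (2 * a.d2))
    + v 1 * v 2 * (a.m0 * a.q2 v + a.q1 v * (2 * a.d2)) - v 0 * v 1 * a.q3 v
    - v 0 * v 1 * v 2 * a.b2 - 2 * a.q v * a.q2 v

/-- The partial derivative of the quartic form in the fourth coordinate. -/
def g3 (a : Coef k) (v : V4 k) : k :=
  a.q0 v * a.q1 v * a.q2 v
    + v 3 * (a.b0 * a.q1 v * a.q2 v + a.q0 v * a.b1 * a.q2 v + a.q0 v * a.q1 v * a.b2)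
    + v 0 * v 1 * (a.b0 * a.q1 v + a.q0 v * a.b1) + v 0 * v 2 * (a.b0 * a.q2 v + a.q0 v * a.b2)
    + v 1 * v 2 * (a.b1 * a.q2 v + a.q1 v * a.b2) - v 0 * v 1 * v 2 * (2 * a.c)
    - 2 * a.q v * a.q3 v

/-- The quadratic form as a polynomial. -/
noncomputable def qForm (a : Coef k) : Form k :=
  C a.d0 * X 0 ^ 2 + C a.d1 * X 1 ^ 2 + C a.d2 * X 2 ^ 2 + C a.m0 * X 1 * X 2 + C a.m1 * X 0 * X 2
    + C a.m2 * X 0 * X 1 + X 3 * (C a.b0 * X 0 + C a.b1 * X 1 + C a.b2 * X 2 + C a.c * X 3)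

/-- The cubic form as a polynomial. -/
noncomputable def cubic (a : Coef k) : Form k := X 0 * X 1 * X 2 + X 3 * a.qForm

/-- The quartic form as a polynomial. -/
noncomputable def quartic (a : Coef k) : Form k :=
  X 3 * (pderiv 0 a.qForm * pderiv 1 a.qForm * pderiv 2 a.qForm)
    + X 0 * X 1 * (pderiv 0 a.qForm * pderiv 1 a.qForm)
    + X 0 * X 2 * (pderiv 0 a.qForm * pderiv 2 a.qForm)
    + X 1 * X 2 * (pderiv 1 a.qForm * pderiv 2 a.qForm)
    - X 0 * X 1 * X 2 * pderiv 3 a.qForm - a.qForm ^ 2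

variable (a : Coef k) (v : V4 k)

theorem eval_qForm : eval v a.qForm = a.q v := by simp [qForm, q]

theorem qForm_isHomogeneous : a.qForm.IsHomogeneous 2 := by
  have hX : ∀ i : Fin 4, (X i : Form k).IsHomogeneous 1 := isHomogeneous_X k
  refine ((((((IsHomogeneous.add ?_ ?_).add ?_).add ?_).add ?_).add ?_).add ?_)
  · exact ((hX 0).pow 2).C_mul _
  · exact ((hX 1).pow 2).C_mul _
  · exact ((hX 2).pow 2).C_mul _
  · exact ((hX 1).C_mul _).mul (hX 2)
  · exact ((hX 0).C_mul _).mul (hX 2)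
  · exact ((hX 0).C_mul _).mul (hX 1)
  · exact (hX 3).mul ((((((hX 0).C_mul _).add ((hX 1).C_mul _)).add ((hX 2).C_mul _))).add
      ((hX 3).C_mul _))

theorem cubic_isHomogeneous : a.cubic.IsHomogeneous 3 := by
  have hX : ∀ i : Fin 4, (X i : Form k).IsHomogeneous 1 := isHomogeneous_X k
  exact (((hX 0).mul (hX 1)).mul (hX 2)).add ((hX 3).mul a.qForm_isHomogeneous)

theorem quartic_isHomogeneous : a.quartic.IsHomogeneous 4 := by
  have hX : ∀ i : Fin 4, (X i : Form k).IsHomogeneous 1 := isHomogeneous_X k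
  have hq : ∀ i : Fin 4, (pderiv i a.qForm).IsHomogeneous 1 := fun i => a.qForm_isHomogeneous.pderiv
  refine (((((IsHomogeneous.add ?_ ?_).add ?_).add ?_).sub ?_).sub ?_)
  · exact (hX 3).mul (((hq 0).mul (hq 1)).mul (hq 2))
  · exact ((hX 0).mul (hX 1)).mul ((hq 0).mul (hq 1))
  · exact ((hX 0).mul (hX 2)).mul ((hq 0).mul (hq 2))
  · exact ((hX 1).mul (hX 2)).mul ((hq 1).mul (hq 2))
  · exact (((hX 0).mul (hX 1)).mul (hX 2)).mul (hq 3)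
  · exact a.qForm_isHomogeneous.pow 2

theorem pderiv0_qForm : pderiv 0 a.qForm = C (2 * a.d0) * X 0 + C a.m2 * X 1 + C a.m1 * X 2 + C a.b0 * X 3 := by
  simp [qForm, pderiv_X, Derivation.leibniz, show (C (2 : k) : Form k) = 2 from map_ofNat C 2]; ring

theorem pderiv1_qForm : pderiv 1 a.qForm = C a.m2 * X 0 + C (2 * a.d1) * X 1 + C a.m0 * X 2 + C a.b1 * X 3 := by
  simp [qForm, pderiv_X, Derivation.leibniz, show (C (2 : k) : Form k) = 2 from map_ofNat C 2]; ring

theorem pderiv2_qForm : pderiv 2 a.qForm = C a.m1 * X 0 + C a.m0 * X 1 + C (2 * a.d2) * X 2 + C a.b2 * X 3 := by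
  simp [qForm, pderiv_X, Derivation.leibniz, show (C (2 : k) : Form k) = 2 from map_ofNat C 2]; ring

theorem pderiv3_qForm : pderiv 3 a.qForm = C a.b0 * X 0 + C a.b1 * X 1 + C a.b2 * X 2 + C (2 * a.c) * X 3 := by
  simp [qForm, pderiv_X, Derivation.leibniz, show (C (2 : k) : Form k) = 2 from map_ofNat C 2]; ring

theorem eval_pderiv0_qForm : eval v (pderiv 0 a.qForm) = a.q0 v := by simp [pderiv0_qForm, q0]
theorem eval_pderiv1_qForm : eval v (pderiv 1 a.qForm) = a.q1 v := by simp [pderiv1_qForm, q1]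
theorem eval_pderiv2_qForm : eval v (pderiv 2 a.qForm) = a.q2 v := by simp [pderiv2_qForm, q2]
theorem eval_pderiv3_qForm : eval v (pderiv 3 a.qForm) = a.q3 v := by simp [pderiv3_qForm, q3]

theorem eval_cubic : eval v a.cubic = a.f v := by simp [cubic, f, eval_qForm]

theorem eval_quartic : eval v a.quartic = a.g v := by
  simp [quartic, g, eval_qForm, eval_pderiv0_qForm, eval_pderiv1_qForm, eval_pderiv2_qForm,
    eval_pderiv3_qForm]

theorem eval_pderiv_cubic (i : Fin 4) :
    eval v (pderiv i a.cubic) = ![a.f0 v, a.f1 v, a.f2 v, a.f3 v] i := by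
  fin_cases i <;>
  simp [cubic, pderiv_X, eval_qForm, f0, f1, f2, f3, eval_pderiv0_qForm,
    eval_pderiv1_qForm, eval_pderiv2_qForm, eval_pderiv3_qForm] <;> ring

theorem eval_pderiv_quartic (i : Fin 4) :
    eval v (pderiv i a.quartic) = ![a.g0 v, a.g1 v, a.g2 v, a.g3 v] i := by
  fin_cases i <;>
  simp only [quartic, map_add, map_sub, Derivation.leibniz, Derivation.leibniz_pow, smul_eq_mul, map_mul, eval_X,
    eval_pderiv0_qForm, eval_pderiv1_qForm, eval_pderiv2_qForm, eval_pderiv3_qForm, eval_qForm,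
    map_pow, nsmul_eq_mul] <;>
  simp [pderiv0_qForm, pderiv1_qForm, pderiv2_qForm, pderiv3_qForm, pderiv_X,
    g0, g1, g2, g3] <;>
  simp only [q0, q1, q2, q3] <;> ring

theorem mem_singular_cubic_iff : (eval v a.cubic = 0 ∧ ∀ i, eval v (pderiv i a.cubic) = 0) ↔
    a.f v = 0 ∧ a.f0 v = 0 ∧ a.f1 v = 0 ∧ a.f2 v = 0 ∧ a.f3 v = 0 := by
  simp [eval_cubic, eval_pderiv_cubic, Fin.forall_fin_succ]

theorem mem_singular_quartic_iff : (eval v a.quartic = 0 ∧ ∀ i, eval v (pderiv i a.quartic) = 0) ↔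
    a.g v = 0 ∧ a.g0 v = 0 ∧ a.g1 v = 0 ∧ a.g2 v = 0 ∧ a.g3 v = 0 := by
  simp [eval_quartic, eval_pderiv_quartic, Fin.forall_fin_succ]

theorem smooth_iff : IsSmoothCubic a.cubic ↔ a.Smooth := by
  constructor
  · intro h v h1 h2 h3 h4 h5
    by_contra hv
    have := (mk_mem_singularPoints a.cubic_isHomogeneous v hv).2
      ((a.mem_singular_cubic_iff v).2 ⟨h1, h2, h3, h4, h5⟩)
    rw [h.2] at this
    exact this
  · refine fun h => ⟨a.cubic_isHomogeneous, Set.eq_empty_of_forall_notMem fun p => ?_⟩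
    induction p using Projectivization.ind with
    | h v hv =>
      intro hp
      obtain ⟨h1, h2, h3, h4, h5⟩ := (a.mem_singular_cubic_iff v).1
        ((mk_mem_singularPoints a.cubic_isHomogeneous v hv).1 hp)
      exact hv (h v h1 h2 h3 h4 h5)

/-- Cyclic permutation of the first three coordinates. -/
def rot : Coef k := ⟨a.d1, a.d2, a.d0, a.m1, a.m2, a.m0, a.b1, a.b2, a.b0, a.c⟩

/-- The quadratic form in the coordinates `x + t0 w`, `y + t1 w`, `z + t2 w`, `w` for which the
cubic form has the same shape. -/
def shift (t0 t1 t2 : k) : Coef k where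
  d0 := a.d0
  d1 := a.d1
  d2 := a.d2
  m0 := a.m0 - t0
  m1 := a.m1 - t1
  m2 := a.m2 - t2
  b0 := a.b0 - 2 * a.d0 * t0 - a.m2 * t1 - a.m1 * t2 + t1 * t2
  b1 := a.b1 - 2 * a.d1 * t1 - a.m2 * t0 - a.m0 * t2 + t0 * t2
  b2 := a.b2 - 2 * a.d2 * t2 - a.m1 * t0 - a.m0 * t1 + t0 * t1
  c := a.c + a.d0 * t0 ^ 2 + a.d1 * t1 ^ 2 + a.d2 * t2 ^ 2 + a.m0 * t1 * t2 + a.m1 * t0 * t2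
    + a.m2 * t0 * t1 - a.b0 * t0 - a.b1 * t1 - a.b2 * t2 - t0 * t1 * t2

/-- Cyclic permutation of the first three coordinates of a vector. -/
def rotV : V4 k ≃ₗ[k] V4 k where
  toFun v := ![v 1, v 2, v 0, v 3]
  invFun v := ![v 2, v 0, v 1, v 3]
  map_add' u v := by ext i; fin_cases i <;> simp
  map_smul' r v := by ext i; fin_cases i <;> simp
  left_inv v := by ext i; fin_cases i <;> simp
  right_inv v := by ext i; fin_cases i <;> simp

/-- Translation of the first three coordinates by multiples of the fourth. -/
def shiftV (t0 t1 t2 : k) : V4 k ≃ₗ[k] V4 k where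
  toFun v := ![v 0 + t0 * v 3, v 1 + t1 * v 3, v 2 + t2 * v 3, v 3]
  invFun v := ![v 0 - t0 * v 3, v 1 - t1 * v 3, v 2 - t2 * v 3, v 3]
  map_add' u v := by ext i; fin_cases i <;> simp <;> ring
  map_smul' r v := by ext i; fin_cases i <;> simp <;> ring
  left_inv v := by ext i; fin_cases i <;> simp
  right_inv v := by ext i; fin_cases i <;> simp

theorem rotV_apply : rotV v = ![v 1, v 2, v 0, v 3] := rfl

theorem shiftV_apply (t0 t1 t2 : k) :
    shiftV t0 t1 t2 v = ![v 0 + t0 * v 3, v 1 + t1 * v 3, v 2 + t2 * v 3, v 3] := rfl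

theorem f_rot : a.rot.f (rotV v) = a.f v := by
  simp [f, q, rot, rotV_apply]; ring

theorem g_rot : a.rot.g (rotV v) = a.g v := by
  simp [g, q, q0, q1, q2, q3, rot, rotV_apply]; ring

theorem q0_shift (t0 t1 t2 : k) : (a.shift t0 t1 t2).q0 (shiftV t0 t1 t2 v) =
    a.q0 v - t1 * v 2 - t2 * v 1 - t1 * t2 * v 3 := by
  simp [q0, shift, shiftV_apply]; ring

theorem q1_shift (t0 t1 t2 : k) : (a.shift t0 t1 t2).q1 (shiftV t0 t1 t2 v) =
    a.q1 v - t0 * v 2 - t2 * v 0 - t0 * t2 * v 3 := by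
  simp [q1, shift, shiftV_apply]; ring

theorem q2_shift (t0 t1 t2 : k) : (a.shift t0 t1 t2).q2 (shiftV t0 t1 t2 v) =
    a.q2 v - t0 * v 1 - t1 * v 0 - t0 * t1 * v 3 := by
  simp [q2, shift, shiftV_apply]; ring

theorem q_shift (t0 t1 t2 : k) : (a.shift t0 t1 t2).q (shiftV t0 t1 t2 v) =
    a.q v - (t0 * v 1 * v 2 + t1 * v 0 * v 2 + t2 * v 0 * v 1)
      - v 3 * (t1 * t2 * v 0 + t0 * t2 * v 1 + t0 * t1 * v 2) - t0 * t1 * t2 * v 3 ^ 2 := by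
  simp [q, shift, shiftV_apply]; ring

theorem q3_shift (t0 t1 t2 : k) : (a.shift t0 t1 t2).q3 (shiftV t0 t1 t2 v) =
    a.q3 v - t0 * a.q0 v - t1 * a.q1 v - t2 * a.q2 v + t1 * t2 * v 0 + t0 * t2 * v 1
      + t0 * t1 * v 2 + t0 * t1 * t2 * v 3 := by
  simp [q3, q0, q1, q2, shift, shiftV_apply]; ring

/-- The cubic is the same; only its decomposition changes, from `x y z + w q` to `X_0 X_1 X_2 + w
Q_t`. Together with the cyclic rotation this lets one compute with the parameter zero and the first
pencil only. -/
theorem f_shift (t0 t1 t2 : k) : (a.shift t0 t1 t2).f (shiftV t0 t1 t2 v) = a.f v := by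
  rw [f, q_shift]; simp [f, shiftV_apply]; ring

theorem two_mul_q : 2 * a.q v = v 0 * a.q0 v + v 1 * a.q1 v + v 2 * a.q2 v + v 3 * a.q3 v := by
  simp only [q, q0, q1, q2, q3]; ring

/-- The origin of `g`. On the right the terms without `w` cancel, and by Euler's relation `x q_0 + y
q_1 + z q_2 - 2 q = - w q_3` the terms linear in `w` become divisible by `w²`. -/
theorem mul_g : v 3 ^ 2 * a.g v = a.f0 v * a.f1 v * a.f2 v - a.f v ^ 2 := by
  have := a.two_mul_q v
  simp only [g, f0, f1, f2, f]
  linear_combination (v 3 * v 0 * v 1 * v 2) * this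

end Coef

end CremonaQuartic

/-! ### Vertices of singular residual conics, and the four planes that carry them. -/

namespace CremonaQuartic

variable {k : Type*} [Field k]

open MvPolynomial

namespace Coef

variable (a : Coef k) (v : V4 k)

theorem g_shift (t0 t1 t2 : k) : (a.shift t0 t1 t2).g (shiftV t0 t1 t2 v) = a.g v := by
  have := a.two_mul_q v
  simp only [g, q_shift, q0_shift, q1_shift, q2_shift, q3_shift]
  simp only [shiftV_apply, Matrix.cons_val]
  -- The coefficient of Euler's relation is the difference between `q` and the shifted quadratic
  -- form.
  linear_combination (t0 * v 1 * v 2 + t1 * v 0 * v 2 + t2 * v 0 * v 1 +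
    v 3 * (t1 * t2 * v 0 + t0 * t2 * v 1 + t0 * t1 * v 2) + t0 * t1 * t2 * v 3 ^ 2) * this

theorem f0_rot : a.rot.f0 (rotV v) = a.f1 v := by
  simp only [f0, f1, q0, q1, rot, rotV_apply, Matrix.cons_val]; ring
theorem f1_rot : a.rot.f1 (rotV v) = a.f2 v := by
  simp only [f1, f2, q1, q2, rot, rotV_apply, Matrix.cons_val]; ring
theorem f2_rot : a.rot.f2 (rotV v) = a.f0 v := by
  simp only [f2, f0, q2, q0, rot, rotV_apply, Matrix.cons_val]; ring
theorem f3_rot : a.rot.f3 (rotV v) = a.f3 v := by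
  simp only [f3, q, q3, rot, rotV_apply, Matrix.cons_val]; ring

theorem Smooth.rot {a : Coef k} (h : a.Smooth) : a.rot.Smooth := by
  intro v h1 h2 h3 h4 h5
  obtain ⟨u, rfl⟩ := rotV.surjective v
  rw [f_rot] at h1
  rw [f0_rot] at h2
  rw [f1_rot] at h3
  rw [f2_rot] at h4
  rw [f3_rot] at h5
  rw [h u h1 h4 h2 h3 h5, map_zero]

theorem f0_shift (t0 t1 t2 : k) : (a.shift t0 t1 t2).f0 (shiftV t0 t1 t2 v) = a.f0 v := by
  rw [f0, q0_shift]; simp [f0, shiftV_apply]; ring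
theorem f1_shift (t0 t1 t2 : k) : (a.shift t0 t1 t2).f1 (shiftV t0 t1 t2 v) = a.f1 v := by
  rw [f1, q1_shift]; simp [f1, shiftV_apply]; ring
theorem f2_shift (t0 t1 t2 : k) : (a.shift t0 t1 t2).f2 (shiftV t0 t1 t2 v) = a.f2 v := by
  rw [f2, q2_shift]; simp [f2, shiftV_apply]; ring
theorem f3_shift (t0 t1 t2 : k) : (a.shift t0 t1 t2).f3 (shiftV t0 t1 t2 v) =
    a.f3 v - t0 * a.f0 v - t1 * a.f1 v - t2 * a.f2 v := by
  rw [f3, q3_shift, q_shift]; simp [f0, f1, f2, f3, shiftV_apply]; ring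

theorem Smooth.shift {a : Coef k} (h : a.Smooth) (t0 t1 t2 : k) : (a.shift t0 t1 t2).Smooth := by
  intro v h1 h2 h3 h4 h5
  obtain ⟨u, rfl⟩ := (shiftV t0 t1 t2).surjective v
  rw [f_shift] at h1
  rw [f0_shift] at h2
  rw [f1_shift] at h3
  rw [f2_shift] at h4
  rw [f3_shift] at h5
  rw [h u h1 h2 h3 h4 (by linear_combination h5 + t0 * h2 + t1 * h3 + t2 * h4), map_zero]

theorem pull_rot_quartic [Infinite k] : pull rotV.toLinearMap a.rot.quartic = a.quartic :=
  eq_of_eval_eq fun v => by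
    rw [eval_pull, eval_quartic, eval_quartic]; exact a.g_rot v

theorem pull_shift_quartic [Infinite k] (t0 t1 t2 : k) :
    pull (shiftV t0 t1 t2).toLinearMap (a.shift t0 t1 t2).quartic = a.quartic :=
  eq_of_eval_eq fun v => by
    rw [eval_pull, eval_quartic, eval_quartic]; exact a.g_shift v t0 t1 t2

/-- Otherwise the corner `(1 : 0 : 0 : 0)` of the triangle is a singular point of the cubic surface.
-/
theorem Smooth.d0_ne_zero {a : Coef k} (h : a.Smooth) : a.d0 ≠ 0 := by
  intro h0
  have := congrFun (h ![1, 0, 0, 0] (by simp [f]) (by simp [f0]) (by simp [f1]) (by simp [f2])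
    (by simp [f3, q, h0])) 0
  simp at this

/-- Either `v` is zero, or the plane `x + s w = 0` cuts the cubic surface along its line in `w = 0`
and a residual conic that is singular at `v`. -/
def IsVertex (a : Coef k) (s : k) (v : V4 k) : Prop :=
  v 0 = -(s * v 3) ∧ a.q1 v = s * v 2 ∧ a.q2 v = s * v 1 ∧ a.q3 v = s * a.q0 v

namespace IsVertex

variable {a v} {s : k}

theorem q_eq (h2 : (2 : k) ≠ 0) (h : a.IsVertex s v) : a.q v = s * (v 1 * v 2) := by
  obtain ⟨e0, e1, e2, e3⟩ := h
  have := a.two_mul_q v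
  rw [e1, e2, e3, e0] at this
  exact mul_left_cancel₀ h2 (by rw [this]; ring)

theorem f_eq (h2 : (2 : k) ≠ 0) (h : a.IsVertex s v) : a.f v = 0 := by
  rw [f, h.q_eq h2, h.1]; ring

theorem f1_eq (h : a.IsVertex s v) : a.f1 v = 0 := by
  rw [f1, h.2.1, h.1]; ring

theorem f2_eq (h : a.IsVertex s v) : a.f2 v = 0 := by
  rw [f2, h.2.2.1, h.1]; ring

theorem f3_eq (h2 : (2 : k) ≠ 0) (h : a.IsVertex s v) : a.f3 v = s * a.f0 v := by
  rw [f3, h.q_eq h2, h.2.2.2, f0]; ring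

/-- At a vertex `f`, `f_1` and `f_2` vanish and `f_3 = s f_0`, so the whole gradient is governed by
`f_0`. All later uses of smoothness at a vertex go through this. -/
theorem f0_ne_zero (h2 : (2 : k) ≠ 0) (ha : a.Smooth) (h : a.IsVertex s v) (hv : v ≠ 0) :
    a.f0 v ≠ 0 := fun h0 =>
  hv (ha v (h.f_eq h2) h0 h.f1_eq h.f2_eq (by rw [h.f3_eq h2, h0, mul_zero]))

theorem add_smul {u : V4 k} (h : a.IsVertex s v) (hu : a.IsVertex s u) (r : k) :
    a.IsVertex s (u + r • v) := by
  obtain ⟨e0, e1, e2, e3⟩ := h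
  obtain ⟨u0, u1, u2, u3⟩ := hu
  simp only [q0, q1, q2, q3] at *
  refine ⟨?_, ?_, ?_, ?_⟩ <;> simp only [Pi.add_apply, Pi.smul_apply, smul_eq_mul, q0, q1, q2, q3]
  · linear_combination u0 + r * e0
  · linear_combination u1 + r * e1
  · linear_combination u2 + r * e2
  · linear_combination u3 + r * e3

/-- Two independent vertices would span a line of vertices. On it `f_0` is a quadratic form, which
has a zero over an algebraically closed field, against `f0_ne_zero`. -/
theorem eq_smul [IsAlgClosed k] (h2 : (2 : k) ≠ 0) (ha : a.Smooth) (h : a.IsVertex s v)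
    (hv : v ≠ 0) {u : V4 k} (hu : a.IsVertex s u) : ∃ r : k, u = r • v := by
  have : NeZero (2 : k) := ⟨h2⟩
  have hf := h.f0_ne_zero h2 ha hv
  obtain ⟨e, he⟩ := IsAlgClosed.exists_pow_nat_eq (discrim (a.f0 v)
    (v 1 * u 2 + u 1 * v 2 + v 3 * a.q0 u + u 3 * a.q0 v) (a.f0 u)) (n := 2) (by norm_num)
  obtain ⟨r, hr⟩ := exists_quadratic_eq_zero hf ⟨e, by rw [← he]; ring⟩
  refine ⟨-r, ?_⟩
  by_contra hne
  refine (h.add_smul hu r).f0_ne_zero h2 ha (fun h0 => hne ?_) ?_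
  · rw [neg_smul]; exact eq_neg_of_add_eq_zero_left h0
  · rw [← hr]
    simp only [f0, q0, Pi.add_apply, Pi.smul_apply, smul_eq_mul]; ring

end IsVertex

/-- A singular symmetric matrix of size three of corank one has a nonzero principal cofactor at
each nonzero coordinate of the kernel. -/
theorem exists_kernel_of_cofactor_eq_zero {B C D E F y z w : k} (h2 : B * y + D * z + E * w = 0)
    (h3 : C * y + E * z + F * w = 0) (hy : y ≠ 0) (hc : D * F - E ^ 2 = 0) :
    ∃ u v : k, (u ≠ 0 ∨ v ≠ 0) ∧ B * u + C * v = 0 ∧ D * u + E * v = 0 ∧ E * u + F * v = 0 := by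
  by_cases h : E ≠ 0 ∨ D ≠ 0
  -- `(E, -D)` annihilates the row `(D, E)` trivially and the row `(E, F)` because the minor is
  -- zero. The given kernel vector, with `y ≠ 0`, makes the remaining row `(B, C)` a combination of
  -- these two.
  · refine ⟨E, -D, by simpa using h, mul_left_cancel₀ hy ?_, by ring, ?_⟩
    · linear_combination E * h2 - D * h3 + w * hc
    · linear_combination -hc
  · push Not at h
    refine ⟨1, 0, by simp, mul_left_cancel₀ hy ?_, by simp [h.2], by simp [h.1]⟩
    rw [h.1, h.2] at h2
    linear_combination h2

/-- The discriminant of the residual conic in the plane `x + s w = 0`, as a polynomial in `s`. -/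
noncomputable def disc (a : Coef k) : Polynomial k :=
  .C (-2 * a.d0) * .X ^ 4
  + .C (4 * a.m0 * a.d0 + 2 * a.b0 - 2 * a.m1 * a.m2) * .X ^ 3
  + .C (8 * a.d0 * a.d1 * a.d2 - 2 * a.c - 4 * a.m0 * a.b0 - 2 * a.d0 * a.m0 ^ 2
    + 2 * (a.b1 * a.m1 + a.b2 * a.m2 + a.m0 * a.m1 * a.m2) - 2 * a.d1 * a.m1 ^ 2
    - 2 * a.d2 * a.m2 ^ 2) * .X ^ 2
  + .C (-8 * a.d1 * a.d2 * a.b0 + 4 * a.c * a.m0 + 2 * a.b0 * a.m0 ^ 2 - 2 * a.b1 * a.b2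
    - 2 * a.m0 * (a.b1 * a.m1 + a.b2 * a.m2) + 4 * a.d1 * a.m1 * a.b2 + 4 * a.d2 * a.m2 * a.b1) * .X
  + .C (8 * a.d1 * a.d2 * a.c - 2 * a.c * a.m0 ^ 2 + 2 * a.m0 * a.b1 * a.b2 - 2 * a.d1 * a.b2 ^ 2
    - 2 * a.d2 * a.b1 ^ 2)

/-- The matrix of the residual conic in the plane `x + s w = 0`. -/
def conicMatrix (a : Coef k) (s : k) : Matrix (Fin 3) (Fin 3) k :=
  !![2 * a.d1, a.m0 - s, a.b1 - s * a.m2; a.m0 - s, 2 * a.d2, a.b2 - s * a.m1;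
    a.b1 - s * a.m2, a.b2 - s * a.m1, 2 * a.c - 2 * s * a.b0 + 2 * a.d0 * s ^ 2]

theorem eval_disc (s : k) : a.disc.eval s = (a.conicMatrix s).det := by
  simp [disc, conicMatrix, Matrix.det_fin_three]; ring

theorem isVertex_iff (s : k) : a.IsVertex s v ↔
    v 0 = -(s * v 3) ∧ (a.conicMatrix s).mulVec ![v 1, v 2, v 3] = 0 := by
  unfold IsVertex
  refine and_congr_right fun h => ?_
  simp only [conicMatrix, q0, q1, q2, q3, h, funext_iff, Fin.forall_fin_succ, Matrix.mulVec, dotProduct,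
    Fin.sum_univ_three]
  simp
  constructor
  · rintro ⟨h1, h2, h3⟩
    exact ⟨by linear_combination h1, by linear_combination h2, by linear_combination h3⟩
  · rintro ⟨h1, h2, h3⟩
    exact ⟨by linear_combination h1, by linear_combination h2, by linear_combination h3⟩

theorem exists_isVertex_iff (s : k) : (∃ v, v ≠ 0 ∧ a.IsVertex s v) ↔ a.disc.IsRoot s := by
  rw [Polynomial.IsRoot, eval_disc, ← Matrix.exists_mulVec_eq_zero_iff]
  constructor
  · rintro ⟨v, hv, h⟩
    rw [isVertex_iff] at h
    refine ⟨_, fun h0 => hv ?_, h.2⟩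
    have e1 := congrFun h0 0
    have e2 := congrFun h0 1
    have e3 := congrFun h0 2
    simp at e1 e2 e3
    ext i; fin_cases i <;> simp [e1, e2, e3, h.1]
  · rintro ⟨u, hu, h⟩
    refine ⟨![-(s * u 2), u 0, u 1, u 2], fun h0 => hu ?_, ?_⟩
    · have e1 := congrFun h0 1
      have e2 := congrFun h0 2
      have e3 := congrFun h0 3
      simp at e1 e2 e3
      ext i; fin_cases i <;> simp [e1, e2, e3]
    · rw [isVertex_iff]
      refine ⟨by simp, ?_⟩
      rw [← h]; congr 1; ext i; fin_cases i <;> simp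

theorem natDegree_disc (h2 : (2 : k) ≠ 0) (h : a.d0 ≠ 0) : a.disc.natDegree = 4 := by
  unfold disc
  compute_degree
  · simpa using ⟨h2, h⟩
  all_goals norm_num

/-- The derivative of `det M(s)` is the trace of `adj M · M'`. The kernel of `M` is the line spanned
by `p = (v 1, v 2, v 3)`, so `adj M` is a nonzero multiple of `p pᵀ`, and the derivative is that
multiple of `pᵀ M' p = -2 f_0(v) ≠ 0`. The proof does this with the individual cofactors. -/
theorem Smooth.derivative_disc_ne_zero [IsAlgClosed k] (h2 : (2 : k) ≠ 0) {a : Coef k}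
    (ha : a.Smooth) {s : k} (hs : a.disc.IsRoot s) : ¬ a.disc.derivative.IsRoot s := by
  intro hd
  obtain ⟨v, hv, h⟩ := (a.exists_isVertex_iff s).2 hs
  have hf := h.f0_ne_zero h2 ha hv
  have huniq : ∀ y z w : k, (a.conicMatrix s).mulVec ![y, z, w] = 0 →
      ∃ r : k, y = r * v 1 ∧ z = r * v 2 ∧ w = r * v 3 := by
    intro y z w h'
    obtain ⟨r, hr⟩ := h.eq_smul h2 ha hv (u := ![-(s * w), y, z, w])
      ((a.isVertex_iff _ s).2 ⟨by simp, by simpa using h'⟩)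
    have e1 := congrFun hr 1
    have e2 := congrFun hr 2
    have e3 := congrFun hr 3
    simp at e1 e2 e3
    exact ⟨r, e1, e2, e3⟩
  obtain ⟨e0, hM⟩ := (a.isVertex_iff v s).1 h
  have hmul : ∀ y z w : k, (a.conicMatrix s).mulVec ![y, z, w] =
      ![2 * a.d1 * y + (a.m0 - s) * z + (a.b1 - s * a.m2) * w,
        (a.m0 - s) * y + 2 * a.d2 * z + (a.b2 - s * a.m1) * w,
        (a.b1 - s * a.m2) * y + (a.b2 - s * a.m1) * z
          + (2 * a.c - 2 * s * a.b0 + 2 * a.d0 * s ^ 2) * w] := by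
    intro y z w
    ext i
    fin_cases i <;> simp [conicMatrix, Matrix.mulVec, dotProduct, Fin.sum_univ_three]
  simp only [hmul] at huniq hM
  have M1 := congrFun hM 0
  have M2 := congrFun hM 1
  have M3 := congrFun hM 2
  simp only [Matrix.cons_val, Pi.zero_apply] at M1 M2 M3
  set A := 2 * a.d1 with hA
  set B := a.m0 - s with hB
  set C := a.b1 - s * a.m2 with hC
  set D := 2 * a.d2 with hD
  set E := a.b2 - s * a.m1 with hE
  set F := 2 * a.c - 2 * s * a.b0 + 2 * a.d0 * s ^ 2 with hF
  -- The trace of `adj M · M'`, with `M'` written out entrywise.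
  have hτ : 2 * (C * E - B * F) * (-1) + 2 * (B * E - C * D) * (-a.m2)
      + 2 * (B * C - A * E) * (-a.m1) + (A * D - B ^ 2) * (-2 * a.b0 + 4 * a.d0 * s) = 0 := by
    rw [Polynomial.IsRoot] at hd
    simp only [disc, Polynomial.derivative_add, Polynomial.derivative_C_mul_X_pow,
      Polynomial.derivative_C_mul_X, Polynomial.derivative_C, Polynomial.eval_add,
      Polynomial.eval_mul, Polynomial.eval_C, Polynomial.eval_pow, Polynomial.eval_X,
      Polynomial.eval_zero] at hd
    norm_num at hd
    rw [← hd, hA, hB, hC, hD, hE, hF]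
    ring
  have hpp : 2 * v 1 * v 2 * (-1) + 2 * v 1 * v 3 * (-a.m2) + 2 * v 2 * v 3 * (-a.m1)
      + v 3 ^ 2 * (-2 * a.b0 + 4 * a.d0 * s) = -2 * a.f0 v := by
    rw [f0, q0, e0]; ring
  have hpp0 : -2 * a.f0 v ≠ 0 := mul_ne_zero (neg_ne_zero.2 h2) hf
  clear_value A B C D E F
  -- If a diagonal cofactor is zero while the corresponding coordinate of `p` is not, there is a
  -- second kernel vector with that coordinate zero, against uniqueness of the vertex.
  have c1 : D * F - E ^ 2 = 0 → v 1 = 0 := by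
    intro hc
    by_contra hy
    obtain ⟨u, w, hne, k1, k2, k3⟩ := exists_kernel_of_cofactor_eq_zero M2 M3 hy hc
    obtain ⟨r, r1, r2, r3⟩ := huniq 0 u w (by
      ext i; fin_cases i <;> simp [k1, k2, k3])
    have : r = 0 := by simpa [hy] using r1.symm
    subst this
    simp [r2, r3] at hne
  have c2 : A * F - C ^ 2 = 0 → v 2 = 0 := by
    intro hc
    by_contra hy
    obtain ⟨u, w, hne, k1, k2, k3⟩ := exists_kernel_of_cofactor_eq_zero (B := B) (C := E) (D := A)
      (E := C) (F := F) (y := v 2) (z := v 1) (w := v 3) (by linear_combination M1)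
      (by linear_combination M3) hy hc
    obtain ⟨r, r1, r2, r3⟩ := huniq u 0 w (by
      ext i; fin_cases i <;> simp [k1, k2, k3])
    have : r = 0 := by simpa [hy] using r2.symm
    subst this
    simp [r1, r3] at hne
  have c3 : A * D - B ^ 2 = 0 → v 3 = 0 := by
    intro hc
    by_contra hy
    obtain ⟨u, w, hne, k1, k2, k3⟩ := exists_kernel_of_cofactor_eq_zero (B := C) (C := E) (D := A)
      (E := B) (F := D) (y := v 3) (z := v 1) (w := v 2) (by linear_combination M1)
      (by linear_combination M2) hy hc
    obtain ⟨r, r1, r2, r3⟩ := huniq u w 0 (by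
      ext i; fin_cases i <;> simp [k1, k2, k3])
    have : r = 0 := by simpa [hy] using r3.symm
    subst this
    simp [r1, r2] at hne
  -- These relations say that the columns of `adj M` are proportional to `p`.
  have R12 : v 1 * (C * E - B * F) = v 2 * (D * F - E ^ 2) := by
    linear_combination E * M3 - F * M2
  have R13 : v 1 * (B * E - C * D) = v 3 * (D * F - E ^ 2) := by
    linear_combination E * M2 - D * M3
  have R22 : v 1 * (A * F - C ^ 2) = v 2 * (C * E - B * F) := by
    linear_combination F * M1 - C * M3
  have R23 : v 1 * (B * C - A * E) = v 2 * (B * E - C * D) := by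
    linear_combination C * M2 - E * M1
  have R33 : v 1 * (A * D - B ^ 2) = v 3 * (B * E - C * D) := by
    linear_combination D * M1 - B * M2
  have S23 : v 2 * (B * C - A * E) = v 3 * (A * F - C ^ 2) := by
    linear_combination C * M1 - A * M3
  have S33 : v 2 * (A * D - B ^ 2) = v 3 * (B * C - A * E) := by
    linear_combination A * M2 - B * M1
  have T12 : v 1 * (B * C - A * E) = v 3 * (C * E - B * F) := by
    linear_combination B * M3 - E * M1
  -- Multiplied by `(v 1)²`, the trace relation becomes `pᵀ M' p` times the first diagonal cofactor;
  -- so that cofactor vanishes, and `c1` applies. The other two coordinates are treated alike.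
  have n1 : v 1 = 0 := by
    by_contra hy
    refine hy (c1 (mul_left_cancel₀ hpp0 ?_))
    rw [← hpp]
    linear_combination v 1 ^ 2 * hτ + 2 * v 1 * R12 + 2 * a.m2 * v 1 * R13
      + 2 * a.m1 * (v 1 * R23 + v 2 * R13) - (-2 * a.b0 + 4 * a.d0 * s) * (v 1 * R33 + v 3 * R13)
  have n2 : v 2 = 0 := by
    by_contra hy
    refine hy (c2 (mul_left_cancel₀ hpp0 ?_))
    rw [← hpp]
    linear_combination v 2 ^ 2 * hτ - 2 * v 2 * R22 - 2 * a.m2 * (v 2 * R23 - v 1 * S23)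
      + 2 * a.m1 * v 2 * S23 - (-2 * a.b0 + 4 * a.d0 * s) * (v 2 * S33 + v 3 * S23)
  have n3 : v 3 = 0 := by
    by_contra hy
    refine hy (c3 (mul_left_cancel₀ hpp0 ?_))
    rw [← hpp]
    linear_combination v 3 ^ 2 * hτ - 2 * (v 3 * T12 + v 1 * S33) - 2 * a.m2 * v 3 * R33
      - 2 * a.m1 * v 3 * S33
  refine hv (_root_.funext fun i => ?_)
  fin_cases i <;> simp [n1, n2, n3, e0]

theorem Smooth.ncard_vertex_planes [IsAlgClosed k] (h2 : (2 : k) ≠ 0) {a : Coef k}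
    (ha : a.Smooth) : {s | ∃ v, v ≠ 0 ∧ a.IsVertex s v}.ncard = 4 := by
  classical
  have hdeg := a.natDegree_disc h2 ha.d0_ne_zero
  have h0 : a.disc ≠ 0 := by
    rintro h; rw [h] at hdeg; simp at hdeg
  have hset : {s | ∃ v, v ≠ 0 ∧ a.IsVertex s v} = (a.disc.roots.toFinset : Set k) := by
    ext s
    simp only [Set.mem_ofPred, exists_isVertex_iff, Finset.mem_coe, Multiset.mem_toFinset,
      Polynomial.mem_roots h0]
  rw [hset, Set.ncard_coe_finset, Multiset.toFinset_card_of_nodup,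
    IsAlgClosed.card_roots_eq_natDegree, hdeg]
  rw [Multiset.nodup_iff_count_le_one]
  intro s
  rw [Polynomial.count_roots]
  by_contra! hlt
  rw [Polynomial.one_lt_rootMultiplicity_iff_isRoot h0] at hlt
  exact ha.derivative_disc_ne_zero h2 hlt.1 hlt.2

end Coef

end CremonaQuartic

/-! ### The singular points of the quartic are the vertices, and they are nodes. -/

namespace CremonaQuartic

variable {k : Type*} [Field k]

open MvPolynomial

namespace Coef

variable {a : Coef k} {v : V4 k}

/-- The quartic surface is singular at `v`. -/
def SingularAt (a : Coef k) (v : V4 k) : Prop :=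
  a.g v = 0 ∧ a.g0 v = 0 ∧ a.g1 v = 0 ∧ a.g2 v = 0 ∧ a.g3 v = 0

theorem singularAt_rot [Infinite k] : a.rot.SingularAt (rotV v) ↔ a.SingularAt v := by
  have := singular_pull_iff rotV a.rot.quartic v
  rw [pull_rot_quartic, mem_singular_quartic_iff, mem_singular_quartic_iff] at this
  exact this.symm

theorem singularAt_shift [Infinite k] (t0 t1 t2 : k) :
    (a.shift t0 t1 t2).SingularAt (shiftV t0 t1 t2 v) ↔ a.SingularAt v := by
  have := singular_pull_iff (shiftV t0 t1 t2) (a.shift t0 t1 t2).quartic v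
  rw [pull_shift_quartic, mem_singular_quartic_iff, mem_singular_quartic_iff] at this
  exact this.symm

theorem IsVertex.shift {t0 t1 t2 : k} (h : a.IsVertex t0 v) :
    (a.shift t0 t1 t2).IsVertex 0 (shiftV t0 t1 t2 v) := by
  unfold IsVertex
  obtain ⟨e0, e1, e2, e3⟩ := h
  rw [q0_shift, q1_shift, q2_shift, q3_shift, shiftV_apply]
  simp only [Matrix.cons_val]
  refine ⟨?_, ?_, ?_, ?_⟩
  · linear_combination e0
  · linear_combination e1 - t2 * e0
  · linear_combination e2 - t1 * e0
  · linear_combination e3 - t1 * e1 - t2 * e2 + t1 * t2 * e0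

/-- After the shift to `s = 0` the quantities `v 0`, `q`, `q_1`, `q_2`, `q_3` all vanish, and every
term of `g` and of its partial derivatives contains one of them. -/
theorem singularAt_of_isVertex [Infinite k] (h2 : (2 : k) ≠ 0) {s : k} (h : a.IsVertex s v) :
    a.SingularAt v := by
  rw [← singularAt_shift s 0 0]
  replace h := h.shift (t1 := 0) (t2 := 0)
  have hq := h.q_eq h2
  rw [zero_mul] at hq
  obtain ⟨e0, e1, e2, e3⟩ := h
  simp only [zero_mul, neg_zero] at e0 e1 e2 e3
  refine ⟨?_, ?_, ?_, ?_, ?_⟩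
  · simp [g, e0, e1, e2, e3, hq]
  · simp [g0, e0, e1, e2, e3, hq]
  · simp [g1, e0, e1, e2, e3, hq]
  · simp [g2, e0, e1, e2, e3, hq]
  · simp [g3, e0, e1, e2, e3, hq]

theorem hess_mul (p q : Form k) (v : V4 k) (i j : Fin 4) : hess (p * q) v i j =
    eval v p * hess q v i j + eval v q * hess p v i j
      + eval v (pderiv i p) * eval v (pderiv j q) + eval v (pderiv j p) * eval v (pderiv i q) := by
  simp only [hess, Matrix.of_apply, Derivation.leibniz, smul_eq_mul, map_add, map_mul]; ring

theorem hess_add (p q : Form k) (v : V4 k) (i j : Fin 4) :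
    hess (p + q) v i j = hess p v i j + hess q v i j := by
  simp [hess]

theorem hess_sub (p q : Form k) (v : V4 k) (i j : Fin 4) :
    hess (p - q) v i j = hess p v i j - hess q v i j := by
  simp [hess]

theorem hess_X (l : Fin 4) (v : V4 k) (i j : Fin 4) : hess (X l) v i j = 0 := by
  simp only [hess, Matrix.of_apply, pderiv_X]
  by_cases h : j = l
  · subst h; simp
  · simp [Ne.symm h]

theorem hess_pderiv_qForm (l : Fin 4) (v : V4 k) (i j : Fin 4) :
    hess (pderiv l a.qForm) v i j = 0 := by
  fin_cases l <;> simp only [Fin.zero_eta, Fin.mk_one, Fin.reduceFinMk, pderiv0_qForm,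
    pderiv1_qForm, pderiv2_qForm, pderiv3_qForm] <;>
  simp [hess_add, hess_mul, hess_X] <;>
  simp [hess]

theorem pderiv_pderiv_qForm (l i : Fin 4) (v : V4 k) : eval v (pderiv i (pderiv l a.qForm)) =
    ![![2 * a.d0, a.m2, a.m1, a.b0] i, ![a.m2, 2 * a.d1, a.m0, a.b1] i,
      ![a.m1, a.m0, 2 * a.d2, a.b2] i, ![a.b0, a.b1, a.b2, 2 * a.c] i] l := by
  fin_cases l <;> simp only [Fin.zero_eta, Fin.mk_one, Fin.reduceFinMk, pderiv0_qForm,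
    pderiv1_qForm, pderiv2_qForm, pderiv3_qForm] <;> fin_cases i <;>
  simp [pderiv_X, Derivation.leibniz]

theorem eval_pderiv_X_zero (i : Fin 4) :
    eval v (pderiv i (X 0 : Form k)) = ![1, 0, 0, 0] i := by
  fin_cases i <;> simp [pderiv_X]

/-- At such a vertex the gradient of `q` is `q_0` times the first unit vector. Up to the factor
`f_0`, the Hessian is that of the quadratic form `q_1 q_2 - x q_3`. -/
theorem hess_of_isVertex (h2 : (2 : k) ≠ 0) (h : a.IsVertex 0 v) (i j : Fin 4) :
    hess a.quartic v i j = a.f0 v *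
      (![a.m2, 2 * a.d1, a.m0, a.b1] i * ![a.m1, a.m0, 2 * a.d2, a.b2] j
      + ![a.m1, a.m0, 2 * a.d2, a.b2] i * ![a.m2, 2 * a.d1, a.m0, a.b1] j
      - ![1, 0, 0, 0] i * ![a.b0, a.b1, a.b2, 2 * a.c] j
      - ![a.b0, a.b1, a.b2, 2 * a.c] i * ![1, 0, 0, 0] j) := by
  have hq := h.q_eq h2
  rw [zero_mul] at hq
  obtain ⟨e0, e1, e2, e3⟩ := h
  simp only [zero_mul, neg_zero] at e0 e1 e2 e3
  have dq : ∀ i, eval v (pderiv i a.qForm) = a.q0 v * ![1, 0, 0, 0] i := by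
    intro i
    fin_cases i <;> simp [eval_pderiv0_qForm, eval_pderiv1_qForm, eval_pderiv2_qForm,
      eval_pderiv3_qForm, e1, e2, e3]
  -- The Hessian matrix of `q` applied to `v` is the gradient of `q` at `v`; the first row drops out
  -- because `v 0 = 0`.
  have rel : ∀ i, v 1 * ![a.m2, 2 * a.d1, a.m0, a.b1] i + v 2 * ![a.m1, a.m0, 2 * a.d2, a.b2] i
      + v 3 * ![a.b0, a.b1, a.b2, 2 * a.c] i = a.q0 v * ![1, 0, 0, 0] i := by
    intro i
    simp only [q0, q1, q2, q3, e0] at e1 e2 e3 ⊢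
    fin_cases i <;> simp
    · ring
    · linear_combination e1
    · linear_combination e2
    · linear_combination e3
  have ri := rel i
  have rj := rel j
  rw [quartic, pow_two]
  simp only [hess_sub, hess_add, hess_mul, hess_X, hess_pderiv_qForm, Derivation.leibniz, smul_eq_mul, map_add, map_mul,
    eval_X, eval_qForm, hq, dq, pderiv_pderiv_qForm, Matrix.cons_val, e0, eval_pderiv_X_zero, f0]
  generalize (![a.m2, 2 * a.d1, a.m0, a.b1] : Fin 4 → k) = r1 at *
  generalize (![a.m1, a.m0, 2 * a.d2, a.b2] : Fin 4 → k) = r2 at *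
  generalize (![a.b0, a.b1, a.b2, 2 * a.c] : Fin 4 → k) = r3 at *
  generalize (![1, 0, 0, 0] : Fin 4 → k) = e at *
  linear_combination a.q0 v * e i * rj + a.q0 v * e j * ri

/-- The kernel of the Hessian is shown to be the line of `v`: uniqueness of the vertex is applied
twice, first to a vector built from `u` and then to `u` itself. -/
theorem hess_rank_of_isVertex [IsAlgClosed k] (h2 : (2 : k) ≠ 0) (ha : a.Smooth)
    (h : a.IsVertex 0 v) (hv : v ≠ 0) : (hess a.quartic v).rank = 3 := by
  have hf := h.f0_ne_zero h2 ha hv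
  have hmul : ∀ u : V4 k, (hess a.quartic v).mulVec u = fun i => a.f0 v *
      (![a.m2, 2 * a.d1, a.m0, a.b1] i * a.q2 u + ![a.m1, a.m0, 2 * a.d2, a.b2] i * a.q1 u
      - ![1, 0, 0, 0] i * a.q3 u - ![a.b0, a.b1, a.b2, 2 * a.c] i * u 0) := by
    intro u
    ext i
    simp only [Matrix.mulVec, dotProduct, hess_of_isVertex h2 h, Fin.sum_univ_four, q1, q2, q3]
    simp
    ring
  have hker : LinearMap.ker (hess a.quartic v).mulVecLin = Submodule.span k {v} := by
    ext u
    rw [LinearMap.mem_ker, Matrix.mulVecLin_apply, hmul, Submodule.mem_span_singleton]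
    constructor
    · intro h0
      have hz : ∀ i, ![a.m2, 2 * a.d1, a.m0, a.b1] i * a.q2 u
          + ![a.m1, a.m0, 2 * a.d2, a.b2] i * a.q1 u - ![1, 0, 0, 0] i * a.q3 u
          - ![a.b0, a.b1, a.b2, 2 * a.c] i * u 0 = 0 := fun i =>
        (mul_eq_zero.1 (congrFun h0 i)).resolve_left hf
      have z0 := hz 0
      have z1 := hz 1
      have z2 := hz 2
      have z3 := hz 3
      simp at z0 z1 z2 z3
      -- Three of the four kernel equations say that this vector satisfies the vertex equations, so
      -- it is `r v`.
      obtain ⟨r, hr⟩ := h.eq_smul h2 ha hv (u := ![0, a.q2 u, a.q1 u, -u 0]) (by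
        refine ⟨by simp, ?_, ?_, ?_⟩
        · rw [Coef.q1]; simp; linear_combination z1
        · rw [Coef.q2]; simp; linear_combination z2
        · rw [Coef.q3]; simp; linear_combination z3)
      have s1 := congrFun hr 1
      have s2 := congrFun hr 2
      have s3 := congrFun hr 3
      simp at s1 s2 s3
      obtain ⟨e0, e1, e2, e3⟩ := h
      simp only [zero_mul, neg_zero] at e0 e1 e2 e3
      have s4 : a.q3 u = r * a.q0 v := by
        rw [q0, e0]; linear_combination -z0 + a.m2 * s1 + a.m1 * s2 + a.b0 * s3
      have sym : v 1 * a.q1 u + v 2 * a.q2 u + v 3 * a.q3 u = u 0 * a.q0 v := by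
        have : u 0 * a.q0 v + u 1 * a.q1 v + u 2 * a.q2 v + u 3 * a.q3 v
          = v 0 * a.q0 u + v 1 * a.q1 u + v 2 * a.q2 u + v 3 * a.q3 u := by
          simp only [q0, q1, q2, q3]; ring
        rw [e0, e1, e2, e3] at this
        linear_combination -this
      -- Symmetry of the polar form of `q` at `u` and `v` gives `2 r f_0(v) = 0`.
      have hr0 : r = 0 := by
        refine mul_left_cancel₀ (mul_ne_zero h2 hf) ?_
        rw [f0]
        linear_combination sym - v 1 * s2 - v 2 * s1 - v 3 * s4 - a.q0 v * s3
      rw [hr0, zero_mul] at s1 s2 s3 s4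
      obtain ⟨r', hr'⟩ := IsVertex.eq_smul h2 ha (s := 0) ⟨by simp [e0], by simp [e1], by simp [e2], by simp [e3]⟩ hv (u := u)
        ⟨by simpa using s3, by simpa using s2, by simpa using s1, by simpa using s4⟩
      exact ⟨r', hr'.symm⟩
    · rintro ⟨r, rfl⟩
      obtain ⟨e0, e1, e2, e3⟩ := h
      simp only [zero_mul, neg_zero] at e0 e1 e2 e3
      have hs1 : a.q1 (r • v) = r * a.q1 v := by simp [q1]; ring
      have hs2 : a.q2 (r • v) = r * a.q2 v := by simp [q2]; ring
      have hs3 : a.q3 (r • v) = r * a.q3 v := by simp [q3]; ring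
      ext i
      simp [hs1, hs2, hs3, e0, e1, e2, e3]
  have := LinearMap.finrank_range_add_finrank_ker (hess a.quartic v).mulVecLin
  rw [hker, finrank_span_singleton hv, Module.finrank_fin_fun] at this
  rw [Matrix.rank]
  omega

theorem isNode_of_isVertex [IsAlgClosed k] (h2 : (2 : k) ≠ 0) (ha : a.Smooth) {s : k}
    (h : a.IsVertex s v) (hv : v ≠ 0) : IsNode a.quartic (Projectivization.mk k v hv) := by
  rw [← pull_shift_quartic a s 0 0, isNode_pull _ (quartic_isHomogeneous _), pmap_mk,
    mk_isNode (quartic_isHomogeneous _), mem_singular_quartic_iff]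
  replace h := h.shift (t1 := 0) (t2 := 0)
  exact ⟨singularAt_of_isVertex h2 h, hess_rank_of_isVertex h2 (ha.shift _ _ _) h (by simpa using hv)⟩

/-- Where the gradient of `q` vanishes, that of `g` is `- x y z (b0, b1, b2, 2 c)`. If it vanishes
as well with `x y z ≠ 0`, then `(0 : 0 : 0 : 1)` is singular on the cubic surface. -/
theorem not_singularAt_of_grad_eq_zero (h2 : (2 : k) ≠ 0) (ha : a.Smooth) (h0 : a.q0 v = 0)
    (h1 : a.q1 v = 0) (hh2 : a.q2 v = 0) (h3 : a.q3 v = 0) (hv : v 0 * v 1 * v 2 ≠ 0) :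
    ¬ a.SingularAt v := by
  have hq : a.q v = 0 := mul_left_cancel₀ h2 (by rw [two_mul_q, h0, h1, hh2, h3]; ring)
  rintro ⟨-, k0, k1, k2, k3⟩
  simp [g0, h0, h1, hh2, h3, hq] at k0
  simp [g1, h0, h1, hh2, h3, hq] at k1
  simp [g2, h0, h1, hh2, h3, hq] at k2
  simp [g3, h0, h1, hh2, h3, hq, h2] at k3
  simp only [ne_eq, mul_eq_zero, not_or] at hv
  simp only [hv, or_self, false_or] at k0 k1 k2 k3
  have := congrFun (ha ![0, 0, 0, 1] (by simp [f, q, k3]) (by simp [f0, q0, k0])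
    (by simp [f1, q1, k1]) (by simp [f2, q2, k2]) (by simp [f3, q, q3, k3])) 3
  simp at this

/-- The point `v` is a singular point of the Cremona quadric with parameters `t`. -/
def CremonaSingular (a : Coef k) (t0 t1 t2 : k) (v : V4 k) : Prop :=
  (a.shift t0 t1 t2).q0 (shiftV t0 t1 t2 v) = 0 ∧ (a.shift t0 t1 t2).q1 (shiftV t0 t1 t2 v) = 0 ∧
  (a.shift t0 t1 t2).q2 (shiftV t0 t1 t2 v) = 0 ∧ (a.shift t0 t1 t2).q3 (shiftV t0 t1 t2 v) = 0

theorem g_eq_zero_of_cremonaSingular (h2 : (2 : k) ≠ 0) {t0 t1 t2 : k}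
    (h : a.CremonaSingular t0 t1 t2 v) : a.g v = 0 := by
  obtain ⟨h0, h1, hh2, h3⟩ := h
  have hq : (a.shift t0 t1 t2).q (shiftV t0 t1 t2 v) = 0 :=
    mul_left_cancel₀ h2 (by rw [two_mul_q, h0, h1, hh2, h3]; ring)
  rw [← g_shift a v t0 t1 t2, g, h0, h1, hh2, h3, hq]; ring

/-- The equations `f_i = X_j X_k` and `f = X_0 X_1 X_2` force `X_i = f / f_i`, and `f_0 f_1 f_2 =
f²` makes this choice consistent. Since `w ≠ 0`, the `t_i` can be solved from `X_i = x_i + t_i w`;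
the last partial derivative then vanishes by Euler's relation. -/
theorem exists_cremonaSingular_of_finite (hw : v 3 ≠ 0) (hf : a.f v ≠ 0)
    (hg : a.g v = 0) : ∃ t0 t1 t2, a.CremonaSingular t0 t1 t2 v ∧
      (v 0 + t0 * v 3) * (v 1 + t1 * v 3) * (v 2 + t2 * v 3) ≠ 0 := by
  have hm := a.mul_g v
  rw [hg, mul_zero] at hm
  have hp : a.f0 v * a.f1 v * a.f2 v = a.f v ^ 2 := by linear_combination -hm
  have hne : a.f0 v * a.f1 v * a.f2 v ≠ 0 := by rw [hp]; exact pow_ne_zero _ hf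
  simp only [ne_eq, mul_eq_zero, not_or] at hne
  obtain ⟨⟨n0, n1⟩, n2⟩ := hne
  obtain ⟨y0, hy0⟩ : ∃ y, y = a.f v / a.f0 v := ⟨_, rfl⟩
  obtain ⟨y1, hy1⟩ : ∃ y, y = a.f v / a.f1 v := ⟨_, rfl⟩
  obtain ⟨y2, hy2⟩ : ∃ y, y = a.f v / a.f2 v := ⟨_, rfl⟩
  have e0 : y1 * y2 = a.f0 v := by rw [hy1, hy2]; field_simp; rw [← hp]; ring
  have e1 : y0 * y2 = a.f1 v := by rw [hy0, hy2]; field_simp; rw [← hp]; ring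
  have e2 : y0 * y1 = a.f2 v := by rw [hy0, hy1]; field_simp; rw [← hp]
  have e : y0 * y1 * y2 = a.f v := by rw [e2, hy2]; field_simp
  obtain ⟨t0, ht0⟩ : ∃ t, v 0 + t * v 3 = y0 := ⟨(y0 - v 0) / v 3, by field_simp; ring⟩
  obtain ⟨t1, ht1⟩ : ∃ t, v 1 + t * v 3 = y1 := ⟨(y1 - v 1) / v 3, by field_simp; ring⟩
  obtain ⟨t2, ht2⟩ : ∃ t, v 2 + t * v 3 = y2 := ⟨(y2 - v 2) / v 3, by field_simp; ring⟩
  have hc0 := f0_shift a v t0 t1 t2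
  have hc1 := f1_shift a v t0 t1 t2
  have hc2 := f2_shift a v t0 t1 t2
  have hc := f_shift a v t0 t1 t2
  have h2q := (a.shift t0 t1 t2).two_mul_q (shiftV t0 t1 t2 v)
  rw [f0] at hc0
  rw [f1] at hc1
  rw [f2] at hc2
  rw [f] at hc
  unfold CremonaSingular
  simp only [shiftV_apply, Matrix.cons_val, ht0, ht1, ht2, ← e0, ← e1, ← e2, ← e, add_eq_left,
    mul_eq_zero, hw, false_or] at hc0 hc1 hc2 hc h2q ⊢
  rw [hc0, hc1, hc2, hc] at h2q
  refine ⟨t0, t1, t2, ?_⟩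
  simp only [ht0, ht1, ht2, hc0, hc1, hc2, true_and]
  refine ⟨mul_left_cancel₀ hw (by linear_combination -h2q), by simpa [← e] using hf⟩

/-- For `w = 0` the first three equations are linear in `t`. With `t_i = x_i s_i` they read `q_i =
x_j x_k (s_j + s_k)`, which is solved by inspection, and the fourth is then equivalent to `g = 0`.
-/
theorem exists_cremonaSingular_of_infinite (h2 : (2 : k) ≠ 0) (hw : v 3 = 0)
    (hX : v 0 * v 1 * v 2 ≠ 0) (hg : a.g v = 0) : ∃ t0 t1 t2, a.CremonaSingular t0 t1 t2 v := by
  have hX' := hX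
  simp only [ne_eq, mul_eq_zero, not_or] at hX'
  obtain ⟨⟨n0, n1⟩, n2⟩ := hX'
  obtain ⟨s0, hs0⟩ : ∃ s, s = (v 1 * a.q1 v + v 2 * a.q2 v - v 0 * a.q0 v) / (2 * (v 0 * v 1 * v 2)) := ⟨_, rfl⟩
  obtain ⟨s1, hs1⟩ : ∃ s, s = (v 0 * a.q0 v + v 2 * a.q2 v - v 1 * a.q1 v) / (2 * (v 0 * v 1 * v 2)) := ⟨_, rfl⟩
  obtain ⟨s2, hs2⟩ : ∃ s, s = (v 0 * a.q0 v + v 1 * a.q1 v - v 2 * a.q2 v) / (2 * (v 0 * v 1 * v 2)) := ⟨_, rfl⟩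
  have e0 : a.q0 v = v 1 * v 2 * (s1 + s2) := by rw [hs1, hs2]; field_simp; ring
  have e1 : a.q1 v = v 0 * v 2 * (s0 + s2) := by rw [hs0, hs2]; field_simp; ring
  have e2 : a.q2 v = v 0 * v 1 * (s0 + s1) := by rw [hs0, hs1]; field_simp; ring
  have hq : a.q v = v 0 * v 1 * v 2 * (s0 + s1 + s2) := by
    refine mul_left_cancel₀ h2 ?_
    rw [two_mul_q, e0, e1, e2, hw]; ring
  have e3 : a.q3 v = v 0 * v 1 * v 2 * (s0 * s1 + s0 * s2 + s1 * s2) := by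
    refine mul_left_cancel₀ hX ?_
    rw [g, e0, e1, e2, hq, hw] at hg
    linear_combination -hg
  refine ⟨v 0 * s0, v 1 * s1, v 2 * s2, ?_⟩
  unfold CremonaSingular
  rw [q0_shift, q1_shift, q2_shift, q3_shift, e0, e1, e2, e3, hw]
  refine ⟨by ring, by ring, by ring, by ring⟩

theorem not_singularAt_of_cremonaSingular [Infinite k] (h2 : (2 : k) ≠ 0) (ha : a.Smooth)
    {t0 t1 t2 : k} (h : a.CremonaSingular t0 t1 t2 v)
    (hv : (v 0 + t0 * v 3) * (v 1 + t1 * v 3) * (v 2 + t2 * v 3) ≠ 0) : ¬ a.SingularAt v := by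
  rw [← singularAt_shift t0 t1 t2]
  obtain ⟨h0, h1, hh2, h3⟩ := h
  exact not_singularAt_of_grad_eq_zero h2 (ha.shift _ _ _) h0 h1 hh2 h3 (by simpa [shiftV_apply] using hv)

theorem isVertex_of_f1_f2_eq_zero (hw : v 3 ≠ 0) (hf : a.f v = 0)
    (h1 : a.f1 v = 0) (hh2 : a.f2 v = 0) : ∃ s, a.IsVertex s v := by
  obtain ⟨s, hs⟩ : ∃ s, v 0 = -(s * v 3) := ⟨-v 0 / v 3, by field_simp⟩
  have e1 : a.q1 v = s * v 2 := mul_left_cancel₀ hw (by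
    rw [f1, hs] at h1; linear_combination h1)
  have e2 : a.q2 v = s * v 1 := mul_left_cancel₀ hw (by
    rw [f2, hs] at hh2; linear_combination hh2)
  have e : a.q v = s * (v 1 * v 2) := mul_left_cancel₀ hw (by
    rw [f, hs] at hf; linear_combination hf)
  refine ⟨s, hs, e1, e2, mul_left_cancel₀ hw ?_⟩
  have := a.two_mul_q v
  rw [e, e1, e2, hs] at this
  linear_combination -this

/-- Differentiating the identity `mul_g` in `x` gives `w² g_0 = 2 d0 w f_1 f_2` where `f` and `f_0`
vanish. -/
theorem f1_or_f2_eq_zero_of_singularAt (h2 : (2 : k) ≠ 0) (ha : a.Smooth) (hw : v 3 ≠ 0)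
    (hf : a.f v = 0) (h0 : a.f0 v = 0) (h : a.SingularAt v) : a.f1 v = 0 ∨ a.f2 v = 0 := by
  have key : v 3 ^ 2 * a.g0 v = 2 * a.d0 * v 3 * a.f1 v * a.f2 v
      + a.f0 v * ((v 2 + v 3 * a.m2) * a.f2 v + a.f1 v * (v 1 + v 3 * a.m1))
      - 2 * a.f v * a.f0 v := by
    simp only [g0, f0, f1, f2, f, q, q0, q1, q2, q3]; ring
  rw [h.2.1, hf, h0] at key
  simpa [h2, ha.d0_ne_zero, hw, eq_comm] using key

/-- On the edge `x = w = 0` one has `4 g = - (y q_1 - z q_2)²`, so `y q_1 = z q_2 = q`. This gives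
`s = q / (y z)`, and the last vertex equation comes from `g_0 = 0`. -/
theorem exists_isVertex_of_edge (h2 : (2 : k) ≠ 0) (ha : a.Smooth) (hv : v ≠ 0) (hw : v 3 = 0)
    (h0 : v 0 = 0) (h : a.SingularAt v) : ∃ s, a.IsVertex s v := by
  obtain ⟨hg, hg0, -⟩ := h
  have h2q := a.two_mul_q v
  rw [hw, h0] at h2q
  have e12 : v 1 * a.q1 v = v 2 * a.q2 v := by
    rw [← sub_eq_zero, ← sq_eq_zero_iff]
    rw [g, hw, h0] at hg
    linear_combination -4 * hg - (2 * a.q v + v 1 * a.q1 v + v 2 * a.q2 v) * h2q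
  have eq : a.q v = v 1 * a.q1 v := mul_left_cancel₀ h2 (by rw [h2q, ← e12]; ring)
  have hd1 := ha.rot.d0_ne_zero
  have hd2 := ha.rot.rot.d0_ne_zero
  change a.d1 ≠ 0 at hd1
  change a.d2 ≠ 0 at hd2
  -- With `d1` and `d2` nonzero this keeps the point away from the corners of the triangle.
  have esq : a.d1 * v 1 ^ 2 = a.d2 * v 2 ^ 2 := by
    refine mul_left_cancel₀ h2 ?_
    rw [q1, q2, h0, hw] at e12
    linear_combination e12
  have n1 : v 1 ≠ 0 := by
    intro h1
    have h2' : v 2 = 0 := by simpa [h1, hd2] using esq.symm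
    exact hv (_root_.funext fun i => by fin_cases i <;> simp [h0, h1, h2', hw])
  have n2 : v 2 ≠ 0 := by
    intro h2'
    exact n1 (by simpa [h2', hd1] using esq)
  refine ⟨a.q v / (v 1 * v 2), by simp [h0, hw], ?_, ?_, ?_⟩
  · rw [eq]; field_simp
  · rw [eq, e12]; field_simp
  · field_simp
    have eul : v 1 * a.m2 + v 2 * a.m1 = a.q0 v := by rw [q0, h0, hw]; ring
    rw [g0, h0, hw] at hg0
    linear_combination -hg0 - 3 * a.q0 v * eq + v 1 * a.q1 v * eul
      - (v 1 * a.m2 + a.q0 v) * e12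

/-- The iterated cyclic permutations of the coefficients. -/
def rots (a : Coef k) : Fin 3 → Coef k := ![a, a.rot, a.rot.rot]

/-- The iterated cyclic permutations of the coordinates. -/
def rotsV : Fin 3 → (V4 k ≃ₗ[k] V4 k) := ![LinearEquiv.refl k _, rotV, rotV.trans rotV]

/-- The plane `x_i + s w = 0` cuts the cubic surface along its line in `w = 0` and a residual conic
that is singular at `v` (or `v` is zero). -/
def Vertex (a : Coef k) (i : Fin 3) (s : k) (v : V4 k) : Prop :=
  (a.rots i).IsVertex s (rotsV i v)

theorem Smooth.rots (ha : a.Smooth) (i : Fin 3) : (a.rots i).Smooth := by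
  fin_cases i
  exacts [ha, ha.rot, ha.rot.rot]

theorem singularAt_rots [Infinite k] (i : Fin 3) :
    (a.rots i).SingularAt (rotsV i v) ↔ a.SingularAt v := by
  fin_cases i
  exacts [Iff.rfl, singularAt_rot, singularAt_rot.trans singularAt_rot]

theorem pull_rots_quartic [Infinite k] (i : Fin 3) :
    pull (rotsV i).toLinearMap (a.rots i).quartic = a.quartic :=
  eq_of_eval_eq fun v => by
    rw [eval_pull, eval_quartic, eval_quartic]
    fin_cases i
    exacts [rfl, g_rot _ _, (g_rot _ _).trans (g_rot _ _)]

theorem f_rots (i : Fin 3) : (a.rots i).f (rotsV i v) = a.f v := by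
  fin_cases i
  exacts [rfl, f_rot _ _, (f_rot _ _).trans (f_rot _ _)]

/-- With `w f ≠ 0`, or with `w = 0` off the triangle, a zero of `g` is singular on some `Q_t` and
lies off its three planes, so `g` is smooth there. If `f = 0 ≠ w`, one of the `f_i` vanishes by
`mul_g` and a second one by singularity, which makes the point a vertex. The edges of the triangle
remain. -/
theorem exists_vertex_of_singularAt [Infinite k] (h2 : (2 : k) ≠ 0) (ha : a.Smooth) (hv : v ≠ 0)
    (h : a.SingularAt v) : ∃ i s, a.Vertex i s v := by
  have hr1 : rotV v ≠ 0 := by simpa using hv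
  have hr2 : rotV (rotV v) ≠ 0 := by simpa using hv
  have s1 := singularAt_rot.2 h
  have s2 := singularAt_rot.2 s1
  by_cases hw : v 3 = 0
  · by_cases hX : v 0 * v 1 * v 2 = 0
    · rw [mul_eq_zero, mul_eq_zero] at hX
      rcases hX with (h0 | h0) | h0
      · exact ⟨0, exists_isVertex_of_edge h2 ha hv hw h0 h⟩
      · exact ⟨1, exists_isVertex_of_edge h2 ha.rot hr1 hw h0 s1⟩
      · exact ⟨2, exists_isVertex_of_edge h2 ha.rot.rot hr2 hw h0 s2⟩
    · obtain ⟨t0, t1, t2, ht⟩ := exists_cremonaSingular_of_infinite h2 hw hX h.1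
      exact absurd h (not_singularAt_of_cremonaSingular h2 ha ht (by simpa [hw] using hX))
  · by_cases hf : a.f v = 0
    · have hp := a.mul_g v
      rw [h.1, hf] at hp
      have hp' : a.f0 v * a.f1 v * a.f2 v = 0 := by linear_combination -hp
      have v0 : a.f1 v = 0 → a.f2 v = 0 → ∃ i s, a.Vertex i s v := fun k1 k2 =>
        ⟨0, isVertex_of_f1_f2_eq_zero hw hf k1 k2⟩
      have v1 : a.f2 v = 0 → a.f0 v = 0 → ∃ i s, a.Vertex i s v := fun k1 k2 =>
        ⟨1, isVertex_of_f1_f2_eq_zero (a := a.rot) (v := rotV v) hw (by rwa [f_rot])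
          (by rwa [f1_rot]) (by rwa [f2_rot])⟩
      have v2 : a.f0 v = 0 → a.f1 v = 0 → ∃ i s, a.Vertex i s v := fun k1 k2 =>
        ⟨2, isVertex_of_f1_f2_eq_zero (a := a.rot.rot) (v := rotV (rotV v)) hw
          (by rwa [f_rot, f_rot]) (by rwa [f1_rot, f2_rot]) (by rwa [f2_rot, f0_rot])⟩
      rw [mul_eq_zero, mul_eq_zero] at hp'
      rcases hp' with (k0 | k1) | k2
      · rcases f1_or_f2_eq_zero_of_singularAt h2 ha hw hf k0 h with k | k
        exacts [v2 k0 k, v1 k k0]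
      · rcases f1_or_f2_eq_zero_of_singularAt (a := a.rot) (v := rotV v) h2 ha.rot hw
          (by rwa [f_rot]) (by rwa [f0_rot]) s1 with k | k
        · rw [f1_rot] at k; exact v0 k1 k
        · rw [f2_rot] at k; exact v2 k k1
      · rcases f1_or_f2_eq_zero_of_singularAt (a := a.rot.rot) (v := rotV (rotV v)) h2 ha.rot.rot hw
          (by rwa [f_rot, f_rot]) (by rwa [f0_rot, f1_rot]) s2 with k | k
        · rw [f1_rot, f2_rot] at k; exact v1 k2 k
        · rw [f2_rot, f0_rot] at k; exact v0 k k2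
    · obtain ⟨t0, t1, t2, ht, hne⟩ := exists_cremonaSingular_of_finite hw hf h.1
      exact absurd h (not_singularAt_of_cremonaSingular h2 ha ht hne)

theorem singularAt_of_vertex [Infinite k] (h2 : (2 : k) ≠ 0) {i : Fin 3} {s : k}
    (h : a.Vertex i s v) : a.SingularAt v :=
  (singularAt_rots i).1 (singularAt_of_isVertex h2 h)

theorem isNode_of_vertex [IsAlgClosed k] (h2 : (2 : k) ≠ 0) (ha : a.Smooth) {i : Fin 3} {s : k}
    (h : a.Vertex i s v) (hv : v ≠ 0) : IsNode a.quartic (Projectivization.mk k v hv) := by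
  rw [← pull_rots_quartic i, isNode_pull _ (quartic_isHomogeneous _), pmap_mk]
  exact isNode_of_isVertex h2 (ha.rots i) h _

theorem mk_mem_singularPoints_quartic (hv : v ≠ 0) :
    Projectivization.mk k v hv ∈ singularPoints a.quartic ↔ a.SingularAt v := by
  rw [mk_mem_singularPoints a.quartic_isHomogeneous, mem_singular_quartic_iff]; rfl

theorem isNode_of_mem_singularPoints [IsAlgClosed k] (h2 : (2 : k) ≠ 0) (ha : a.Smooth) (p : P3 k)
    (hp : p ∈ singularPoints a.quartic) : IsNode a.quartic p := by
  induction p using Projectivization.ind with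
  | h v hv =>
    obtain ⟨i, s, h⟩ := exists_vertex_of_singularAt h2 ha hv ((mk_mem_singularPoints_quartic hv).1 hp)
    exact isNode_of_vertex h2 ha h hv

end Coef

end CremonaQuartic

/-! ### Irreducibility of a form whose singular points are nodes. -/

namespace CremonaQuartic

variable {k : Type*} [Field k]

open MvPolynomial

section Krull

/-- Translation by a vector as an automorphism of the polynomial ring. -/
noncomputable def translate (v : V4 k) : Form k ≃ₐ[k] Form k :=
  AlgEquiv.ofAlgHom (aeval fun i => X i + C (v i)) (aeval fun i => X i - C (v i))
    (by ext i; simp) (by ext i; simp)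

theorem aeval_eq_eval' (v : V4 k) (g : Form k) : aeval v g = eval v g := by
  rw [← coe_aeval_eq_eval]; rfl

theorem eval_translate (u v : V4 k) (g : Form k) : eval u (translate v g) = eval (u + v) g := by
  have : (eval u).comp (translate v).toAlgHom.toRingHom = eval (u + v) := by
    apply MvPolynomial.ringHom_ext
    · intro r; simp [translate]
    · intro i; simp [translate]
  exact congrArg (fun φ => φ g) this

variable [IsAlgClosed k]

/-- All maximal ideals are translates of the one at the origin and have its height; if that were at
most two, so would be the Krull dimension of the polynomial ring, which is four. -/
theorem two_lt_height_vanishingIdeal :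
    2 < (vanishingIdeal k {(0 : V4 k)} : Ideal (Form k)).height := by
  by_contra! hle
  have hdim : ringKrullDim (Form k) = 4 := by
    rw [MvPolynomial.ringKrullDim_of_isNoetherianRing, ringKrullDim_eq_zero_of_field]; simp
  have h2 : ringKrullDim (Form k) ≤ 2 := by
    rw [ringKrullDim_le_iff_isMaximal_height_le]
    intro m hm
    obtain ⟨x, rfl⟩ := (isMaximal_iff_eq_vanishingIdeal_singleton (K := k)).1 hm
    have he : (vanishingIdeal k {x} : Ideal (Form k)) =
        (vanishingIdeal k {(0 : V4 k)}).comap (translate x).toRingEquiv := by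
      ext g
      have := eval_translate 0 x g
      rw [zero_add] at this
      rw [Ideal.mem_comap, mem_vanishingIdeal_singleton_iff, mem_vanishingIdeal_singleton_iff,
        aeval_eq_eval', aeval_eq_eval', ← this]
      rfl
    have hh := (RingEquiv.height_comap (translate x).toRingEquiv
      (vanishingIdeal k {(0 : V4 k)} : Ideal (Form k))).trans_le hle
    rw [← he] at hh
    exact WithBot.coe_le_coe.2 hh
  rw [hdim] at h2
  exact absurd h2 (by decide)

/-- Two polynomials in four variables that vanish at the origin have another common zero. -/
theorem exists_common_zero {A B : Form k} (hA : eval 0 A = 0) (hB : eval 0 B = 0) :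
    ∃ v : V4 k, v ≠ 0 ∧ eval v A = 0 ∧ eval v B = 0 := by
  by_contra! hne
  have hz : MvPolynomial.zeroLocus k (Ideal.span {A, B}) = {(0 : V4 k)} := by
    ext v
    rw [zeroLocus_span]
    simp only [Set.mem_insert_iff, forall_eq_or_imp, Set.mem_singleton_iff, forall_eq, Set.mem_ofPred]
    constructor
    · rintro ⟨h1, h2⟩
      by_contra hv
      exact hne v hv h1 h2
    · rintro rfl; exact ⟨hA, hB⟩
  have hrad := vanishingIdeal_zeroLocus_eq_radical (k := k) (K := k) (Ideal.span {A, B})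
  rw [hz] at hrad
  have hmax : (vanishingIdeal k {(0 : V4 k)} : Ideal (Form k)).IsMaximal :=
    (isMaximal_iff_eq_vanishingIdeal_singleton (K := k)).2 ⟨0, rfl⟩
  -- By the Nullstellensatz the ideal of the origin is the radical of `(A, B)`, hence a minimal
  -- prime over it; Krull's height theorem bounds its height by two.
  have hmin : (vanishingIdeal k {(0 : V4 k)} : Ideal (Form k)) ∈ (Ideal.span {A, B}).minimalPrimes := by
    refine ⟨⟨hmax.isPrime, hrad ▸ Ideal.le_radical⟩, fun P hP _ => ?_⟩
    rw [hrad]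
    exact (hP.1.radical_le_iff).2 hP.2
  have h2 : (vanishingIdeal k {(0 : V4 k)} : Ideal (Form k)).height ≤ 2 := by
    refine (Ideal.height_le_card_of_mem_minimalPrimes_span (Set.toFinite _) hmin).trans ?_
    exact_mod_cast (Set.ncard_insert_le A {B}).trans (by simp)
  exact absurd h2 (not_le.2 two_lt_height_vanishingIdeal)

end Krull

/-- Restriction of a polynomial to the line through the origin and `v`. -/
noncomputable def along (v : V4 k) : Form k →ₐ[k] Polynomial k :=
  aeval fun i => Polynomial.C (v i) * Polynomial.X

theorem eval_along (v : V4 k) (p : Form k) (t : k) : (along v p).eval t = eval (t • v) p := by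
  have : (Polynomial.evalRingHom t).comp (along v).toRingHom = eval (t • v) := by
    apply MvPolynomial.ringHom_ext
    · intro c
      change (along v (C c)).eval t = eval (t • v) (C c)
      rw [show along v (C c) = Polynomial.C c from aeval_C _ c, Polynomial.eval_C, eval_C]
    · intro i
      change (along v (X i)).eval t = eval (t • v) (X i)
      rw [show along v (X i) = Polynomial.C (v i) * Polynomial.X from aeval_X _ i,
        Polynomial.eval_mul, Polynomial.eval_C, Polynomial.eval_X, eval_X, mul_comm]
      rfl
  exact congrArg (fun φ => φ p) this

theorem along_of_isHomogeneous [Infinite k] {p : Form k} {d : ℕ} (hp : p.IsHomogeneous d)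
    (v : V4 k) : along v p = Polynomial.C (eval v p) * Polynomial.X ^ d := by
  refine Polynomial.funext fun t => ?_
  rw [eval_along, eval_smul_of_isHomogeneous hp, Polynomial.eval_mul, Polynomial.eval_C,
    Polynomial.eval_pow, Polynomial.eval_X, mul_comm]

/-- In a linear relation between forms of the same degree, the coefficients may be replaced by
their constant terms. -/
theorem isHomogeneous_combination [Infinite k] {p q r A B : Form k} {d : ℕ}
    (hp : p.IsHomogeneous d) (hq : q.IsHomogeneous d) (hr : r.IsHomogeneous d)
    (h : A * p + B * q = r) (v : V4 k) :
    eval 0 A * eval v p + eval 0 B * eval v q = eval v r := by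
  -- On the line through `v` the three forms become multiples of the same power of the variable. It
  -- cancels, and the value at `0` of the quotient is the claim.
  have h1 := congrArg (along v) h
  rw [map_add, map_mul, map_mul, along_of_isHomogeneous hp, along_of_isHomogeneous hq,
    along_of_isHomogeneous hr] at h1
  have h2 : (along v A * Polynomial.C (eval v p) + along v B * Polynomial.C (eval v q))
      * Polynomial.X ^ d = Polynomial.C (eval v r) * Polynomial.X ^ d := by
    rw [← h1]; ring
  have h3 := congrArg (Polynomial.eval 0)
    (mul_right_cancel₀ (pow_ne_zero _ Polynomial.X_ne_zero) h2)
  rw [Polynomial.eval_add, Polynomial.eval_mul, Polynomial.eval_mul, eval_along, eval_along,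
    zero_smul, Polynomial.eval_C, Polynomial.eval_C, Polynomial.eval_C] at h3
  exact h3

/-- A factor with nonzero constant term of a nonzero form is constant. -/
theorem isUnit_of_mul_isHomogeneous [Infinite k] {G A B : Form k} {d : ℕ} (hG : G.IsHomogeneous d)
    (h0 : G ≠ 0) (h : G = A * B) (hA : eval 0 A ≠ 0) : IsUnit A := by
  have hconst : ∀ v, eval v G ≠ 0 → eval v A = eval 0 A := by
    intro v hv
    have hrG : along v A * along v B = Polynomial.C (eval v G) * Polynomial.X ^ d := by
      rw [← map_mul, ← h]
      exact along_of_isHomogeneous hG v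
    -- On a line where `G` is not identically zero the factor divides a power of the variable; being
    -- nonzero at `0`, it is constant there.
    have hdvd : along v A ∣ Polynomial.X ^ d := by
      have hu : IsUnit (Polynomial.C (eval v G)) := Polynomial.isUnit_C.2 (Ne.isUnit hv)
      exact (hu.dvd_mul_left).1 ⟨along v B, hrG.symm⟩
    obtain ⟨i, -, hi⟩ := (dvd_prime_pow Polynomial.prime_X d).1 hdvd
    have hA0 : (along v A).eval 0 ≠ 0 := by rw [eval_along, zero_smul]; exact hA
    have hi0 : i = 0 := by
      by_contra hi0
      obtain ⟨c, hc⟩ := hi.symm.dvd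
      apply hA0
      rw [hc]
      simp [hi0]
    rw [hi0, pow_zero, associated_one_iff_isUnit, Polynomial.isUnit_iff] at hi
    obtain ⟨c, -, hc⟩ := hi
    have e1 := eval_along v A 1
    have e0 := eval_along v A 0
    rw [← hc, Polynomial.eval_C] at e1 e0
    rw [one_smul] at e1
    rw [zero_smul] at e0
    rw [← e1, e0]
  have hz : (A - C (eval 0 A)) * G = 0 := eq_of_eval_eq fun v => by
    by_cases hv : eval v G = 0
    · simp [hv]
    · simp [hconst v hv]
  rw [mul_eq_zero, or_iff_left h0, sub_eq_zero] at hz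
  rw [hz]
  exact (Ne.isUnit hA).map C

/-- A form all of whose singular points are nodes is irreducible. -/
theorem irreducible_of_isNode [IsAlgClosed k] {G : Form k} {d : ℕ} (hG : G.IsHomogeneous d)
    (hd : d ≠ 0) (h0 : G ≠ 0) (h : ∀ p ∈ singularPoints G, IsNode G p) : Irreducible G := by
  have hG0 : eval 0 G = 0 := by
    have := eval_smul_of_isHomogeneous hG 0 0
    rwa [zero_smul, zero_pow hd, zero_mul] at this
  refine ⟨fun hu => ?_, fun A B hAB => ?_⟩
  · have := hu.map (eval (0 : V4 k))
    rw [hG0] at this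
    exact not_isUnit_zero this
  -- The factors need not be assumed homogeneous: a factor with nonzero constant term is a unit, and
  -- otherwise both vanish at the origin and have a further common zero.
  · by_cases hA : eval 0 A = 0
    · by_cases hB : eval 0 B = 0
      · obtain ⟨v, hv, hvA, hvB⟩ := exists_common_zero hA hB
        have hn := (mk_isNode hG v hv).1 (h _ ((mk_mem_singularPoints hG v hv).2
          ⟨by simp [hAB, hvA], fun i => by simp [hAB, hvA, hvB]⟩))
        -- At a common zero of the factors the Hessian of `A B` is `∇A ∇Bᵀ + ∇B ∇Aᵀ`, of rank at
        -- most two.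
        have hH : hess G v =
            (Matrix.of fun i => ![eval v (pderiv i A), eval v (pderiv i B)] : Matrix (Fin 4) (Fin 2) k)
            * (Matrix.of ![fun i => eval v (pderiv i B), fun i => eval v (pderiv i A)]) := by
          ext i j
          simp only [hess, hAB, Matrix.of_apply, Derivation.leibniz, smul_eq_mul, map_add, map_mul,
            hvA, hvB, Matrix.mul_apply, Fin.sum_univ_two, Matrix.cons_val]
          ring
        have hr : (hess G v).rank ≤ 2 := by
          rw [hH]
          exact (Matrix.rank_mul_le_left _ _).trans (Matrix.rank_le_width _)
        omega
      · exact Or.inr (isUnit_of_mul_isHomogeneous hG h0 (hAB.trans (mul_comm _ _)) hB)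
    · exact Or.inl (isUnit_of_mul_isHomogeneous hG h0 hAB hA)

namespace Coef

variable {a : Coef k}

theorem Smooth.quartic_ne_zero (ha : a.Smooth) : a.quartic ≠ 0 := by
  intro h
  have hd := ha.d0_ne_zero
  have := a.eval_quartic ![1, 0, 0, 0]
  rw [h, map_zero] at this
  simp [g, q, hd] at this

theorem Smooth.irreducible_quartic [IsAlgClosed k] (h2 : (2 : k) ≠ 0) (ha : a.Smooth) :
    Irreducible a.quartic :=
  irreducible_of_isNode a.quartic_isHomogeneous (by norm_num) ha.quartic_ne_zero
    (isNode_of_mem_singularPoints h2 ha)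

end Coef

end CremonaQuartic

/-! ### Cremona's quadrics in coordinates, and the Steinerian surface as zero locus of the quartic.
-/

namespace CremonaQuartic

variable {k : Type*} [Field k]

open MvPolynomial

section LinearForms

/-- The linear form attached to a linear functional. -/
noncomputable def lin (φ : Module.Dual k (V4 k)) : Form k := ∑ i, C (φ (Pi.single i 1)) * X i

theorem eval_lin (φ : Module.Dual k (V4 k)) (v : V4 k) : eval v (lin φ) = φ v := by
  have hv : v = ∑ j, v j • Pi.single j (1 : k) := by
    ext i; simp [Finset.sum_apply, Pi.single_apply]
  conv_rhs => rw [hv]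
  simp [lin, mul_comm]

theorem lin_isHomogeneous (φ : Module.Dual k (V4 k)) : (lin φ).IsHomogeneous 1 :=
  IsHomogeneous.sum _ _ 1 fun _ _ => isHomogeneous_C_mul_X _ _

theorem exists_eq_C_of_isHomogeneous_zero {g : Form k} (hg : g.IsHomogeneous 0) :
    ∃ c, g = C c :=
  ⟨_, totalDegree_eq_zero_iff_eq_C.1 ((totalDegree_zero_iff_isHomogeneous _).2 hg)⟩

theorem exists_eq_lin {g : Form k} (hg : g.IsHomogeneous 1) : ∃ φ, g = lin φ := by
  have h : ∀ i, ∃ c, pderiv i g = C c := fun i => exists_eq_C_of_isHomogeneous_zero hg.pderiv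
  choose c hc using h
  refine ⟨∑ i, c i • LinearMap.proj i, ?_⟩
  have := hg.sum_X_mul_pderiv
  rw [one_smul] at this
  rw [← this, lin]
  refine Finset.sum_congr rfl fun i _ => ?_
  rw [hc, mul_comm]
  simp [Finset.sum_apply, Pi.single_apply]

theorem isEquationOf_lin (φ : Module.Dual k (V4 k)) : IsEquationOf (lin φ) (LinearMap.ker φ) := by
  refine ⟨lin_isHomogeneous φ, Set.ext fun p => ?_⟩
  induction p using Projectivization.ind with
  | h v hv => rw [mk_mem_zeroLocus (lin_isHomogeneous φ), mk_mem_pts, eval_lin, LinearMap.mem_ker]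

theorem IsEquationOf.exists_ker {g : Form k} {W : Submodule k (V4 k)} (h : IsEquationOf g W) :
    ∃ φ, g = lin φ ∧ W = LinearMap.ker φ := by
  obtain ⟨φ, rfl⟩ := exists_eq_lin h.1
  have := (isEquationOf_lin φ).2
  rw [h.2] at this
  exact ⟨φ, rfl, le_antisymm (le_of_pts_subset this.le) (le_of_pts_subset this.ge)⟩

theorem finrank_ker {φ : Module.Dual k (V4 k)} (h : φ ≠ 0) :
    Module.finrank k (LinearMap.ker φ) = 3 := by
  have := Module.Dual.finrank_ker_add_one_of_ne_zero h
  rw [Module.finrank_fin_fun] at this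
  omega

/-- The Nullstellensatz for a hypersurface. -/
theorem dvd_of_forall_eval_eq_zero [IsAlgClosed k] {h g : Form k} (hh : Irreducible h)
    (H : ∀ v, eval v h = 0 → eval v g = 0) : h ∣ g := by
  have hp : (Ideal.span {h}).IsPrime := (Ideal.span_singleton_prime hh.ne_zero).2 hh.prime
  have := IsPrime.vanishingIdeal_zeroLocus (K := k) (Ideal.span {h})
  rw [← Ideal.mem_span_singleton, ← this, mem_vanishingIdeal_iff]
  intro v hv
  rw [zeroLocus_span] at hv
  rw [aeval_eq_eval']
  refine H v ?_
  have := hv h rfl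
  rwa [aeval_eq_eval'] at this

end LinearForms

/-- The plane `w = 0`. -/
def stdT (k : Type*) [Field k] : Submodule k (V4 k) := LinearMap.ker (LinearMap.proj 3 : V4 k →ₗ[k] k)

/-- The lines `x_i = w = 0`. -/
def stdL (k : Type*) [Field k] (i : Fin 3) : Submodule k (V4 k) :=
  LinearMap.ker (LinearMap.proj i.castSucc : V4 k →ₗ[k] k) ⊓ stdT k

theorem mem_stdT {v : V4 k} : v ∈ stdT k ↔ v 3 = 0 := Iff.rfl

theorem mem_stdL {i : Fin 3} {v : V4 k} : v ∈ stdL k i ↔ v i.castSucc = 0 ∧ v 3 = 0 := Iff.rfl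

/-- The functional `x_i + t_i w`. -/
def planeForm (t : Fin 3 → k) (i : Fin 3) : Module.Dual k (V4 k) :=
  LinearMap.proj i.castSucc + t i • LinearMap.proj 3

theorem planeForm_apply (t : Fin 3 → k) (i : Fin 3) (v : V4 k) :
    planeForm t i v = v i.castSucc + t i * v 3 := rfl

theorem planeForm_ne_zero (t : Fin 3 → k) (i : Fin 3) : planeForm t i ≠ 0 := by
  intro h
  have := congrArg (fun φ : Module.Dual k (V4 k) => φ (Pi.single i.castSucc 1)) h
  have h3 : (3 : Fin 4) ≠ i.castSucc := (Fin.castSucc_lt_last i).ne'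
  simp [planeForm_apply, h3] at this

theorem finrank_stdT : Module.finrank k (stdT k) = 3 :=
  finrank_ker fun h => by
    have := congrArg (fun φ : Module.Dual k (V4 k) => φ (Pi.single 3 1)) h
    simp at this

theorem stdL_le_ker_planeForm (t : Fin 3 → k) (i : Fin 3) :
    stdL k i ≤ LinearMap.ker (planeForm t i) := by
  intro v hv
  rw [mem_stdL] at hv
  rw [LinearMap.mem_ker, planeForm_apply, hv.1, hv.2]; ring

theorem ker_planeForm_ne_stdT (t : Fin 3 → k) (i : Fin 3) :
    LinearMap.ker (planeForm t i) ≠ stdT k := by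
  intro h
  have h3 : (3 : Fin 4) ≠ i.castSucc := (Fin.castSucc_lt_last i).ne'
  have : (Pi.single i.castSucc 1 : V4 k) ∈ stdT k := by rw [mem_stdT]; simp [h3]
  rw [← h, LinearMap.mem_ker, planeForm_apply] at this
  simp [h3] at this

/-- A plane through `x_i = w = 0` other than `w = 0` has an equation `x_i + t w`. -/
theorem exists_smul_planeForm {i : Fin 3} {φ : Module.Dual k (V4 k)} (hφ : φ ≠ 0)
    (h1 : stdL k i ≤ LinearMap.ker φ) (h2 : LinearMap.ker φ ≠ stdT k) :
    ∃ c s : k, c ≠ 0 ∧ ∀ v, φ v = c * (v i.castSucc + s * v 3) := by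
  have h3 : i.castSucc ≠ (3 : Fin 4) := (Fin.castSucc_lt_last i).ne
  have hform : ∀ v, φ v = φ (Pi.single i.castSucc 1) * v i.castSucc + φ (Pi.single 3 1) * v 3 := by
    intro v
    have : v - v i.castSucc • Pi.single i.castSucc 1 - v 3 • Pi.single 3 1 ∈ stdL k i := by
      rw [mem_stdL]; simp [h3, h3.symm]
    have := h1 this
    rw [LinearMap.mem_ker, map_sub, map_sub, map_smul, map_smul] at this
    simp only [smul_eq_mul] at this
    linear_combination this
  have hc : φ (Pi.single i.castSucc 1) ≠ 0 := by
    intro hc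
    rw [hc] at hform
    by_cases h0 : φ (Pi.single 3 1) = 0
    · exact hφ (LinearMap.ext fun v => by rw [hform, h0]; simp)
    · refine h2 (Submodule.ext fun v => ?_)
      rw [LinearMap.mem_ker, hform, mem_stdT]
      simp [h0]
  exact ⟨_, φ (Pi.single 3 1) / φ (Pi.single i.castSucc 1), hc, fun v => by
    rw [hform]; field_simp⟩

namespace Coef

variable {a : Coef k}

/-- The quadratic form of the Cremona quadric with parameters `t`. -/
noncomputable def quadric (a : Coef k) (t : Fin 3 → k) : Form k :=
  pull (shiftV (t 0) (t 1) (t 2)).toLinearMap (a.shift (t 0) (t 1) (t 2)).qForm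

/-- This identity shows that `a.quadric t` cuts out the residual conics: modulo `f`, the product of
the three planes is `- w Q_t`. -/
theorem f_eq (t : Fin 3 → k) (v : V4 k) :
    a.f v = (∏ i, planeForm t i v) + v 3 * eval v (a.quadric t) := by
  rw [quadric, eval_pull, eval_qForm, ← f_shift a v (t 0) (t 1) (t 2), f, Fin.prod_univ_three]
  rfl

theorem quadric_isHomogeneous (t : Fin 3 → k) : (a.quadric t).IsHomogeneous 2 :=
  pull_isHomogeneous _ (qForm_isHomogeneous _)

theorem singular_quadric_iff (h2 : (2 : k) ≠ 0) (t : Fin 3 → k) (v : V4 k) :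
    (eval v (a.quadric t) = 0 ∧ ∀ i, eval v (pderiv i (a.quadric t)) = 0) ↔
      a.CremonaSingular (t 0) (t 1) (t 2) v := by
  rw [quadric, singular_pull_iff]
  simp only [Fin.forall_fin_succ, eval_qForm]
  simp
  change _ ∧ eval _ (pderiv 0 _) = 0 ∧ eval _ (pderiv 1 _) = 0 ∧ eval _ (pderiv 2 _) = 0 ∧
    eval _ (pderiv 3 _) = 0 ↔ _
  rw [eval_pderiv0_qForm, eval_pderiv1_qForm, eval_pderiv2_qForm, eval_pderiv3_qForm]
  refine and_iff_right_of_imp ?_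
  rintro ⟨h0, h1, hh2, h3⟩
  exact mul_left_cancel₀ h2 (by rw [two_mul_q, h0, h1, hh2, h3]; ring)

theorem Smooth.quadric_ne_zero [Infinite k] (ha : a.Smooth) (t : Fin 3 → k) : a.quadric t ≠ 0 := by
  intro h
  have hd := ha.d0_ne_zero
  have := congrArg (pull (shiftV (t 0) (t 1) (t 2)).symm.toLinearMap) h
  rw [quadric, pull_symm_pull, map_zero] at this
  have h1 := eval_qForm (a.shift (t 0) (t 1) (t 2)) ![1, 0, 0, 0]
  rw [this, map_zero] at h1
  simp [q] at h1
  exact hd h1.symm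

/-- Any quadric `Q` allowed by the definition has `Q_t` as a scalar multiple, where `t` are the
parameters of its planes. So a singular point of `Q` is singular on `Q_t`, whatever the scalar. -/
theorem eval_quartic_of_cutsOut [Infinite k] (h2 : (2 : k) ≠ 0)
    {P : Fin 3 → Submodule k (V4 k)} {Q : Form k}
    (h : CutsOutResidualConics a.cubic (stdT k) (stdL k) P Q) {v : V4 k}
    (hQ : eval v Q = 0 ∧ ∀ i, eval v (pderiv i Q) = 0) : a.g v = 0 := by
  obtain ⟨hP, hQ2, w, π, hw, hπ, hI⟩ := h
  obtain ⟨ω, rfl, hω⟩ := hw.exists_ker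
  have hω' : ∃ e : k, ∀ v, ω v = e * v 3 := by
    refine ⟨ω (Pi.single 3 1), fun v => ?_⟩
    have : v - v 3 • Pi.single 3 1 ∈ stdT k := by rw [mem_stdT]; simp
    rw [hω, LinearMap.mem_ker, map_sub, map_smul, smul_eq_mul] at this
    linear_combination this
  obtain ⟨e, he⟩ := hω'
  have hπ' : ∀ i, ∃ c s : k, c ≠ 0 ∧ ∀ v, eval v (π i) = c * (v i.castSucc + s * v 3) := by
    intro i
    obtain ⟨p, hp, hPp⟩ := (hπ i).exists_ker
    obtain ⟨c, s, hc, hs⟩ := exists_smul_planeForm (φ := p) (i := i)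
      (by
        rintro rfl
        have := (hP i).1
        rw [hPp, LinearMap.ker_zero, finrank_top, Module.finrank_fin_fun] at this
        omega)
      (hPp ▸ (hP i).2.1) (hPp ▸ (hP i).2.2)
    exact ⟨c, s, hc, fun v => by rw [hp, eval_lin, hs]⟩
  choose c t hc ht using hπ'
  have hmem : ∏ i, π i ∈ Ideal.span {a.cubic, lin ω * Q} := by
    rw [hI]; exact Ideal.subset_span (by simp)
  obtain ⟨A, B, hAB⟩ := Ideal.mem_span_pair.1 hmem
  have hprod : (∏ i, π i).IsHomogeneous 3 := by
    rw [Fin.prod_univ_three]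
    exact ((hπ 0).1.mul (hπ 1).1).mul (hπ 2).1
  -- All three members have degree three, so the coefficients from the ideal membership may be taken
  -- to be constants.
  have hcomb := isHomogeneous_combination a.cubic_isHomogeneous ((lin_isHomogeneous ω).mul hQ2)
    hprod hAB
  simp only [eval_cubic, map_mul, eval_lin, map_prod, he] at hcomb
  set α := eval 0 A
  set β := eval 0 B
  have hprod' : ∀ v, ∏ i, eval v (π i) = (∏ i, c i) * ∏ i, planeForm t i v := by
    intro v
    rw [← Finset.prod_mul_distrib]
    exact Finset.prod_congr rfl fun i _ => by rw [ht]; rfl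
  -- Evaluation at a point of `w = 0` off the triangle removes the term with `Q`.
  have hα : α = ∏ i, c i := by
    have := hcomb ![1, 1, 1, 0]
    rw [hprod'] at this
    simpa [f, planeForm_apply, Fin.prod_univ_three] using this
  have hα0 : α ≠ 0 := by rw [hα]; exact Finset.prod_ne_zero_iff.2 fun i _ => hc i
  have hX : X 3 * (C (β * e) * Q + C α * a.quadric t) = 0 := eq_of_eval_eq fun v => by
    have := hcomb v
    rw [hprod', ← hα, f_eq t] at this
    simp only [map_mul, map_add, eval_X, eval_C, map_zero]
    linear_combination this
  rw [mul_eq_zero, or_iff_right (X_ne_zero 3)] at hX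
  have hq : a.quadric t = C (-(β * e) / α) * Q := by
    have h1 : C α * a.quadric t = C α * (C (-(β * e) / α) * Q) := by
      rw [← mul_assoc, ← C_mul, mul_div_cancel₀ _ hα0]
      rw [C_neg]; linear_combination hX
    exact mul_left_cancel₀ (by simpa using hα0) h1
  refine g_eq_zero_of_cremonaSingular h2 ((singular_quadric_iff h2 t v).1 ?_)
  rw [hq]
  refine ⟨by simp [hQ.1], fun i => ?_⟩
  rw [pderiv_C_mul, map_mul, hQ.2, mul_zero]

theorem cutsOut_quadric [Infinite k] (t : Fin 3 → k) :
    CutsOutResidualConics a.cubic (stdT k) (stdL k) (fun i => LinearMap.ker (planeForm t i))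
      (a.quadric t) := by
  refine ⟨fun i => ⟨finrank_ker (planeForm_ne_zero t i), stdL_le_ker_planeForm t i,
    ker_planeForm_ne_stdT t i⟩, quadric_isHomogeneous t, lin (LinearMap.proj 3),
    fun i => lin (planeForm t i), isEquationOf_lin _, fun i => isEquationOf_lin _, ?_⟩
  have h : a.cubic = (∏ i, lin (planeForm t i)) + lin (LinearMap.proj 3) * a.quadric t :=
    eq_of_eval_eq fun v => by
      simp only [eval_cubic, f_eq t v, map_add, map_prod, eval_lin, map_mul, LinearMap.proj_apply]
  apply le_antisymm <;> rw [Ideal.span_le] <;>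
    simp only [Set.insert_subset_iff, Set.singleton_subset_iff, SetLike.mem_coe]
  · exact ⟨Ideal.subset_span (by simp), Ideal.mem_span_pair.2 ⟨1, -1, by rw [h]; ring⟩⟩
  · exact ⟨Ideal.subset_span (by simp), Ideal.mem_span_pair.2 ⟨1, -1, by rw [h]; ring⟩⟩

/-- All points of the quartic outside `w f = 0` are singular on some Cremona quadric. A form `g`
vanishing at the singular points therefore makes `g w f` vanish on the quartic, which is irreducible
and of too large degree to divide `w` or `f`. -/
theorem steinerian_eq [IsAlgClosed k] (h2 : (2 : k) ≠ 0) (ha : a.Smooth) :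
    steinerian a.cubic (stdT k) (stdL k) = zeroLocus a.quartic := by
  have hG := a.quartic_isHomogeneous
  apply Set.Subset.antisymm
  · intro p hp
    refine hp 4 _ hG ?_
    rintro q ⟨P, Q, hPQ, hq⟩
    induction q using Projectivization.ind with
    | h v hv =>
      rw [mk_mem_zeroLocus hG, eval_quartic]
      exact eval_quartic_of_cutsOut h2 hPQ ((mk_mem_singularPoints hPQ.2.1 v hv).1 hq)
  · intro p hp d g hg hA
    have hdvd : a.quartic ∣ g * (X 3 * a.cubic) := by
      refine dvd_of_forall_eval_eq_zero (ha.irreducible_quartic h2) fun v hv => ?_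
      rw [map_mul, map_mul, eval_X, eval_cubic]
      by_contra hne
      simp only [mul_eq_zero, not_or] at hne
      have hv0 : v ≠ 0 := by rintro rfl; exact hne.2.1 rfl
      rw [eval_quartic] at hv
      obtain ⟨t0, t1, t2, ht, -⟩ := exists_cremonaSingular_of_finite hne.2.1 hne.2.2 hv
      have hmem : Projectivization.mk k v hv0 ∈ zeroLocus g := by
        refine hA ⟨_, _, cutsOut_quadric ![t0, t1, t2], ?_⟩
        rw [mk_mem_singularPoints (quadric_isHomogeneous _), singular_quadric_iff h2]
        exact ht
      exact hne.1 ((mk_mem_zeroLocus hg v hv0).1 hmem)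
    have hprime := (ha.irreducible_quartic h2).prime
    have hdeg : ∀ (b : Form k) (n : ℕ), b.IsHomogeneous n → b ≠ 0 → n < 4 → ¬ a.quartic ∣ b := by
      rintro b n hb hb0 hn ⟨r, rfl⟩
      rw [mul_ne_zero_iff] at hb0
      have := totalDegree_mul_of_isDomain hb0.1 hb0.2
      rw [hb.totalDegree (mul_ne_zero hb0.1 hb0.2), hG.totalDegree hb0.1] at this
      omega
    have hc0 : a.cubic ≠ 0 := by
      intro h
      have := a.eval_cubic ![1, 1, 1, 0]
      rw [h, map_zero] at this
      simp [f] at this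
    rcases hprime.dvd_or_dvd hdvd with h | h
    · obtain ⟨r, rfl⟩ := h
      induction p using Projectivization.ind with
      | h v hv =>
        rw [mk_mem_zeroLocus hG] at hp
        rw [mk_mem_zeroLocus hg, map_mul, hp, zero_mul]
    · rcases hprime.dvd_or_dvd h with h | h
      · exact absurd h (hdeg _ 1 (isHomogeneous_X k 3) (X_ne_zero 3) (by norm_num))
      · exact absurd h (hdeg _ 3 a.cubic_isHomogeneous hc0 (by norm_num))

end Coef

end CremonaQuartic

/-! ### Cremona quadrics that split into two planes, and the vertices on their singular lines. -/

namespace CremonaQuartic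

variable {k : Type*} [Field k]

open MvPolynomial

theorem exists_ne_zero_of_three (φ : Fin 3 → Module.Dual k (V4 k)) :
    ∃ v : V4 k, v ≠ 0 ∧ ∀ i, φ i v = 0 := by
  have := LinearMap.ker_ne_bot_of_finrank_lt (f := LinearMap.pi φ) (by simp)
  obtain ⟨v, hv, h0⟩ := (Submodule.ne_bot_iff _).1 this
  exact ⟨v, h0, fun i => congrFun hv i⟩

namespace Coef

variable {a : Coef k} {v : V4 k}

theorem q0_rot : a.rot.q0 (rotV v) = a.q1 v := by
  simp only [q0, q1, rot, rotV_apply, Matrix.cons_val]; ring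
theorem q1_rot : a.rot.q1 (rotV v) = a.q2 v := by
  simp only [q1, q2, rot, rotV_apply, Matrix.cons_val]; ring
theorem q2_rot : a.rot.q2 (rotV v) = a.q0 v := by
  simp only [q2, q0, rot, rotV_apply, Matrix.cons_val]; ring
theorem q3_rot : a.rot.q3 (rotV v) = a.q3 v := by
  simp only [q3, rot, rotV_apply, Matrix.cons_val]; ring

theorem rotV_rotV_rotV (v : V4 k) : rotV (rotV (rotV v)) = v := by
  ext i; fin_cases i <;> rfl

theorem vertex_rot {i : Fin 3} {s : k} : a.rot.Vertex i s (rotV v) ↔ a.Vertex (i + 1) s v := by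
  fin_cases i
  · rfl
  · rfl
  · change a.rot.rot.rot.IsVertex s (rotV (rotV (rotV v))) ↔ a.IsVertex s v
    have : a.rot.rot.rot = a := rfl
    rw [this, rotV_rotV_rotV]

theorem cremonaSingular_rot {t0 t1 t2 : k} :
    a.rot.CremonaSingular t1 t2 t0 (rotV v) ↔ a.CremonaSingular t0 t1 t2 v := by
  unfold CremonaSingular
  simp only [q0_shift, q1_shift, q2_shift, q3_shift, q0_rot, q1_rot, q2_rot, q3_rot]
  simp only [rotV_apply, Matrix.cons_val]
  constructor
  · rintro ⟨h0, h1, h2, h3⟩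
    exact ⟨by linear_combination h2, by linear_combination h0, by linear_combination h1,
      by linear_combination h3⟩
  · rintro ⟨h0, h1, h2, h3⟩
    exact ⟨by linear_combination h1, by linear_combination h2, by linear_combination h0,
      by linear_combination h3⟩

/-- On the plane `X_0 = 0` the quadric `Q_t` cuts out the residual conic, so a singular point of
`Q_t` in this plane is a vertex. -/
theorem isVertex_of_cremonaSingular {t0 t1 t2 : k} (h : a.CremonaSingular t0 t1 t2 v)
    (h0 : v 0 + t0 * v 3 = 0) : a.IsVertex t0 v := by
  unfold CremonaSingular at h
  simp only [q0_shift, q1_shift, q2_shift, q3_shift] at h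
  obtain ⟨k0, k1, k2, k3⟩ := h
  have e1 : a.q1 v = t0 * v 2 := by linear_combination k1 + t2 * h0
  have e2 : a.q2 v = t0 * v 1 := by linear_combination k2 + t1 * h0
  refine ⟨by linear_combination h0, e1, e2, ?_⟩
  linear_combination k3 + t1 * e1 + t2 * e2 - t1 * t2 * h0

theorem vertex_of_cremonaSingular {t : Fin 3 → k} (h : a.CremonaSingular (t 0) (t 1) (t 2) v)
    {i : Fin 3} (hi : planeForm t i v = 0) : a.Vertex i (t i) v := by
  fin_cases i
  · exact isVertex_of_cremonaSingular h hi
  · exact isVertex_of_cremonaSingular (cremonaSingular_rot.2 h) hi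
  · exact isVertex_of_cremonaSingular (cremonaSingular_rot.2 (cremonaSingular_rot.2 h)) hi

/-- The plane `x_i + s w = 0` is the tangent plane of the cubic surface at `v`; this is why a vertex
determines its plane. -/
theorem Vertex.grad (h2 : (2 : k) ≠ 0) (ha : a.Smooth) {i : Fin 3} {s : k} (h : a.Vertex i s v)
    (hv : v ≠ 0) : ![a.f0 v, a.f1 v, a.f2 v] i ≠ 0 ∧
      (∀ j, j ≠ i → ![a.f0 v, a.f1 v, a.f2 v] j = 0) ∧
      a.f3 v = s * ![a.f0 v, a.f1 v, a.f2 v] i := by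
  fin_cases i
  · have h' : a.IsVertex s v := h
    refine ⟨h'.f0_ne_zero h2 ha hv, fun j hj => ?_, h'.f3_eq h2⟩
    fin_cases j
    exacts [absurd rfl hj, h'.f1_eq, h'.f2_eq]
  · have h' : a.rot.IsVertex s (rotV v) := h
    refine ⟨?_, fun j hj => ?_, ?_⟩
    · have := h'.f0_ne_zero h2 ha.rot (by simpa using hv)
      rwa [f0_rot] at this
    · fin_cases j
      exacts [(f2_rot a v).symm.trans h'.f2_eq, absurd rfl hj, (f1_rot a v).symm.trans h'.f1_eq]
    · have := h'.f3_eq h2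
      rwa [f0_rot, f3_rot] at this
  · have h' : a.rot.rot.IsVertex s (rotV (rotV v)) := h
    refine ⟨?_, fun j hj => ?_, ?_⟩
    · have := h'.f0_ne_zero h2 ha.rot.rot (by simpa using hv)
      rwa [f0_rot, f1_rot] at this
    · fin_cases j
      · have := h'.f1_eq
        rwa [f1_rot, f2_rot] at this
      · have := h'.f2_eq
        rwa [f2_rot, f0_rot] at this
      · exact absurd rfl hj
    · have := h'.f3_eq h2
      rwa [f0_rot, f1_rot, f3_rot, f3_rot] at this

/-- A node of the quartic surface determines the plane of which it is a vertex. -/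
theorem Vertex.unique (h2 : (2 : k) ≠ 0) (ha : a.Smooth) {i j : Fin 3} {s r : k}
    (h : a.Vertex i s v) (h' : a.Vertex j r v) (hv : v ≠ 0) : i = j ∧ s = r := by
  obtain ⟨n1, z1, e1⟩ := h.grad h2 ha hv
  obtain ⟨n2, z2, e2⟩ := h'.grad h2 ha hv
  have hij : i = j := by
    by_contra hne
    exact n1 (z2 i hne)
  subst hij
  exact ⟨rfl, mul_right_cancel₀ n1 (e1.symm.trans e2)⟩

theorem Vertex.eq_smul [IsAlgClosed k] (h2 : (2 : k) ≠ 0) (ha : a.Smooth) {i : Fin 3} {s : k}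
    (h : a.Vertex i s v) (hv : v ≠ 0) {u : V4 k} (hu : a.Vertex i s u) : ∃ r : k, u = r • v := by
  obtain ⟨r, hr⟩ := IsVertex.eq_smul h2 (ha.rots i) h (by simpa using hv) hu
  exact ⟨r, (rotsV i).injective (by rw [hr, map_smul])⟩

/-- The Cremona quadric with parameters `t` is the pair of planes `A B = 0`. -/
def IsSplit (a : Coef k) (t : Fin 3 → k) (A B : Module.Dual k (V4 k)) : Prop :=
  ∀ v, eval v (a.quadric t) = A v * B v

theorem eval_quadric (t : Fin 3 → k) (v : V4 k) : eval v (a.quadric t) =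
    a.q v - (t 0 * v 1 * v 2 + t 1 * v 0 * v 2 + t 2 * v 0 * v 1)
      - v 3 * (t 1 * t 2 * v 0 + t 0 * t 2 * v 1 + t 0 * t 1 * v 2) - t 0 * t 1 * t 2 * v 3 ^ 2 := by
  rw [← q_shift, quadric, eval_pull, eval_qForm]; rfl

theorem q_rot : a.rot.q (rotV v) = a.q v := by
  simp only [q, rot, rotV_apply, Matrix.cons_val]; ring

theorem IsSplit.of_rot {t : Fin 3 → k} {A B : Module.Dual k (V4 k)} (h : a.rot.IsSplit t A B) :
    a.IsSplit (fun i => t (i + 2)) (A ∘ₗ rotV.toLinearMap) (B ∘ₗ rotV.toLinearMap) := by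
  intro v
  have := h (rotV v)
  rw [eval_quadric, q_rot] at this
  simp only [rotV_apply, Matrix.cons_val] at this
  rw [eval_quadric]
  simp only [LinearMap.comp_apply, LinearEquiv.coe_coe, rotV_apply, Fin.reduceAdd]
  linear_combination this

theorem Vertex.planeForm_eq_zero {t : Fin 3 → k} {i : Fin 3} (h : a.Vertex i (t i) v) :
    planeForm t i v = 0 := by
  have := h.1
  rw [planeForm_apply, ← neg_eq_iff_add_eq_zero.mp (neg_eq_iff_eq_neg.2 this)]
  fin_cases i <;> rfl

namespace IsSplit

variable {t : Fin 3 → k} {A B : Module.Dual k (V4 k)}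

theorem cremonaSingular [Infinite k] (h2 : (2 : k) ≠ 0) (h : a.IsSplit t A B) (hA : A v = 0) (hB : B v = 0) :
    a.CremonaSingular (t 0) (t 1) (t 2) v := by
  have : a.quadric t = lin A * lin B := eq_of_eval_eq fun v => by
    rw [h v, map_mul, eval_lin, eval_lin]
  rw [← singular_quadric_iff h2, this]
  simp [eval_lin, hA, hB]

/-- The line `A = B = 0` meets the plane `X_i = 0`, and all its points are singular on `Q_t`. -/
theorem exists_vertex [Infinite k] (h2 : (2 : k) ≠ 0) (h : a.IsSplit t A B) (i : Fin 3) :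
    ∃ n, n ≠ 0 ∧ a.Vertex i (t i) n ∧ A n = 0 ∧ B n = 0 := by
  obtain ⟨n, hn, h0⟩ := exists_ne_zero_of_three ![planeForm t i, A, B]
  exact ⟨n, hn, vertex_of_cremonaSingular (h.cremonaSingular h2 (h0 1) (h0 2)) (h0 0), h0 1, h0 2⟩

/-- A vertex lies on the singular line of a split Cremona quadric if and only if its plane is one
of the three planes that define the quadric. -/
theorem vertex_mem_iff [IsAlgClosed k] (h2 : (2 : k) ≠ 0) (ha : a.Smooth) (h : a.IsSplit t A B)
    {i : Fin 3} {s : k} (hv : a.Vertex i s v) (h0 : v ≠ 0) : (A v = 0 ∧ B v = 0) ↔ t i = s := by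
  constructor
  · rintro ⟨hA, hB⟩
    have hc := h.cremonaSingular h2 hA hB
    -- The vertex lies on the cubic surface and on `Q_t`, hence on one of the three planes `X_j =
    -- 0`; uniqueness of its plane identifies `j` and the parameter.
    have hf : a.f v = 0 := by
      have := IsVertex.f_eq h2 hv
      rwa [f_rots] at this
    rw [f_eq t, h v, hA, zero_mul, mul_zero, add_zero, Finset.prod_eq_zero_iff] at hf
    obtain ⟨j, -, hj⟩ := hf
    obtain ⟨rfl, h'⟩ := (vertex_of_cremonaSingular hc hj).unique h2 ha hv h0
    exact h'
  · rintro rfl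
    obtain ⟨n, hn, hnv, hA, hB⟩ := h.exists_vertex h2 i
    obtain ⟨r, rfl⟩ := hnv.eq_smul h2 ha hn hv
    simp [hA, hB]

/-- The singular line determines the parameters of a split Cremona quadric. -/
theorem parameters_unique [IsAlgClosed k] (h2 : (2 : k) ≠ 0) (ha : a.Smooth)
    (h : a.IsSplit t A B) {t' : Fin 3 → k} {A' B' : Module.Dual k (V4 k)} (h' : a.IsSplit t' A' B')
    (hL : ∀ v, A v = 0 → B v = 0 → A' v = 0 ∧ B' v = 0) : t = t' := by
  ext i
  obtain ⟨n, hn, hnv, hA, hB⟩ := h.exists_vertex h2 i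
  exact ((h'.vertex_mem_iff h2 ha hnv hn).1 (hL n hA hB)).symm

end IsSplit

/-- Two vertices in planes through different lines determine a split Cremona quadric: the form of
the case in which the parameters of the two planes are zero. -/
theorem exists_factor_of_vertices [IsAlgClosed k] (h2 : (2 : k) ≠ 0) (ha : a.Smooth) {n m : V4 k}
    (hn : a.Vertex 0 0 n) (hn0 : n ≠ 0) (hm : a.Vertex 1 0 m) (hm0 : m ≠ 0) :
    ∃ (r : k) (A B : Module.Dual k (V4 k)), ∀ v, a.q v - r * v 0 * v 1 = A v * B v := by
  obtain ⟨fn, -, -⟩ := hn.grad h2 ha hn0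
  obtain ⟨fm, -, -⟩ := hm.grad h2 ha hm0
  change a.f0 n ≠ 0 at fn
  change a.f1 m ≠ 0 at fm
  obtain ⟨x0, x1, x2, x3⟩ := hn
  obtain ⟨y0, y1, y2, y3⟩ := hm
  change n 0 = _ at x0
  change a.q1 n = _ at x1
  change a.q2 n = _ at x2
  change a.q3 n = _ at x3
  change m 1 = _ at y0
  change a.rot.q1 (rotV m) = _ at y1
  change a.rot.q2 (rotV m) = _ at y2
  change a.rot.q3 (rotV m) = _ at y3
  rw [q1_rot] at y1
  rw [q2_rot] at y2
  rw [q3_rot] at y3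
  simp only [zero_mul, neg_zero] at x0 x1 x2 x3 y0 y1 y2 y3
  have hd : a.d2 ≠ 0 := ha.rot.rot.d0_ne_zero
  have hsym : m 0 * a.q0 n = n 1 * a.q1 m := by
    have : m 0 * a.q0 n + m 1 * a.q1 n + m 2 * a.q2 n + m 3 * a.q3 n
      = n 0 * a.q0 m + n 1 * a.q1 m + n 2 * a.q2 m + n 3 * a.q3 m := by
      simp only [q0, q1, q2, q3]; ring
    rw [x0, x1, x2, x3, y1, y2, y3] at this
    linear_combination this
  -- Otherwise also `m 0 = 0`, both vertices lie on the line `x = y = 0` and are proportional; then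
  -- `q_1(n) = 0` contradicts `f_1(m) ≠ 0`.
  have hn1 : n 1 ≠ 0 := by
    intro h0
    simp only [f0, h0, zero_mul, zero_add, ne_eq, mul_eq_zero, not_or] at fn
    have hm0 : m 0 = 0 := by
      rw [h0, zero_mul, mul_eq_zero] at hsym
      exact hsym.resolve_right fn.2
    simp only [f1, hm0, zero_mul, zero_add, ne_eq, mul_eq_zero, not_or] at fm
    have e2 : n 2 * m 3 = m 2 * n 3 := by
      refine mul_left_cancel₀ (mul_ne_zero h2 hd) ?_
      rw [q2, x0, h0] at x2
      rw [q2, hm0, y0] at y1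
      linear_combination m 3 * x2 - n 3 * y1
    have : n 3 * a.q1 m = 0 := by
      rw [q1, x0, h0] at x1
      rw [q1, hm0, y0]
      linear_combination m 3 * x1 - a.m0 * e2
    exact mul_ne_zero fn.1 fm.2 this
  have hm0 : m 0 ≠ 0 := by
    intro h0
    rw [h0, zero_mul, eq_comm, mul_eq_zero] at hsym
    exact fm (by rw [f1, h0, hsym.resolve_left hn1]; ring)
  -- This `r` makes the quadric `q - r x y` singular at `n`. By symmetry of the polar form the same
  -- `r` works at `m`, so the quadric is singular along the line through both points.
  obtain ⟨r, hr⟩ : ∃ r, a.q0 n = r * n 1 := ⟨a.q0 n / n 1, by field_simp⟩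
  have hr' : a.q1 m = r * m 0 := mul_left_cancel₀ hn1 (by rw [← hsym, hr]; ring)
  -- Modulo its singular line the quadric is the binary form `d2 Z² + b2 Z W + c W²`; the root `ρ`
  -- factors it.
  obtain ⟨ρ, hρ⟩ : ∃ ρ : k, a.d2 * ρ ^ 2 + a.b2 * ρ + a.c = 0 := by
    have : NeZero (2 : k) := ⟨h2⟩
    obtain ⟨e, he⟩ := IsAlgClosed.exists_pow_nat_eq (discrim a.d2 a.b2 a.c) (n := 2) (by norm_num)
    obtain ⟨ρ, hρ⟩ := exists_quadratic_eq_zero hd ⟨e, by rw [← he]; ring⟩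
    exact ⟨ρ, by rw [← hρ]; ring⟩
  -- `r2` and `r3` vanish at `n` and `m`: they are `z` and `w` corrected along the singular line.
  let r2 : Module.Dual k (V4 k) := LinearMap.proj 2 - (n 2 / n 1) • LinearMap.proj 1
    - (m 2 / m 0) • LinearMap.proj 0
  let r3 : Module.Dual k (V4 k) := LinearMap.proj 3 - (n 3 / n 1) • LinearMap.proj 1
    - (m 3 / m 0) • LinearMap.proj 0
  refine ⟨r, r2 - ρ • r3, a.d2 • r2 + (a.b2 + a.d2 * ρ) • r3, fun v => ?_⟩
  have hr2 : r2 v = v 2 - n 2 / n 1 * v 1 - m 2 / m 0 * v 0 := rfl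
  have hr3 : r3 v = v 3 - n 3 / n 1 * v 1 - m 3 / m 0 * v 0 := rfl
  obtain ⟨α, hα⟩ : ∃ α, v 1 = α * n 1 := ⟨v 1 / n 1, by field_simp⟩
  obtain ⟨β, hβ⟩ : ∃ β, v 0 = β * m 0 := ⟨v 0 / m 0, by field_simp⟩
  have hv2 : v 2 = r2 v + α * n 2 + β * m 2 := by rw [hr2, hα, hβ]; field_simp; ring
  have hv3 : v 3 = r3 v + α * n 3 + β * m 3 := by rw [hr3, hα, hβ]; field_simp; ring
  have key : a.q v - r * v 0 * v 1 = a.d2 * r2 v ^ 2 + a.b2 * r2 v * r3 v + a.c * r3 v ^ 2 := by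
    have e1 := a.two_mul_q n
    have e2 := a.two_mul_q m
    rw [x0, x1, x2, x3] at e1
    rw [y0, y1, y2, y3] at e2
    have qn : a.q n = 0 := mul_left_cancel₀ h2 (by rw [e1]; ring)
    have qm : a.q m = 0 := mul_left_cancel₀ h2 (by rw [e2]; ring)
    rw [q, hv2, hv3, hα, hβ]
    generalize r2 v = p at *
    generalize r3 v = u at *
    simp only [q, q0, q1, q2, q3, x0, y0] at *
    linear_combination α ^ 2 * qn + β ^ 2 * qm + α * (p * x2 + u * x3) + β * (p * y1 + u * y3)
      + α * β * m 0 * hr + α * β * (m 2 * x2 + m 3 * x3)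
  have hAB : (r2 - ρ • r3) v * (a.d2 • r2 + (a.b2 + a.d2 * ρ) • r3) v =
      (r2 v - ρ * r3 v) * (a.d2 * r2 v + (a.b2 + a.d2 * ρ) * r3 v) := by
    simp only [LinearMap.sub_apply, LinearMap.smul_apply, LinearMap.add_apply, smul_eq_mul]
  rw [key, hAB]
  linear_combination r3 v ^ 2 * hρ

theorem rot_shift (t0 t1 t2 : k) : (a.shift t0 t1 t2).rot = a.rot.shift t1 t2 t0 := by
  simp only [rot, shift, mk.injEq, true_and]
  exact ⟨by ring, by ring, by ring⟩

/-- Two vertices in planes through different lines determine a split Cremona quadric. -/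
theorem exists_isSplit [IsAlgClosed k] (h2 : (2 : k) ≠ 0) : ∀ (i : Fin 3) {a : Coef k}, a.Smooth →
    ∀ {n m : V4 k} {s r : k}, a.Vertex i s n → n ≠ 0 → a.Vertex (i + 1) r m → m ≠ 0 →
      ∃ t A B, a.IsSplit t A B ∧ t i = s ∧ t (i + 1) = r := by
  intro i
  induction i using Fin.induction with
  | zero =>
    intro a ha n m s r hn hn0 hm hm0
    -- The shift moves the two given planes to the parameter zero; the third parameter is free and
    -- is the `p` obtained here. The other pairs of pencils follow by cyclic rotation.
    obtain ⟨p, A, B, h⟩ := exists_factor_of_vertices (a := a.shift s r 0) h2 (ha.shift s r 0)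
      (n := shiftV s r 0 n) (m := shiftV s r 0 m) (IsVertex.shift hn) (by simpa using hn0)
      (by
        change (a.shift s r 0).rot.IsVertex 0 (shiftV r 0 s (rotV m))
        rw [rot_shift]
        exact IsVertex.shift hm) (by simpa using hm0)
    refine ⟨![s, r, p], A ∘ₗ (shiftV s r 0).toLinearMap, B ∘ₗ (shiftV s r 0).toLinearMap,
      fun v => ?_, rfl, rfl⟩
    have := h (shiftV s r 0 v)
    rw [q_shift] at this
    simp only [LinearMap.comp_apply, LinearEquiv.coe_coe]
    rw [← this, eval_quadric]
    simp only [shiftV_apply, Matrix.cons_val]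
    ring
  | succ i ih =>
    intro a ha n m s r hn hn0 hm hm0
    have hi : i.succ = i.castSucc + 1 := by rw [Fin.coeSucc_eq_succ]
    rw [hi] at hn hm ⊢
    obtain ⟨t, A, B, h, rfl, rfl⟩ := ih ha.rot (vertex_rot.2 hn) (by simpa using hn0)
      (vertex_rot.2 hm) (by simpa using hm0)
    have h3 : (1 + 2 : Fin 3) = 0 := rfl
    refine ⟨_, _, _, h.of_rot, ?_, ?_⟩ <;> simp only [add_assoc, h3, add_zero]

/-- Subtract the two decompositions `f = X_0 X_1 X_2 + w Q_t`: the products share two factors, and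
the third factors differ by a multiple of `w`. -/
theorem eval_quadric_sub {t t' : Fin 3 → k} {i : Fin 3} (h : t i = t' i)
    (h' : t (i + 1) = t' (i + 1)) (v : V4 k) : eval v (a.quadric t') - eval v (a.quadric t) =
      (t (i + 2) - t' (i + 2)) * planeForm t i v * planeForm t (i + 1) v := by
  rw [eval_quadric, eval_quadric, planeForm_apply, planeForm_apply]
  fin_cases i <;> simp at h h' ⊢ <;> rw [h, h'] <;> ring

/-- A split Cremona quadric is determined by two of its parameters. -/
theorem IsSplit.eq_of_eq [IsAlgClosed k] (h2 : (2 : k) ≠ 0) (ha : a.Smooth) {t t' : Fin 3 → k}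
    {A B A' B' : Module.Dual k (V4 k)} (h : a.IsSplit t A B) (h' : a.IsSplit t' A' B') {i : Fin 3}
    (hi : t i = t' i) (hi' : t (i + 1) = t' (i + 1)) : t = t' := by
  obtain ⟨n, hn, hnv, hA, hB⟩ := h.exists_vertex h2 i
  obtain ⟨hA', hB'⟩ := (h'.vertex_mem_iff h2 ha hnv hn).2 hi.symm
  have h0 := hnv.planeForm_eq_zero
  have h1 : planeForm t (i + 1) n ≠ 0 := fun h1 => by
    have := ((vertex_of_cremonaSingular (h.cremonaSingular h2 hA hB) h1).unique h2 ha hnv hn).1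
    simp at this
  have key : ∀ v, A' v * B' v - A v * B v =
      (t (i + 2) - t' (i + 2)) * planeForm t i v * planeForm t (i + 1) v := fun v => by
    rw [← eval_quadric_sub hi hi', h v, h' v]
  have h3 : (3 : Fin 4) ≠ i.castSucc := (Fin.castSucc_lt_last i).ne'
  have e1 := key (Pi.single i.castSucc 1)
  -- The vertex `n` lies on both singular lines, so translation by `n` does not change the left side
  -- of `key`, while the right side changes by the difference of the third parameters times
  -- `planeForm t (i + 1) n ≠ 0`.
  have e2 := key (n + Pi.single i.castSucc 1)
  simp only [map_add, hA, hB, hA', hB', h0, zero_add] at e2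
  have hu : planeForm t i (Pi.single i.castSucc 1) = 1 := by simp [planeForm_apply, h3]
  rw [hu] at e1 e2
  have h2' : t (i + 2) = t' (i + 2) := by
    refine sub_eq_zero.1 ((mul_eq_zero.1 ?_).resolve_right h1)
    linear_combination e1 - e2
  ext j
  fin_cases i <;> fin_cases j <;> assumption

end Coef

end CremonaQuartic

/-! ### Planes, quadratic forms vanishing on lines, and trihedral pairs. -/

namespace CremonaQuartic

variable {k : Type*} [Field k]

open MvPolynomial

section Planes

theorem exists_ker_of_finrank_eq_three {W : Submodule k (V4 k)} (h : Module.finrank k W = 3) :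
    ∃ φ : Module.Dual k (V4 k), φ ≠ 0 ∧ W = LinearMap.ker φ := by
  have hlt : W < ⊤ := by
    rw [lt_top_iff_ne_top]
    rintro rfl
    rw [finrank_top, Module.finrank_fin_fun] at h
    omega
  obtain ⟨φ, h0, hφ⟩ := W.exists_le_ker_of_lt_top hlt
  exact ⟨φ, h0, Submodule.eq_of_le_of_finrank_eq hφ (by rw [h, finrank_ker h0])⟩

/-- Two different planes meet in a line. -/
theorem finrank_inf_eq_two {U W : Submodule k (V4 k)} (hU : Module.finrank k U = 3)
    (hW : Module.finrank k W = 3) (h : U ≠ W) : Module.finrank k (U ⊓ W : Submodule k (V4 k)) = 2 := by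
  have hs := Submodule.finrank_sup_add_finrank_inf_eq U W
  have hlt : U < U ⊔ W := by
    refine lt_of_le_of_ne le_sup_left fun he => h ?_
    have : W ≤ U := by rw [he]; exact le_sup_right
    exact (Submodule.eq_of_le_of_finrank_eq this (by rw [hU, hW])).symm
  have h1 := Submodule.finrank_lt_finrank_of_lt hlt
  have h2 := Submodule.finrank_le (U ⊔ W)
  rw [Module.finrank_fin_fun] at h2
  omega

/-- A subspace on which a product of linear functionals vanishes is contained in a kernel. -/
theorem exists_le_ker_of_prod_eq_zero [Infinite k] {ι : Type*} [Fintype ι]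
    {φ : ι → Module.Dual k (V4 k)} {L : Submodule k (V4 k)} (h : ∀ v ∈ L, ∏ i, φ i v = 0) :
    ∃ i, L ≤ LinearMap.ker (φ i) := by
  -- A vector space over an infinite field is not a finite union of proper subspaces.
  obtain ⟨i, hi⟩ := Subspace.exists_eq_top_of_iUnion_eq_univ (k := k) (E := L)
    (p := fun i => (LinearMap.ker (φ i)).comap L.subtype) (by
      refine Set.eq_univ_of_forall fun v => ?_
      obtain ⟨i, -, hi⟩ := Finset.prod_eq_zero_iff.1 (h v v.2)
      exact Set.mem_iUnion.2 ⟨i, hi⟩)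
  exact ⟨i, Submodule.comap_subtype_eq_top.1 hi⟩

theorem finrank_stdL (i : Fin 3) : Module.finrank k (stdL k i) = 2 := by
  have h3 : (3 : Fin 4) ≠ i.castSucc := (Fin.castSucc_lt_last i).ne'
  refine finrank_inf_eq_two (finrank_ker fun h => ?_) finrank_stdT fun h => ?_
  · have := LinearMap.congr_fun h (Pi.single i.castSucc 1)
    simp at this
  · have : (Pi.single i.castSucc 1 : V4 k) ∈ stdT k := by rw [mem_stdT]; simp [h3]
    rw [← h] at this
    simp at this

/-- A quadratic form that vanishes on the planes `φ = 0` and `ψ = 0` of `W` is a multiple of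
`φ ψ` on `W`. -/
theorem exists_eq_mul_of_vanishing {Q : QuadraticForm k (V4 k)} {W : Submodule k (V4 k)}
    {φ ψ : Module.Dual k (V4 k)} (hφ : ∀ v ∈ W, φ v = 0 → Q v = 0)
    (hψ : ∀ v ∈ W, ψ v = 0 → Q v = 0) (h1 : ∃ u ∈ W, φ u = 0 ∧ ψ u ≠ 0)
    (h2 : ∃ u ∈ W, ψ u = 0 ∧ φ u ≠ 0) : ∃ c, ∀ v ∈ W, Q v = c * (φ v * ψ v) := by
  obtain ⟨u, hu, u1, u2⟩ := h1
  obtain ⟨u', hu', u1', u2'⟩ := h2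
  refine ⟨QuadraticMap.polar Q u u' / (φ u' * ψ u), fun v hv => ?_⟩
  -- `r` is killed by both functionals. Expanding `Q v` in `r`, `u`, `u'`, only the polar of `u` and
  -- `u'` survives.
  set r := v - (φ v / φ u') • u' - (ψ v / ψ u) • u with hr
  have hrW : r ∈ W := W.sub_mem (W.sub_mem hv (W.smul_mem _ hu')) (W.smul_mem _ hu)
  have r1 : φ r = 0 := by simp [hr, u1, u2']
  have r2 : ψ r = 0 := by simp [hr, u1', u2]
  have hpr : QuadraticMap.polar Q r u' = 0 := by
    rw [QuadraticMap.polar, hψ _ (W.add_mem hrW hu') (by simp [r2, u1']), hψ _ hrW r2, hψ _ hu' u1']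
    simp
  have hv' : v = (r + (ψ v / ψ u) • u) + (φ v / φ u') • u' := by rw [hr]; abel
  have h3 : Q (r + (ψ v / ψ u) • u) = 0 :=
    hφ _ (W.add_mem hrW (W.smul_mem _ hu)) (by simp [r1, u1])
  conv_lhs => rw [hv', QuadraticMap.map_add Q, h3, QuadraticMap.map_smul, hψ _ hu' u1',
    QuadraticMap.polar_smul_right, QuadraticMap.polar_add_left, hpr, QuadraticMap.polar_smul_left]
  simp only [smul_eq_mul]
  field_simp
  ring

/-- A quadratic form on a three-dimensional space that vanishes on three lines of the projective
plane is zero. -/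
theorem eq_zero_of_vanishing [Infinite k] {Q : QuadraticForm k (V4 k)} {W : Submodule k (V4 k)}
    {φ : Fin 3 → Module.Dual k (V4 k)} (hφ : ∀ i, ∀ v ∈ W, φ i v = 0 → Q v = 0)
    (h : ∀ i j, i ≠ j → ∃ u ∈ W, φ i u = 0 ∧ φ j u ≠ 0) : ∀ v ∈ W, Q v = 0 := by
  obtain ⟨c, hc⟩ := exists_eq_mul_of_vanishing (hφ 0) (hφ 1) (h 0 1 (by decide)) (h 1 0 (by decide))
  -- A point of the third line off the first two forces the constant `c` to be zero.
  obtain ⟨u, hu, h0, h1⟩ : ∃ u ∈ W ⊓ LinearMap.ker (φ 2), φ 0 u ≠ 0 ∧ φ 1 u ≠ 0 := by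
    by_contra! hne
    obtain ⟨i, hi⟩ := exists_le_ker_of_prod_eq_zero (L := W ⊓ LinearMap.ker (φ 2))
      (φ := ![φ 0, φ 1]) fun v hv => by
        rw [Fin.prod_univ_two]
        by_cases h0 : φ 0 v = 0
        · exact mul_eq_zero_of_left h0 _
        · exact mul_eq_zero_of_right _ (hne v hv h0)
    fin_cases i
    · obtain ⟨u, hu, h1, h2⟩ := h 2 0 (by decide)
      exact h2 (hi ⟨hu, h1⟩)
    · obtain ⟨u, hu, h1, h2⟩ := h 2 1 (by decide)
      exact h2 (hi ⟨hu, h1⟩)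
  have := hc u hu.1
  rw [hφ 2 u hu.1 hu.2, eq_comm, mul_eq_zero] at this
  intro v hv
  rw [hc v hv, this.resolve_right (mul_ne_zero h0 h1), zero_mul]

end Planes

namespace Coef

variable {a : Coef k}

/-- The equation of the cubic surface is a sum of two products of three linear forms. -/
def IsTrihedralPair (a : Coef k) (Y W : Fin 3 → Module.Dual k (V4 k)) : Prop :=
  ∀ v, a.f v = (∏ i, Y i v) + ∏ i, W i v

/-- A product of linear forms is singular wherever two of the factors vanish. -/
theorem eval_prod_lin_eq_zero {Y : Fin 3 → Module.Dual k (V4 k)} {v : V4 k} {i j : Fin 3}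
    (hij : i ≠ j) (hi : Y i v = 0) (hj : Y j v = 0) :
    eval v (∏ i, lin (Y i)) = 0 ∧ ∀ m, eval v (pderiv m (∏ i, lin (Y i))) = 0 := by
  refine ⟨?_, fun m => ?_⟩
  · rw [map_prod]
    exact Finset.prod_eq_zero (Finset.mem_univ i) (by rw [eval_lin, hi])
  · simp only [Fin.prod_univ_three, Derivation.leibniz, smul_eq_mul, map_add, map_mul, eval_lin]
    fin_cases i <;> fin_cases j <;> simp_all

namespace IsTrihedralPair

variable {Y W : Fin 3 → Module.Dual k (V4 k)}

theorem symm (h : a.IsTrihedralPair Y W) : a.IsTrihedralPair W Y := fun v => by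
  rw [h v, add_comm]

/-- A point on two planes of each trihedron is singular for both products, hence for the cubic. All
nondegeneracy statements below follow: a coincidence of planes or lines would leave three linear
conditions for such a point, which have a nonzero solution. -/
theorem eq_zero [Infinite k] (h : a.IsTrihedralPair Y W) (ha : a.Smooth) {i i' j j' : Fin 3}
    (hi : i ≠ i') (hj : j ≠ j') {v : V4 k} (h1 : Y i v = 0) (h2 : Y i' v = 0) (h3 : W j v = 0)
    (h4 : W j' v = 0) : v = 0 := by
  have he : a.cubic = (∏ i, lin (Y i)) + ∏ i, lin (W i) := eq_of_eval_eq fun v => by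
    simp only [eval_cubic, h v, map_add, map_prod, eval_lin]
  obtain ⟨e1, e2⟩ := eval_prod_lin_eq_zero hi h1 h2
  obtain ⟨e3, e4⟩ := eval_prod_lin_eq_zero hj h3 h4
  obtain ⟨k1, k2, k3, k4, k5⟩ := (a.mem_singular_cubic_iff v).1
    ⟨by rw [he, map_add, e1, e3, add_zero], fun m => by rw [he, map_add, map_add, e2, e4, add_zero]⟩
  exact ha v k1 k2 k3 k4 k5

theorem ne_zero [Infinite k] (h : a.IsTrihedralPair Y W) (ha : a.Smooth) (j : Fin 3) : W j ≠ 0 := by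
  intro h0
  obtain ⟨v, hv, hv0⟩ := exists_ne_zero_of_three ![Y 0, Y 1, W (j + 1)]
  exact hv (h.eq_zero ha (i := 0) (i' := 1) (j := j) (j' := j + 1) (by decide) (by simp) (hv0 0)
    (hv0 1) (by rw [h0]; rfl) (hv0 2))

theorem ker_ne_ker [Infinite k] (h : a.IsTrihedralPair Y W) (ha : a.Smooth) (i j : Fin 3) :
    LinearMap.ker (Y i) ≠ LinearMap.ker (W j) := by
  intro he
  obtain ⟨v, hv, hv0⟩ := exists_ne_zero_of_three ![Y i, Y (i + 1), W (j + 1)]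
  have : v ∈ LinearMap.ker (W j) := he ▸ hv0 0
  exact hv (h.eq_zero ha (i := i) (i' := i + 1) (j := j) (j' := j + 1) (by simp) (by simp) (hv0 0)
    (hv0 1) this (hv0 2))

theorem ker_injective [Infinite k] (h : a.IsTrihedralPair Y W) (ha : a.Smooth) :
    Function.Injective fun j => LinearMap.ker (W j) := by
  intro i j he
  by_contra hij
  obtain ⟨v, hv, hv0⟩ := exists_ne_zero_of_three ![Y 0, Y 1, W i]
  have : v ∈ LinearMap.ker (W j) := by
    change LinearMap.ker (W i) = LinearMap.ker (W j) at he
    exact he ▸ hv0 2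
  exact hv (h.eq_zero ha (by decide : (0 : Fin 3) ≠ 1) hij (hv0 0) (hv0 1) (hv0 2) this)

theorem finrank_ker_inf_ker [Infinite k] (h : a.IsTrihedralPair Y W) (ha : a.Smooth)
    (i j : Fin 3) :
    Module.finrank k (LinearMap.ker (Y i) ⊓ LinearMap.ker (W j) : Submodule k (V4 k)) = 2 :=
  finrank_inf_eq_two (finrank_ker (h.symm.ne_zero ha i)) (finrank_ker (h.ne_zero ha j))
    (h.ker_ne_ker ha i j)

theorem lines_injective [Infinite k] (h : a.IsTrihedralPair Y W) (ha : a.Smooth) :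
    Function.Injective fun ij : Fin 3 × Fin 3 =>
      LinearMap.ker (Y ij.1) ⊓ LinearMap.ker (W ij.2) := by
  rintro ⟨i, j⟩ ⟨i', j'⟩ he
  by_contra hne
  replace he : LinearMap.ker (Y i) ⊓ LinearMap.ker (W j) =
    LinearMap.ker (Y i') ⊓ LinearMap.ker (W j') := he
  by_cases hi : i = i'
  · have hj : j ≠ j' := fun hj => hne (by rw [hi, hj])
    obtain ⟨v, hv, hv0⟩ := exists_ne_zero_of_three ![Y i, W j, Y (i + 1)]
    have : v ∈ LinearMap.ker (Y i') ⊓ LinearMap.ker (W j') := he ▸ ⟨hv0 0, hv0 1⟩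
    exact hv (h.eq_zero ha (i := i) (i' := i + 1) (by simp) hj (hv0 0) (hv0 2) (hv0 1) this.2)
  · obtain ⟨v, hv, hv0⟩ := exists_ne_zero_of_three ![Y i, W j, W (j + 1)]
    have : v ∈ LinearMap.ker (Y i') ⊓ LinearMap.ker (W j') := he ▸ ⟨hv0 0, hv0 1⟩
    exact hv (h.eq_zero ha (j := j) (j' := j + 1) hi (by simp) (hv0 0) this.1 (hv0 1) (hv0 2))

/-- On the plane `W j = 0` the cubic reduces to the product of the `Y i`. -/
theorem isTritangentPlane [Infinite k] (h : a.IsTrihedralPair Y W) (ha : a.Smooth) (j : Fin 3) :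
    IsTritangentPlane a.cubic (LinearMap.ker (W j)) := by
  refine ⟨fun i => LinearMap.ker (Y i) ⊓ LinearMap.ker (W j), finrank_ker (h.ne_zero ha j),
    fun i => h.finrank_ker_inf_ker ha i j, fun i i' he => ?_, Set.ext fun p => ?_⟩
  · exact congrArg Prod.fst (h.lines_injective ha (a₁ := (i, j)) (a₂ := (i', j)) he)
  · induction p using Projectivization.ind with
    | h v hv =>
      have hW : W j v = 0 → a.f v = ∏ i, Y i v := fun h0 => by
        rw [h v, add_eq_left]
        exact Finset.prod_eq_zero (Finset.mem_univ j) h0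
      rw [Set.mem_inter_iff, mk_mem_pts, mk_mem_zeroLocus a.cubic_isHomogeneous, eval_cubic]
      simp only [Set.mem_iUnion, mk_mem_pts, Submodule.mem_inf, LinearMap.mem_ker]
      constructor
      · rintro ⟨h0, hf⟩
        rw [hW h0, Finset.prod_eq_zero_iff] at hf
        obtain ⟨i, -, hi⟩ := hf
        exact ⟨i, hi, h0⟩
      · rintro ⟨i, hi, h0⟩
        exact ⟨h0, by rw [hW h0, Finset.prod_eq_zero (Finset.mem_univ i) hi]⟩

theorem isConjugateTriad [Infinite k] (h : a.IsTrihedralPair Y W) (ha : a.Smooth) :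
    IsConjugateTriad a.cubic (Set.range fun j => LinearMap.ker (W j)) := by
  refine ⟨_, fun i => LinearMap.ker (Y i), rfl, h.isTritangentPlane ha,
    h.symm.isTritangentPlane ha, fun i j => ⟨h.symm.finrank_ker_inf_ker ha i j, fun p hp => ?_⟩,
    h.symm.lines_injective ha⟩
  induction p using Projectivization.ind with
  | h v hv =>
    rw [mk_mem_pts] at hp
    have h1 : ∏ j, Y j v = 0 := Finset.prod_eq_zero (Finset.mem_univ j) hp.2
    have h2 : ∏ i, W i v = 0 := Finset.prod_eq_zero (Finset.mem_univ i) hp.1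
    rw [mk_mem_zeroLocus a.cubic_isHomogeneous, eval_cubic, h v, h1, h2, add_zero]

end IsTrihedralPair

theorem IsSplit.isTrihedralPair {t : Fin 3 → k} {A B : Module.Dual k (V4 k)}
    (h : a.IsSplit t A B) : a.IsTrihedralPair (planeForm t) ![LinearMap.proj 3, A, B] := fun v => by
  rw [f_eq t, h v, Fin.prod_univ_three (fun i => ![LinearMap.proj 3, A, B] i v)]
  simp [mul_assoc]

theorem range_ker_eq (A B : Module.Dual k (V4 k)) :
    (Set.range fun j => LinearMap.ker (![LinearMap.proj 3, A, B] j : Module.Dual k (V4 k))) =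
      {stdT k, LinearMap.ker A, LinearMap.ker B} := by
  ext P
  simp only [Set.mem_range, Fin.exists_fin_succ, Set.mem_insert_iff, Set.mem_singleton_iff]
  simp [stdT, eq_comm]

/-- The value of a Cremona quadric as a quadratic form. -/
noncomputable def quadricMap (a : Coef k) (t : Fin 3 → k) : QuadraticForm k (V4 k) :=
  QuadraticMap.ofPolar (fun v => eval v (a.quadric t))
    (fun r v => by rw [eval_smul_of_isHomogeneous (quadric_isHomogeneous t), smul_eq_mul, sq])
    (fun u v w => by
      simp only [QuadraticMap.polar, eval_quadric, q, Pi.add_apply]; ring)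
    (fun r u v => by
      simp only [QuadraticMap.polar, eval_quadric, q, Pi.add_apply, Pi.smul_apply, smul_eq_mul]
      ring)

theorem quadricMap_apply (t : Fin 3 → k) (v : V4 k) : a.quadricMap t v = eval v (a.quadric t) := rfl

end Coef

end CremonaQuartic

/-! ### Every conjugate triad through the plane `w = 0` comes from a split Cremona quadric. -/

namespace CremonaQuartic

variable {k : Type*} [Field k]

open MvPolynomial

namespace Coef

variable {a : Coef k}

theorem f_eq_zero_of_pts_subset {L : Submodule k (V4 k)} (h : pts L ⊆ zeroLocus a.cubic)
    {v : V4 k} (hv : v ∈ L) : a.f v = 0 := by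
  by_cases h0 : v = 0
  · rw [h0]; simp [f]
  · rw [← eval_cubic, ← mk_mem_zeroLocus a.cubic_isHomogeneous v h0]
    exact h ((mk_mem_pts L v h0).2 hv)

/-- On the plane `w = 0` the cubic is `x y z`. -/
theorem exists_eq_stdL [Infinite k] {L : Submodule k (V4 k)} (h : pts L ⊆ zeroLocus a.cubic)
    (hL : Module.finrank k L = 2) (hT : L ≤ stdT k) : ∃ i, L = stdL k i := by
  obtain ⟨i, hi⟩ := exists_le_ker_of_prod_eq_zero (L := L)
    (φ := fun i : Fin 3 => LinearMap.proj i.castSucc) fun v hv => by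
      have h1 := f_eq_zero_of_pts_subset h hv
      rw [f, mem_stdT.1 (hT hv), zero_mul, add_zero] at h1
      rw [Fin.prod_univ_three]
      exact h1
  exact ⟨i, Submodule.eq_of_le_of_finrank_eq (le_inf hi hT) (by rw [hL, finrank_stdL])⟩

/-- A Cremona quadric vanishes on the lines of the surface that lie in one of its three planes. -/
theorem quadricMap_eq_zero_of_mem (h2 : (2 : k) ≠ 0) {t : Fin 3 → k} {j : Fin 3}
    {L : Submodule k (V4 k)} (h : pts L ⊆ zeroLocus a.cubic) (hL : L ≤ LinearMap.ker (planeForm t j))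
    (hT : ¬ L ≤ stdT k) {v : V4 k} (hv : v ∈ L) : a.quadricMap t v = 0 := by
  have key : ∀ u ∈ L, u 3 ≠ 0 → a.quadricMap t u = 0 := fun u hu h3 => by
    have h1 := f_eq_zero_of_pts_subset h hu
    have h4 : ∏ i, planeForm t i u = 0 := Finset.prod_eq_zero (Finset.mem_univ j) (hL hu)
    rw [f_eq t, h4, zero_add, mul_eq_zero] at h1
    exact h1.resolve_left h3
  by_cases h3 : v 3 = 0
  -- For the point of `L` with `w = 0`, compare the values at `v + u` and `v - u`, which have `w ≠
  -- 0`, through the parallelogram identity.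
  · obtain ⟨u, hu, hu3⟩ := Set.not_subset.1 hT
    have hu3 : u 3 ≠ 0 := hu3
    have e0 := key u hu hu3
    have e1 := key (v + u) (L.add_mem hv hu) (by simpa [h3] using hu3)
    have e2 := key (v - u) (L.sub_mem hv hu) (by simpa [h3] using hu3)
    rw [QuadraticMap.map_add (a.quadricMap t), e0, add_zero] at e1
    rw [sub_eq_add_neg, QuadraticMap.map_add (a.quadricMap t), QuadraticMap.map_neg, e0, add_zero,
      QuadraticMap.polar_neg_right] at e2
    refine (mul_eq_zero.1 ?_).resolve_left h2
    linear_combination e1 + e2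
  · exact key v hv h3

/-- The planes `B j` have equations `X_j = x_j + t_j w`. The line `A m ⊓ B j` with `m ≠ 0` lies on
the cubic and in `X_j = 0` but not in `w = 0`, so `Q_t` vanishes on it. Three such lines in the
plane `A m` make `Q_t` vanish on `A m`, and a quadric containing the planes `A 1` and `A 2` is their
product. -/
theorem exists_isSplit_of_lines [Infinite k] (h2 : (2 : k) ≠ 0) (ha : a.Smooth)
    {A B : Fin 3 → Submodule k (V4 k)} (hA : ∀ i, Module.finrank k (A i) = 3)
    (hB : ∀ i, Module.finrank k (B i) = 3)
    (hAB : ∀ i j, Module.finrank k (A i ⊓ B j : Submodule k (V4 k)) = 2 ∧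
      pts (A i ⊓ B j) ⊆ zeroLocus a.cubic)
    (hinj : Function.Injective fun ij : Fin 3 × Fin 3 => A ij.1 ⊓ B ij.2)
    (h0 : A 0 = stdT k) (hl : ∀ j, stdT k ⊓ B j = stdL k j) :
    ∃ t α β, a.IsSplit t α β ∧ A 1 = LinearMap.ker α ∧ A 2 = LinearMap.ker β := by
  have hne : ∀ {i j i' j'}, (i, j) ≠ (i', j') → ¬ A i ⊓ B j ≤ A i' ⊓ B j' := fun hij hle =>
    hij (hinj (Submodule.eq_of_le_of_finrank_eq hle (by rw [(hAB _ _).1, (hAB _ _).1])))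
  have hBt : ∀ j, ∃ t : k, B j = LinearMap.ker
      (LinearMap.proj j.castSucc + t • LinearMap.proj 3 : Module.Dual k (V4 k)) := by
    intro j
    obtain ⟨φ, hφ0, hφ⟩ := exists_ker_of_finrank_eq_three (hB j)
    obtain ⟨c, s, hc, hs⟩ := exists_smul_planeForm hφ0 (i := j)
      (by rw [← hφ, ← hl]; exact inf_le_right) (by
        rw [← hφ]
        intro he
        have := finrank_stdL (k := k) j
        rw [← hl, he, inf_idem, finrank_stdT] at this
        omega)
    refine ⟨s, ?_⟩
    rw [hφ]
    ext v
    rw [LinearMap.mem_ker, hs, mul_eq_zero, or_iff_right hc]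
    rfl
  choose t ht using hBt
  replace ht : ∀ j, B j = LinearMap.ker (planeForm t j) := ht
  have hQ : ∀ m, m ≠ 0 → ∀ v ∈ A m, a.quadricMap t v = 0 := by
    intro m hm
    refine eq_zero_of_vanishing (φ := planeForm t) (fun j v hv hj => ?_) fun i j hij => ?_
    · have hvB : v ∈ B j := by rw [ht]; exact hj
      refine quadricMap_eq_zero_of_mem h2 (j := j) (hAB m j).2 (by rw [ht]; exact inf_le_right) ?_
        ⟨hv, hvB⟩
      intro hle
      exact hne (by simp [hm]) (le_inf (h0 ▸ hle) inf_le_right : _ ≤ A 0 ⊓ B j)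
    · by_contra! hcon
      refine hne (i := m) (j := i) (i' := m) (j' := j) (by simp [hij]) ?_
      refine le_inf inf_le_left fun v hv => ?_
      rw [ht] at hv ⊢
      exact hcon v hv.1 hv.2
  obtain ⟨α, hα0, hα⟩ := exists_ker_of_finrank_eq_three (hA 1)
  obtain ⟨β, hβ0, hβ⟩ := exists_ker_of_finrank_eq_three (hA 2)
  have hex : ∀ {i j} {φ ψ : Module.Dual k (V4 k)}, i ≠ j → A i = LinearMap.ker φ →
      A j = LinearMap.ker ψ → ∃ u ∈ (⊤ : Submodule k (V4 k)), φ u = 0 ∧ ψ u ≠ 0 := by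
    intro i j φ ψ hij hφ hψ
    by_contra! hcon
    refine hne (i := i) (j := 0) (i' := j) (j' := 0) (by simp [hij]) (inf_le_inf_right _ fun v hv => ?_)
    rw [hφ] at hv
    rw [hψ]
    exact hcon v trivial hv
  obtain ⟨c, hc⟩ := exists_eq_mul_of_vanishing (Q := a.quadricMap t) (W := ⊤) (φ := α) (ψ := β)
    (fun v _ hv => hQ 1 (by decide) v (by rw [hα]; exact hv))
    (fun v _ hv => hQ 2 (by decide) v (by rw [hβ]; exact hv)) (hex (by decide) hα hβ)
    (hex (by decide) hβ hα)
  have hc0 : c ≠ 0 := by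
    rintro rfl
    refine ha.quadric_ne_zero t (eq_of_eval_eq fun v => ?_)
    rw [← quadricMap_apply, hc v trivial, zero_mul, map_zero]
  refine ⟨t, c • α, β, fun v => ?_, ?_, hβ⟩
  · rw [← quadricMap_apply, hc v trivial, LinearMap.smul_apply, smul_eq_mul, mul_assoc]
  · rw [hα, LinearMap.ker_smul _ _ hc0]

theorem exists_isSplit_of_isConjugateTriad [Infinite k] (h2 : (2 : k) ≠ 0) (ha : a.Smooth)
    {τ : Set (Submodule k (V4 k))} (h : IsConjugateTriad a.cubic τ) (hT : stdT k ∈ τ) :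
    ∃ t A B, a.IsSplit t A B ∧ τ = {stdT k, LinearMap.ker A, LinearMap.ker B} := by
  obtain ⟨A, B, rfl, hA, hB, hAB, hinj⟩ := h
  obtain ⟨m, hm⟩ := hT
  have hline : ∀ j, ∃ i, A m ⊓ B j = stdL k i := fun j =>
    exists_eq_stdL (hAB m j).2 (hAB m j).1 (hm ▸ inf_le_left)
  choose σ hσ using hline
  have hσi : Function.Injective σ := fun i j hij =>
    congrArg Prod.snd (@hinj (m, i) (m, j) (by change A m ⊓ B i = A m ⊓ B j; rw [hσ, hσ, hij]))
  -- The `B j` cut the three sides of the triangle in some order. Reindexing by `e`, and the `A i`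
  -- by a transposition, brings the situation to that of `exists_isSplit_of_lines`.
  let e := Equiv.ofBijective σ (Finite.injective_iff_bijective.1 hσi)
  let s := Equiv.swap 0 m
  obtain ⟨t, α, β, hs, h1, h2⟩ := exists_isSplit_of_lines h2 ha (A := A ∘ s) (B := B ∘ e.symm)
    (fun i => (hA _).choose_spec.1) (fun i => (hB _).choose_spec.1) (fun i j => hAB _ _)
    (fun x y hxy => by
      have := hinj (a₁ := (s x.1, e.symm x.2)) (a₂ := (s y.1, e.symm y.2)) hxy
      simpa [Prod.ext_iff] using this)
    (by simp [s, hm]) (fun j => by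
      rw [← hm, Function.comp_apply, hσ]
      congr 1
      exact e.apply_symm_apply j)
  refine ⟨t, α, β, hs, ?_⟩
  rw [← EquivLike.range_comp A s, ← h1, ← h2, ← hm]
  ext P
  simp only [Set.mem_range, Fin.exists_fin_succ, Set.mem_insert_iff, Set.mem_singleton_iff]
  simp [s, eq_comm]

end Coef

end CremonaQuartic

/-! ### Counting triads, nodes and incidences by parameters. -/

namespace CremonaQuartic

variable {k : Type*} [Field k]

open MvPolynomial

theorem triadLine_insert {T U W : Submodule k (V4 k)} (hU : U ≠ T) (hW : W ≠ T) :
    triadLine T {T, U, W} = U ⊓ W := by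
  have : ({T, U, W} : Set (Submodule k (V4 k))) \ {T} = {U, W} := by
    ext P
    simp only [Set.mem_sdiff, Set.mem_insert_iff, Set.mem_singleton_iff]
    constructor
    · tauto
    · rintro (rfl | rfl) <;> tauto
  rw [triadLine, this, sInf_pair]

namespace Coef

variable {a : Coef k} {v : V4 k}

theorem Vertex.smul {i : Fin 3} {s : k} (h : a.Vertex i s v) (r : k) : a.Vertex i s (r • v) := by
  obtain ⟨e0, e1, e2, e3⟩ := h
  rw [Vertex, map_smul]
  simp only [q0, q1, q2, q3] at e1 e2 e3
  refine ⟨?_, ?_, ?_, ?_⟩ <;> simp only [Pi.smul_apply, smul_eq_mul, q0, q1, q2, q3]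
  · linear_combination r * e0
  · linear_combination r * e1
  · linear_combination r * e2
  · linear_combination r * e3

/-- The parameters of the planes of the `i`-th pencil that have a vertex. -/
def vertexPlanes (a : Coef k) (i : Fin 3) : Set k := {s | ∃ v, v ≠ 0 ∧ a.Vertex i s v}

theorem Smooth.ncard_vertexPlanes [IsAlgClosed k] (h2 : (2 : k) ≠ 0) (ha : a.Smooth) (i : Fin 3) :
    (a.vertexPlanes i).ncard = 4 := by
  rw [← (ha.rots i).ncard_vertex_planes h2]
  congr 1
  ext s
  constructor
  · rintro ⟨v, hv, h⟩
    exact ⟨rotsV i v, by simpa using hv, h⟩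
  · rintro ⟨v, hv, h⟩
    exact ⟨(rotsV i).symm v, by simpa using hv, by rwa [Vertex, LinearEquiv.apply_symm_apply]⟩

theorem IsSplit.symm {t : Fin 3 → k} {A B : Module.Dual k (V4 k)} (h : a.IsSplit t A B) :
    a.IsSplit t B A := fun v => by
  rw [h v, mul_comm]

/-- Factorisation of `Q_t` into two planes is unique up to order, so the parameters determine the
triad. -/
theorem IsSplit.ker_eq_or [Infinite k] (ha : a.Smooth) {t : Fin 3 → k}
    {A B A' B' : Module.Dual k (V4 k)} (h : a.IsSplit t A B) (h' : a.IsSplit t A' B') :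
    LinearMap.ker A' = LinearMap.ker A ∨ LinearMap.ker A' = LinearMap.ker B := by
  obtain ⟨i, hi⟩ := exists_le_ker_of_prod_eq_zero (L := LinearMap.ker A') (φ := ![A, B])
    fun v hv => by
      rw [Fin.prod_univ_two]
      change A v * B v = 0
      rw [← h v, h' v, LinearMap.mem_ker.1 hv, zero_mul]
  have h3 := finrank_ker (h'.isTrihedralPair.ne_zero ha 1)
  fin_cases i
  · exact Or.inl (Submodule.eq_of_le_of_finrank_eq hi
      (h3.trans (finrank_ker (h.isTrihedralPair.ne_zero ha 1)).symm))
  · exact Or.inr (Submodule.eq_of_le_of_finrank_eq hi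
      (h3.trans (finrank_ker (h.isTrihedralPair.ne_zero ha 2)).symm))

/-- The parameters of the split Cremona quadrics. -/
def splitParameters (a : Coef k) : Set (Fin 3 → k) := {t | ∃ A B, a.IsSplit t A B}

theorem injOn_splitParameters [IsAlgClosed k] (h2 : (2 : k) ≠ 0) (ha : a.Smooth) (i : Fin 3) :
    Set.InjOn (fun t : Fin 3 → k => (t i, t (i + 1))) a.splitParameters := by
  rintro t ⟨A, B, h⟩ t' ⟨A', B', h'⟩ he
  exact h.eq_of_eq h2 ha h' (Prod.ext_iff.1 he).1 (Prod.ext_iff.1 he).2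

/-- With `injOn_splitParameters` this is a bijection between split quadrics and pairs of vertex
planes from two pencils. All the counts rest on it. -/
theorem image_splitParameters [IsAlgClosed k] (h2 : (2 : k) ≠ 0) (ha : a.Smooth) (i : Fin 3) :
    (fun t : Fin 3 → k => (t i, t (i + 1))) '' a.splitParameters =
      a.vertexPlanes i ×ˢ a.vertexPlanes (i + 1) := by
  ext ⟨s, r⟩
  simp only [Set.mem_image, Set.mem_prod, Prod.mk.injEq]
  constructor
  · rintro ⟨t, ⟨A, B, h⟩, rfl, rfl⟩
    obtain ⟨n, hn, hnv, -⟩ := h.exists_vertex h2 i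
    obtain ⟨m, hm, hmv, -⟩ := h.exists_vertex h2 (i + 1)
    exact ⟨⟨n, hn, hnv⟩, ⟨m, hm, hmv⟩⟩
  · rintro ⟨⟨n, hn, hnv⟩, ⟨m, hm, hmv⟩⟩
    obtain ⟨t, A, B, h, hs, hr⟩ := exists_isSplit h2 i ha hnv hn hmv hm
    exact ⟨t, ⟨A, B, h⟩, hs, hr⟩

theorem Smooth.ncard_splitParameters [IsAlgClosed k] (h2 : (2 : k) ≠ 0) (ha : a.Smooth) :
    a.splitParameters.ncard = 16 := by
  rw [← (injOn_splitParameters h2 ha 0).ncard_image, image_splitParameters h2 ha,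
    Set.ncard_prod, ha.ncard_vertexPlanes h2, ha.ncard_vertexPlanes h2]

theorem Smooth.ncard_splitParameters_fiber [IsAlgClosed k] (h2 : (2 : k) ≠ 0) (ha : a.Smooth)
    {i : Fin 3} {s : k} (hs : s ∈ a.vertexPlanes i) :
    {t ∈ a.splitParameters | t i = s}.ncard = 4 := by
  rw [← ((injOn_splitParameters h2 ha i).mono (Set.sep_subset _ _)).ncard_image]
  have : (fun t : Fin 3 → k => (t i, t (i + 1))) '' {t ∈ a.splitParameters | t i = s} =
      {s} ×ˢ a.vertexPlanes (i + 1) := by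
    have himg := image_splitParameters h2 ha i
    ext ⟨s', r⟩
    have := Set.ext_iff.1 himg (s', r)
    simp only [Set.mem_image, Set.mem_prod, Prod.mk.injEq, Set.mem_ofPred,
      Set.mem_singleton_iff] at this ⊢
    constructor
    · rintro ⟨t, ⟨ht, rfl⟩, rfl, rfl⟩
      exact ⟨rfl, (this.1 ⟨t, ht, rfl, rfl⟩).2⟩
    · rintro ⟨rfl, hr⟩
      obtain ⟨t, ht, h1, h2⟩ := this.2 ⟨hs, hr⟩
      exact ⟨t, ⟨ht, h1⟩, h1, h2⟩
  rw [this, Set.ncard_prod, Set.ncard_singleton, ha.ncard_vertexPlanes h2]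

/-- A model of the configuration: a node is a pencil with the parameter of a vertex plane, a line is
the triple of parameters of a split quadric, and incidence is equality of the parameter in that
pencil. -/
theorem isConfiguration_splitParameters [IsAlgClosed k] (h2 : (2 : k) ≠ 0) (ha : a.Smooth) :
    IsConfiguration {p : Fin 3 × k | p.2 ∈ a.vertexPlanes p.1} a.splitParameters
      (fun p t => t p.1 = p.2) 12 4 16 3 := by
  refine ⟨?_, ha.ncard_splitParameters h2, fun p hp => ha.ncard_splitParameters_fiber h2 hp, ?_⟩
  · have hfin : ∀ i, Finite (a.vertexPlanes i) := fun i =>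
      Set.finite_of_ncard_ne_zero (by rw [ha.ncard_vertexPlanes h2]; norm_num)
    rw [← Nat.card_coe_set_eq]
    refine (Nat.card_congr (Equiv.subtypeProdEquivSigmaSubtype
      fun i s => s ∈ a.vertexPlanes i)).trans ?_
    rw [Nat.card_sigma]
    simp only [Fin.sum_univ_three]
    change (a.vertexPlanes 0).ncard + (a.vertexPlanes 1).ncard + (a.vertexPlanes 2).ncard = 12
    simp only [ha.ncard_vertexPlanes h2]
  · rintro t ⟨A, B, h⟩
    have : {p ∈ {p : Fin 3 × k | p.2 ∈ a.vertexPlanes p.1} | t p.1 = p.2} =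
        Set.range fun i => (i, t i) := by
      ext ⟨i, s⟩
      simp only [Set.mem_ofPred, Set.mem_range, Prod.mk.injEq]
      constructor
      · rintro ⟨-, rfl⟩; exact ⟨i, rfl, rfl⟩
      · rintro ⟨i, rfl, rfl⟩
        obtain ⟨n, hn, hnv, -⟩ := h.exists_vertex h2 i
        exact ⟨⟨n, hn, hnv⟩, rfl⟩
    rw [this, Set.ncard_range_of_injective fun i j hij => (Prod.ext_iff.1 hij).1,
      Nat.card_eq_fintype_card, Fintype.card_fin]

/-- The maps `ν` (the vertex of a plane), `τ` (the triad of a split quadric) and `L` (its singular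
line) carry the model by parameters to the actual nodes, triads and lines. -/
theorem steinerianIsNodalQuartic [IsAlgClosed k] (h2 : (2 : k) ≠ 0) (ha : a.Smooth) :
    SteinerianIsNodalQuartic a.cubic (stdT k) (stdL k) := by
  have hR : ∀ t ∈ a.splitParameters, ∃ A B, a.IsSplit t A B := fun t ht => ht
  choose! A B hAB using hR
  have hI : ∀ p : Fin 3 × k, p.2 ∈ a.vertexPlanes p.1 → ∃ (x : P3 k) (v : V4 k) (hv : v ≠ 0),
      x = Projectivization.mk k v hv ∧ a.Vertex p.1 p.2 v := by
    rintro p ⟨v, hv, h⟩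
    exact ⟨_, v, hv, rfl, h⟩
  choose! ν hν using hI
  set τ : (Fin 3 → k) → Set (Submodule k (V4 k)) :=
    fun t => {stdT k, LinearMap.ker (A t), LinearMap.ker (B t)}
  set L : (Fin 3 → k) → Submodule k (V4 k) := fun t => LinearMap.ker (A t) ⊓ LinearMap.ker (B t)
  have hker : ∀ t ∈ a.splitParameters, Function.Injective fun j => LinearMap.ker
      (![LinearMap.proj 3, A t, B t] j : Module.Dual k (V4 k)) := fun t ht =>
    (hAB t ht).isTrihedralPair.ker_injective ha
  have hline : ∀ t ∈ a.splitParameters, triadLine (stdT k) (τ t) = L t := fun t ht =>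
    triadLine_insert ((hker t ht).ne (by decide : (1 : Fin 3) ≠ 0))
      ((hker t ht).ne (by decide : (2 : Fin 3) ≠ 0))
  have hL : Set.InjOn L a.splitParameters := fun t ht t' ht' he =>
    (hAB t ht).parameters_unique h2 ha (hAB t' ht') fun v hA hB => by
      have : v ∈ L t := ⟨hA, hB⟩
      rw [he] at this
      exact this
  have htriads : triadsThrough a.cubic (stdT k) = τ '' a.splitParameters := by
    ext σ
    constructor
    · rintro ⟨h, hT⟩
      obtain ⟨t, A', B', h', rfl⟩ := exists_isSplit_of_isConjugateTriad h2 ha h hT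
      have ht : t ∈ a.splitParameters := ⟨A', B', h'⟩
      refine ⟨t, ht, ?_⟩
      -- The chosen factors of `Q_t` and those of the given triad are the same two planes, possibly
      -- interchanged.
      have e1 := (hAB t ht).ker_eq_or ha h'
      have e2 := (hAB t ht).ker_eq_or ha h'.symm
      have e3 := h'.ker_eq_or ha (hAB t ht)
      have e4 := h'.ker_eq_or ha (hAB t ht).symm
      ext P
      simp only [τ, Set.mem_insert_iff, Set.mem_singleton_iff]
      constructor
      · rintro (h | rfl | rfl)
        exacts [Or.inl h, Or.inr e3, Or.inr e4]
      · rintro (h | rfl | rfl)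
        exacts [Or.inl h, Or.inr e1, Or.inr e2]
    · rintro ⟨t, ht, rfl⟩
      refine ⟨?_, Set.mem_insert _ _⟩
      have := (hAB t ht).isTrihedralPair.isConjugateTriad ha
      rwa [range_ker_eq] at this
  have hτ : Set.InjOn τ a.splitParameters := fun t ht t' ht' he =>
    hL ht ht' (by rw [← hline t ht, he, hline t' ht'])
  have hlines : triadLine (stdT k) '' triadsThrough a.cubic (stdT k) = L '' a.splitParameters := by
    rw [htriads, Set.image_image]
    exact Set.image_congr hline
  have hnodes : singularPoints a.quartic =
      ν '' {p : Fin 3 × k | p.2 ∈ a.vertexPlanes p.1} := by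
    ext x
    constructor
    · induction x using Projectivization.ind with
      | h u hu =>
        intro hx
        obtain ⟨i, s, h⟩ := exists_vertex_of_singularAt h2 ha hu
          ((mk_mem_singularPoints_quartic hu).1 hx)
        have hp : s ∈ a.vertexPlanes i := ⟨u, hu, h⟩
        obtain ⟨v, hv, hx, hvv⟩ := hν (i, s) hp
        refine ⟨(i, s), hp, ?_⟩
        rw [hx, Projectivization.mk_eq_mk_iff']
        obtain ⟨r, hr⟩ := h.eq_smul h2 ha hu hvv
        exact ⟨r, hr.symm⟩
    · rintro ⟨p, hp, rfl⟩
      obtain ⟨v, hv, hx, hvv⟩ := hν p hp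
      rw [hx, mk_mem_singularPoints_quartic]
      exact singularAt_of_vertex h2 hvv
  refine ⟨a.quartic, a.quartic_isHomogeneous, ha.irreducible_quartic h2, steinerian_eq h2 ha,
    isNode_of_mem_singularPoints h2 ha, ?_, ?_, ?_, ?_⟩
  · rw [htriads, hτ.ncard_image, ha.ncard_splitParameters h2]
  · rw [htriads]
    rintro _ ⟨t, ht, rfl⟩ _ ⟨t', ht', rfl⟩ he
    rw [hline t ht, hline t' ht'] at he
    rw [hL ht ht' he]
  · rw [hlines, steinerian_eq h2 ha]
    rintro _ ⟨t, ht, rfl⟩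
    refine ⟨finrank_inf_eq_two (finrank_ker ((hAB t ht).isTrihedralPair.ne_zero ha 1))
      (finrank_ker ((hAB t ht).isTrihedralPair.ne_zero ha 2))
      ((hker t ht).ne (by decide : (1 : Fin 3) ≠ 2)), fun x hx => ?_⟩
    induction x using Projectivization.ind with
    | h v hv =>
      rw [mk_mem_pts] at hx
      rw [mk_mem_zeroLocus a.quartic_isHomogeneous, eval_quartic]
      exact g_eq_zero_of_cremonaSingular h2 ((hAB t ht).cremonaSingular h2 hx.1 hx.2)
  · rw [hlines, hnodes]
    refine (isConfiguration_splitParameters h2 ha).image (fun p hp p' hp' he => ?_) hL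
      fun p hp t ht => ?_
    · obtain ⟨v, hv, hx, hvv⟩ := hν p hp
      obtain ⟨v', hv', hx', hvv'⟩ := hν p' hp'
      rw [hx, hx', Projectivization.mk_eq_mk_iff'] at he
      obtain ⟨r, rfl⟩ := he
      have := hvv.unique h2 ha (hvv'.smul r) hv
      exact Prod.ext this.1 this.2
    · obtain ⟨v, hv, hx, hvv⟩ := hν p hp
      rw [hx, mk_mem_pts]
      exact (hAB t ht).vertex_mem_iff h2 ha hvv hv

end Coef

end CremonaQuartic

/-! ### Reduction of an arbitrary smooth cubic with a triangle to the normal form. -/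

namespace CremonaQuartic

variable {k : Type*} [Field k]

open MvPolynomial

section NormalForm

theorem isHomogeneous_of_X_mul {i : Fin 4} {g : Form k} {n : ℕ}
    (h : (X i * g).IsHomogeneous (n + 1)) : g.IsHomogeneous n := by
  intro d hd
  have := h (d := Finsupp.single i 1 + d) (by rwa [coeff_X_mul])
  rw [map_add, Finsupp.weight_single] at this
  simp only [Pi.one_apply, smul_eq_mul, mul_one] at this
  omega

/-- A form of degree two in characteristic different from two, by coefficients. -/
theorem exists_eq_q (h2 : (2 : k) ≠ 0) {g : Form k} (hg : g.IsHomogeneous 2) :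
    ∃ a : Coef k, ∀ v, eval v g = a.q v := by
  have h : ∀ i, ∃ φ, pderiv i g = lin φ := fun i => exists_eq_lin hg.pderiv
  choose φ hφ using h
  set e : Fin 4 → V4 k := fun i => Pi.single i 1
  -- The coefficients are read off from Euler's relation, which expresses `2 g` by the linear forms
  -- `∂_i g`.
  refine ⟨⟨φ 0 (e 0) / 2, φ 1 (e 1) / 2, φ 2 (e 2) / 2, (φ 1 (e 2) + φ 2 (e 1)) / 2,
    (φ 0 (e 2) + φ 2 (e 0)) / 2, (φ 0 (e 1) + φ 1 (e 0)) / 2, (φ 0 (e 3) + φ 3 (e 0)) / 2,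
    (φ 1 (e 3) + φ 3 (e 1)) / 2, (φ 2 (e 3) + φ 3 (e 2)) / 2, φ 3 (e 3) / 2⟩, fun v => ?_⟩
  have := congrArg (eval v) hg.sum_X_mul_pderiv
  simp only [hφ, lin, Fin.sum_univ_four, map_add, map_mul, eval_X, eval_C, map_nsmul] at this
  refine mul_left_cancel₀ h2 ?_
  rw [Coef.q]
  field_simp
  rw [nsmul_eq_mul] at this
  push_cast at this
  linear_combination -this

/-- The cubic surfaces that meet the plane `w = 0` in the triangle `x y z = 0`. -/
theorem exists_normal_form [IsAlgClosed k] (h2 : (2 : k) ≠ 0) {f : Form k} (hf : f.IsHomogeneous 3)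
    (h : IsTritangentWith f (stdT k) (stdL k)) :
    ∃ (c : k) (a : Coef k), c ≠ 0 ∧ ∀ v, eval v f = c * (v 0 * v 1 * v 2) + v 3 * a.q v := by
  have hz : ∀ v : V4 k, v 3 = 0 → (eval v f = 0 ↔ ∃ i : Fin 3, v i.castSucc = 0) := by
    intro v hv
    by_cases h0 : v = 0
    · subst h0
      have := eval_smul_of_isHomogeneous hf 0 (0 : V4 k)
      rw [zero_smul, zero_pow (by norm_num), zero_mul] at this
      rw [this]
      simp
    · have := Set.ext_iff.1 h.2.2.2 (Projectivization.mk k v h0)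
      simpa only [Set.mem_inter_iff, Set.mem_iUnion, mk_mem_pts, mk_mem_zeroLocus hf, mem_stdT,
        mem_stdL, hv, true_and, and_true] using this
  -- Projection to the plane `w = 0`, so that `r` is `f` with `w` set to zero. It vanishes on `x =
  -- 0`, `y = 0` and `z = 0`, hence is `c x y z`, and `f - r` is divisible by `w`.
  let π : V4 k →ₗ[k] V4 k := LinearMap.id - (LinearMap.proj 3 : V4 k →ₗ[k] k).smulRight (Pi.single 3 1)
  have hπ : ∀ v i, π v i = if i = 3 then 0 else v i := by
    intro v i
    fin_cases i <;> simp [π]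
  set r := pull π f with hr
  have hrf : ∀ v, eval v r = eval (π v) f := eval_pull π f
  have hX : ∀ i : Fin 4, Irreducible (X i : Form k) := fun i => (X_prime).irreducible
  have hdvd : ∀ i : Fin 3, X i.castSucc ∣ r := fun i =>
    dvd_of_forall_eval_eq_zero (hX _) fun v hv => by
      rw [hrf, hz _ (by simp [hπ])]
      refine ⟨i, ?_⟩
      rw [hπ, if_neg (Fin.castSucc_lt_last i).ne (c := i.castSucc = 3)]
      simpa using hv
  have hnd : ∀ {i j : Fin 4}, i ≠ j → ¬ (X i : Form k) ∣ X j := fun hij hd => hij (X_dvd_X.1 hd)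
  obtain ⟨r0, e0⟩ := hdvd 0
  have hd1 := hdvd 1
  have hd2 := hdvd 2
  rw [e0] at hd1 hd2
  obtain ⟨r1, e1⟩ := ((X_prime).dvd_or_dvd hd1).resolve_left (hnd (by decide))
  replace hd2 := ((X_prime).dvd_or_dvd hd2).resolve_left (hnd (by decide))
  rw [e1] at hd2
  obtain ⟨r2, e2⟩ := ((X_prime).dvd_or_dvd hd2).resolve_left (hnd (by decide))
  have hr3 := pull_isHomogeneous π hf
  rw [← hr, e0, e1, e2] at hr3
  obtain ⟨c, rfl⟩ := exists_eq_C_of_isHomogeneous_zero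
    (isHomogeneous_of_X_mul (isHomogeneous_of_X_mul (isHomogeneous_of_X_mul hr3)))
  have hrc : ∀ v, eval v r = c * (v 0 * v 1 * v 2) := by
    intro v
    rw [e0, e1, e2]
    simp only [map_mul, eval_X, eval_C]
    change v 0 * (v 1 * (v 2 * c)) = _
    ring
  obtain ⟨g, hg⟩ : X 3 ∣ f - r := dvd_of_forall_eval_eq_zero (hX 3) fun v hv => by
    have : π v = v := by
      ext i
      rw [hπ]
      split_ifs with h3
      · rw [h3]; simpa using hv.symm
      · rfl
    rw [map_sub, hrf, this, sub_self]
  have hgh : g.IsHomogeneous 2 := isHomogeneous_of_X_mul (i := 3) (hg ▸ hf.sub (pull_isHomogeneous π hf))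
  obtain ⟨a, ha⟩ := exists_eq_q h2 hgh
  have hfv : ∀ v, eval v f = c * (v 0 * v 1 * v 2) + v 3 * a.q v := fun v => by
    rw [← hrc, ← ha, ← eval_X (f := v) 3, ← map_mul, ← hg, ← map_add]
    ring_nf
  refine ⟨c, a, ?_, hfv⟩
  rintro rfl
  -- With `c = 0` the whole plane would lie on the surface, including points off the triangle.
  obtain ⟨i, hi⟩ := (hz ![1, 1, 1, 0] rfl).1 (by rw [hfv]; simp)
  fin_cases i <;> simp at hi

/-- Multiplication of the first coordinate by a nonzero constant. -/
def scaleV (c : k) (hc : c ≠ 0) : V4 k ≃ₗ[k] V4 k where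
  toFun v := ![c * v 0, v 1, v 2, v 3]
  invFun v := ![c⁻¹ * v 0, v 1, v 2, v 3]
  map_add' u v := by ext i; fin_cases i <;> simp [mul_add]
  map_smul' r v := by ext i; fin_cases i <;> simp [mul_left_comm]
  left_inv v := by ext i; fin_cases i <;> simp [hc]
  right_inv v := by ext i; fin_cases i <;> simp [hc]

theorem scaleV_apply (c : k) (hc : c ≠ 0) (v : V4 k) :
    scaleV c hc v = ![c * v 0, v 1, v 2, v 3] := rfl

theorem steinerianIsNodalQuartic_std [IsAlgClosed k] (h2 : (2 : k) ≠ 0) {f : Form k}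
    (hf : IsSmoothCubic f) (h : IsTritangentWith f (stdT k) (stdL k)) :
    SteinerianIsNodalQuartic f (stdT k) (stdL k) := by
  obtain ⟨c, a, hc, ha⟩ := exists_normal_form h2 hf.1 h
  -- Rescaling `x` absorbs the constant `c` and preserves the coordinate triangle.
  let φ := scaleV c⁻¹ (inv_ne_zero hc)
  let b : Coef k := ⟨a.d0 * c⁻¹ ^ 2, a.d1, a.d2, a.m0, a.m1 * c⁻¹, a.m2 * c⁻¹, a.b0 * c⁻¹, a.b1,
    a.b2, a.c⟩
  have hb : pull φ.toLinearMap f = b.cubic := eq_of_eval_eq fun v => by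
    rw [eval_pull, ha, Coef.eval_cubic]
    simp only [φ, LinearEquiv.coe_coe, scaleV_apply, Coef.f, Coef.q, b, Matrix.cons_val]
    field_simp
  have hT : cmap φ (stdT k) = stdT k := rfl
  have hL : ∀ i, cmap φ (stdL k i) = stdL k i := by
    intro i
    ext v
    rw [mem_cmap, mem_stdL, mem_stdL]
    fin_cases i <;> simp [φ, scaleV_apply, hc]
  refine SteinerianIsNodalQuartic.of_pull φ hf.1 ?_
  rw [hb, hT]
  simp only [hL]
  exact Coef.steinerianIsNodalQuartic h2 (b.smooth_iff.1 (hb ▸ isSmoothCubic_pull φ hf))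

/-- A triangle of lines in a plane is the image of the coordinate triangle under an automorphism
of the space. -/
theorem exists_linearEquiv_of_triangle {T : Submodule k (V4 k)} {l : Fin 3 → Submodule k (V4 k)}
    (hT : Module.finrank k T = 3) (hl : ∀ i, Module.finrank k (l i) = 2) (hlT : ∀ i, l i ≤ T)
    (h : ⋂ i, pts (l i) = ∅) :
    ∃ φ : V4 k ≃ₗ[k] V4 k, cmap φ T = stdT k ∧ ∀ i, cmap φ (l i) = stdL k i := by
  -- Two lines of the plane meet, so each `v i` is the corner opposite to `l i`. Since the lines
  -- have no common point, `v i` is not on `l i`; this makes the corners, together with a vector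
  -- outside `T`, a basis.
  have hv : ∀ i : Fin 3, ∃ v, v ≠ 0 ∧ ∀ j, j ≠ i → v ∈ l j := by
    intro i
    have h1 := Submodule.finrank_sup_add_finrank_inf_eq (l (i + 1)) (l (i + 2))
    have h3 := Submodule.finrank_mono (sup_le (hlT (i + 1)) (hlT (i + 2)))
    rw [hl, hl] at h1
    have hne : l (i + 1) ⊓ l (i + 2) ≠ ⊥ := by
      intro h0
      rw [h0, finrank_bot] at h1
      omega
    obtain ⟨v, hv, hv0⟩ := (Submodule.ne_bot_iff _).1 hne
    refine ⟨v, hv0, fun j hj => ?_⟩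
    have : ∀ i j : Fin 3, j ≠ i → j = i + 1 ∨ j = i + 2 := by decide
    rcases this i j hj with rfl | rfl
    exacts [hv.1, hv.2]
  choose v hv0 hvl using hv
  have hvn : ∀ i, v i ∉ l i := by
    intro i hi
    have : Projectivization.mk k (v i) (hv0 i) ∈ ⋂ j, pts (l j) := by
      refine Set.mem_iInter.2 fun j => (mk_mem_pts _ _ _).2 ?_
      by_cases hj : j = i
      · rw [hj]; exact hi
      · exact hvl i j hj
    rw [h] at this
    exact this
  have hvT : ∀ i, v i ∈ T := fun i => hlT (i + 1) (hvl i (i + 1) (by simp))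
  obtain ⟨w, hw⟩ : ∃ w, w ∉ T := by
    by_contra! hall
    rw [Submodule.eq_top_iff'.2 hall, finrank_top, Module.finrank_fin_fun] at hT
    omega
  let ψ : V4 k →ₗ[k] V4 k := (∑ i : Fin 3, (LinearMap.proj i.castSucc : V4 k →ₗ[k] k).smulRight (v i))
    + (LinearMap.proj 3 : V4 k →ₗ[k] k).smulRight w
  have hψ : ∀ u, ψ u = (∑ i : Fin 3, u i.castSucc • v i) + u 3 • w := fun u => by
    simp [ψ, LinearMap.sum_apply]
  have hψT : ∀ u, ψ u ∈ T ↔ u 3 = 0 := fun u => by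
    rw [hψ, Submodule.add_mem_iff_right _ (T.sum_mem fun i _ => T.smul_mem _ (hvT i))]
    by_cases h3 : u 3 = 0
    · simp [h3]
    · rw [Submodule.smul_mem_iff _ h3]
      simp [hw, h3]
  have hψl : ∀ u i, ψ u ∈ l i ↔ u i.castSucc = 0 ∧ u 3 = 0 := fun u i => by
    rw [and_comm, ← and_iff_right_of_imp (fun hu => (hψT u).1 (hlT i hu) : ψ u ∈ l i → u 3 = 0)]
    refine and_congr_right fun h3 => ?_
    rw [hψ, h3, zero_smul, add_zero, ← Finset.add_sum_erase _ _ (Finset.mem_univ i),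
      Submodule.add_mem_iff_left _ (Submodule.sum_mem _ fun j hj =>
        Submodule.smul_mem _ _ (hvl j i (Finset.ne_of_mem_erase hj).symm))]
    by_cases h0 : u i.castSucc = 0
    · simp [h0]
    · rw [Submodule.smul_mem_iff _ h0]
      simp [hvn, h0]
  have hinj : Function.Injective ψ := by
    rw [injective_iff_map_eq_zero]
    intro u hu
    have hi : ∀ i : Fin 3, u i.castSucc = 0 ∧ u 3 = 0 := fun i => by
      rw [← hψl, hu]; exact Submodule.zero_mem _
    ext j
    induction j using Fin.lastCases with
    | last => exact (hi 0).2
    | cast i => exact (hi i).1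
  refine ⟨LinearEquiv.ofInjectiveEndo ψ hinj, ?_, fun i => ?_⟩
  · ext u
    exact hψT u
  · ext u
    exact hψl u i

end NormalForm

end CremonaQuartic

theorem mainTheorem8 {k : Type*} [Field k] [IsAlgClosed k] (h2 : (2 : k) ≠ 0)
    (f : CremonaQuartic.Form k) (hf : CremonaQuartic.IsSmoothCubic f)
    (T : Submodule k (CremonaQuartic.V4 k)) (l : Fin 3 → Submodule k (CremonaQuartic.V4 k))
    (hT : CremonaQuartic.IsTritangentWith f T l)
    (hl : ⋂ i, CremonaQuartic.pts (l i) = ∅) :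
    ∃ G : CremonaQuartic.Form k,
      G.IsHomogeneous 4 ∧ Irreducible G ∧
      CremonaQuartic.steinerian f T l = CremonaQuartic.zeroLocus G ∧
      (∀ p ∈ CremonaQuartic.singularPoints G, CremonaQuartic.IsNode G p) ∧
      (CremonaQuartic.triadsThrough f T).ncard = 16 ∧
      Set.InjOn (CremonaQuartic.triadLine T) (CremonaQuartic.triadsThrough f T) ∧
      (∀ L ∈ CremonaQuartic.triadLine T '' CremonaQuartic.triadsThrough f T,
        Module.finrank k L = 2 ∧ CremonaQuartic.pts L ⊆ CremonaQuartic.steinerian f T l) ∧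
      CremonaQuartic.IsConfiguration
        (CremonaQuartic.singularPoints G)
        (CremonaQuartic.triadLine T '' CremonaQuartic.triadsThrough f T)
        (fun p L => p ∈ CremonaQuartic.pts L) 12 4 16 3 := by
  have hlT : ∀ i, l i ≤ T := fun i => CremonaQuartic.le_of_pts_subset fun p hp => by
    have : p ∈ ⋃ i, CremonaQuartic.pts (l i) := Set.mem_iUnion.2 ⟨i, hp⟩
    rw [← hT.2.2.2] at this
    exact this.1
  obtain ⟨φ, h1, h3⟩ := CremonaQuartic.exists_linearEquiv_of_triangle hT.1 hT.2.1 hlT hl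
  have htr := CremonaQuartic.isTritangentWith_pull φ hf.1 hT
  rw [h1, funext h3] at htr
  refine CremonaQuartic.SteinerianIsNodalQuartic.of_pull φ hf.1 ?_
  rw [h1, funext h3]
  exact CremonaQuartic.steinerianIsNodalQuartic_std h2 (CremonaQuartic.isSmoothCubic_pull φ hf) htr
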